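/- Let $m,n\ge 0$ be integers with $m+n>0$. **Alphabet, weights, crystals.** Let $\mathbf B=\{\overline m<\cdots<\overline 1<1<\cdots<n\}$, with $|b|=0$ for barred and $|b|=1$ for unbarred letters. Let $P=\bigoplus_{b\in\mathbf B}\mathbb Z\epsilon_b$ with the symmetric form $(\epsilon_b,\epsilon_{b'})=(-1)^{|b|}\delta_{bb'}$. Let $I=\{\overline{m-1},\dots,\overline 1,0,1,\dots,n-1\}$, where the index $0$ is present only if $m,n\ge 1$. Put $\alpha_{\overline k}=\epsilon_{\overline{k+1}}-\epsilon_{\overline k}$, $\alpha_0=\epsilon_{\overline 1}-\epsilon_1$, $\alpha_l=\epsilon_l-\epsilon_{l+1}$, and $\langle h_i,\lambda\rangle=(\alpha_i,\lambda)$ for $i=\overline{m-1},\dots,\overline 1,0$, $\langle h_i,\lambda\rangle=-(\alpha_i,\lambda)$ for $i=1,\dots,n-1$. A $\mathfrak{gl}_{m|n}$-crystal is a set $B$ with maps $\mathrm{wt}:B\to P$, $\varepsilon_i,\varphi_i:B\to\mathbb Z_{\ge0}$, $e_i,f_i:B\to B\sqcup\{0\}$ $(i\in I)$ such that - (a) $\varphi_i(b)-\varepsilon_i(b)=\langle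 h_i,\mathrm{wt}(b)\rangle$ for $i\ne0$; $\langle h_0,\mathrm{wt}(b)\rangle\ge0$, and $\varphi_0(b)+\varepsilon_0(b)$ is $0$ if $\langle h_0,\mathrm{wt}(b)\rangle=0$ and $1$ otherwise; - (b) if $e_ib\in B$, then $\varepsilon_i(e_ib)=\varepsilon_i(b)-1$, $\varphi_i(e_ib)=\varphi_i(b)+1$, $\mathrm{wt}(e_ib)=\mathrm{wt}(b)+\alpha_i$; - (c) if $f_ib\in B$, then $\varepsilon_i(f_ib)=\varepsilon_i(b)+1$, $\varphi_i(f_ib)=\varphi_i(b)-1$, $\mathrm{wt}(f_ib)=\mathrm{wt}(b)-\alpha_i$; - (d) for $b,b'\in B$, $f_ib=b'$ if and only if $e_ib'=b$. An isomorphism of crystals is a bijection that is an isomorphism of $I$-coloured oriented graphs (with arrows $b\xrightarrow{i}f_ib$) and preserves $\mathrm{wt},\varepsilon_i,\varphi_i$. A direct sum is a disjoint union. **Tensor products and words.** The set $B_1\otimes B_2=B_1\times B_2$ has $\mathrm{wt}(b_1\otimes b_2)=\mathrm{wt}(b_1)+\mathrm{wt}(b_2)$ and the following structure (with $0\otimes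 b_2=b_1\otimes0=0$). - For $i=\overline{m-1},\dots,\overline1$: $\varepsilon_i(b_1\otimes b_2)=\max(\varepsilon_i(b_1),\varepsilon_i(b_2)-\langle h_i,\mathrm{wt}(b_1)\rangle)$ and $\varphi_i(b_1\otimes b_2)=\max(\varphi_i(b_1)+\langle h_i,\mathrm{wt}(b_2)\rangle,\varphi_i(b_2))$; $e_i$ acts on $b_1$ if $\varphi_i(b_1)\ge\varepsilon_i(b_2)$ and on $b_2$ otherwise; $f_i$ acts on $b_1$ if $\varphi_i(b_1)>\varepsilon_i(b_2)$ and on $b_2$ otherwise. - For $i=1,\dots,n-1$: $\varepsilon_i(b_1\otimes b_2)=\max(\varepsilon_i(b_1)-\langle h_i,\mathrm{wt}(b_2)\rangle,\varepsilon_i(b_2))$ and $\varphi_i(b_1\otimes b_2)=\max(\varphi_i(b_1),\varphi_i(b_2)+\langle h_i,\mathrm{wt}(b_1)\rangle)$; $e_i$ acts on $b_1$ if $\varphi_i(b_2)<\varepsilon_i(b_1)$ and on $b_2$ otherwise; $f_i$ acts on $b_1$ if $\varphi_i(b_2)\le\varepsilon_i(b_1)$ and on $b_2$ otherwise. - For $i=0$: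 if $\langle h_0,\mathrm{wt}(b_1)\rangle>0$, then $\varepsilon_0,\varphi_0$ of $b_1\otimes b_2$ are those of $b_1$ and $e_0,f_0$ act on $b_1$; otherwise the same holds with $b_2$. The letters form a crystal with $\mathrm{wt}(b)=\epsilon_b$ and arrows $\overline m\xrightarrow{\overline{m-1}}\cdots\xrightarrow{\overline1}\overline1\xrightarrow{0}1\xrightarrow{1}\cdots\xrightarrow{n-1}n$, where $\varepsilon_i(b)$, $\varphi_i(b)$ count the $i$-arrows into and out of $b$. The set $\mathcal W$ of finite words becomes a crystal by identifying $w_1\cdots w_r$ with $w_1\otimes\cdots\otimes w_r$; the empty word has weight $0$, $\varepsilon_i=\varphi_i=0$ and $e_i=f_i=0$. **Tableaux.** Let $\mathcal P_{m|n}$ be the set of partitions $\lambda$ with $\lambda_{m+1}\le n$. For $\lambda\in\mathcal P_{m|n}$ let $\mathbf B_{m|n}(\lambda)$ be the set of fillings of the Young diagram of $\lambda$ by letters that weakly increase along rows (left to right) and columns (top to bottom), such that barred letters strictly increase in each column and unbarred letters strictly increase in each row. View it as a subset of $\mathcal W$ by reading the columns from right to left, each from top to bottom. **Matrices.** Let $\mathbf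 M$ be the set of matrices $A=(a_{bb'})_{b,b'\in\mathbf B}$ of non-negative integers with $a_{bb'}\le1$ if $|b|\ne|b'|$. Order pairs of letters by: $(b,b')<(c,c')$ if $b'<c'$, or $b'=c'$, $|b'|=0$ and $b>c$, or $b'=c'$, $|b'|=1$ and $b<c$. For words of equal length, let $A(\mathbf i,\mathbf j)$ be the matrix whose $(b,b')$ entry is the number of $k$ with $(i_k,j_k)=(b,b')$. Each $A\in\mathbf M$ is $A(\mathbf i,\mathbf j)$ for a unique pair whose sequence $(i_k,j_k)$ is weakly increasing, and is $A(\mathbf k,\mathbf l)$ for a unique pair whose sequence $(l_k,k_k)$ is weakly increasing. For $x=e,f$ and $i\in I$, put $x_iA=A(x_i\mathbf i,\mathbf j)$ and $x_i^*A=A(\mathbf k,x_i\mathbf l)$ (which is $0$ if $x_i\mathbf i=0$, respectively $x_i\mathbf l=0$). Let $\mathfrak M=\{A\in\mathbf M: A=A^t\}$. For $A\in\mathfrak M$ put $\mathbf e_iA=e_ie_i^*A$, $\mathbf f_iA=f_if_i^*A$ (with $x_i0=x_i^*0=0$), $\mathrm{wt}(A)=\sum_b\big(\sum_{b'}a_{bb'}\big)\epsilon_b$,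 $\varepsilon_i(A)=\max\{k:\mathbf e_i^kA\ne0\}$ and $\varphi_i(A)=\max\{k:\mathbf f_i^kA\ne0\}$. **Proposition.** For all $i\in I$ and $A\in\mathfrak M$ one has $e_ie_i^*A=e_i^*e_iA$ and $f_if_i^*A=f_i^*f_iA$, and the maxima defining $\varepsilon_i(A)$ and $\varphi_i(A)$ exist. With $\mathrm{wt},\varepsilon_i,\varphi_i,\mathbf e_i,\mathbf f_i$ $(i\in I)$, the set $\mathfrak M$ is a $\mathfrak{gl}_{m|n}$-crystal (in particular $\mathbf e_i,\mathbf f_i$ map $\mathfrak M$ to $\mathfrak M\sqcup\{0\}$). Each $\mathbf B_{m|n}(\lambda)$, $\lambda\in\mathcal P_{m|n}$, with the maps of $\mathcal W$, is a $\mathfrak{gl}_{m|n}$-crystal, and there is an isomorphism of $\mathfrak{gl}_{m|n}$-crystals $$\mathfrak M\;\simeq\;\bigoplus_{\lambda\in\mathcal P_{m|n}}\mathbf B_{m|n}(\lambda).$$ -/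

import Mathlib

namespace HookCrystal

/-! ### The ordered alphabet, weights and roots -/

/-- The linearly ordered alphabet `m̄ < ⋯ < 1̄ < 1 < ⋯ < n`: the element `k` of `Fin (m + n)` stands
for the letter `(m - k)‾` if `k < m`, and for the letter `k - m + 1` if `m ≤ k`. -/
abbrev Letter (m n : ℕ) : Type := Fin (m + n)

/-- The degree `|b|`: it is `0` on the barred letters and `1` on the unbarred ones. -/
def degree {m n : ℕ} (b : Letter m n) : ℕ := if b.val < m then 0 else 1

/-- The index set `(m-1)‾, …, 1̄, 0, 1, …, n-1` of the simple roots, listed in this order: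
`i` stands for `(m - 1 - i)‾` if `i + 1 < m`, for `0` if `i + 1 = m`, and for `i + 1 - m` if
`m < i + 1`. The index `0` is present exactly if `m` and `n` are both positive. -/
abbrev Index (m n : ℕ) : Type := Fin (m + n - 1)

/-- The letter `b` at the tail of the only `i`-coloured arrow `b → b'` between letters. -/
def Index.lo {m n : ℕ} (i : Index m n) : Letter m n := ⟨i.val, by omega⟩

/-- The letter `b'` at the head of the only `i`-coloured arrow `b → b'` between letters. -/
def Index.hi {m n : ℕ} (i : Index m n) : Letter m n := ⟨i.val + 1, by omega⟩

/-- The weight lattice, free on the `ε_b`; a weight is given by its coordinates. -/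
abbrev Weight (m n : ℕ) : Type := Letter m n → ℤ

/-- The bilinear form with `(ε_b, ε_b') = (-1)^|b| δ_{bb'}`. -/
def form {m n : ℕ} (x y : Weight m n) : ℤ := ∑ b, (-1) ^ degree b * (x b * y b)

/-- The simple root `α_i`. -/
def simpleRoot {m n : ℕ} (i : Index m n) : Weight m n := Pi.single i.lo 1 - Pi.single i.hi 1

/-- The value `⟨h_i, x⟩` of the simple coroot: `(α_i, x)` for `i = (m-1)‾, …, 1̄, 0`, and
`-(α_i, x)` for `i = 1, …, n - 1`. -/
def coroot {m n : ℕ} (i : Index m n) (x : Weight m n) : ℤ :=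
  if i.val + 1 ≤ m then form (simpleRoot i) x else -form (simpleRoot i) x

/-! ### Crystals -/

/-- The maps that make up a crystal, without the axioms; `none` is the formal symbol `0`. -/
structure CrystalMaps (m n : ℕ) (B : Type) where
  wt : B → Weight m n
  eps : Index m n → B → ℕ
  phi : Index m n → B → ℕ
  e : Index m n → B → Option B
  f : Index m n → B → Option B

/-- The set `S`, with the restrictions to `S` of the given maps, is a crystal for `gl(m|n)`. The
first two fields say that `e_i` and `f_i` are maps from `S` to `S ∪ {0}`. -/
structure IsCrystalOn {m n : ℕ} {B : Type} (C : CrystalMaps m n B) (S : Set B) : Prop where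
  e_mem : ∀ i, ∀ b ∈ S, ∀ b', C.e i b = some b' → b' ∈ S
  f_mem : ∀ i, ∀ b ∈ S, ∀ b', C.f i b = some b' → b' ∈ S
  phi_sub_eps : ∀ i : Index m n, i.val + 1 ≠ m → ∀ b ∈ S,
    (C.phi i b : ℤ) - C.eps i b = coroot i (C.wt b)
  coroot_zero_nonneg : ∀ i : Index m n, i.val + 1 = m → ∀ b ∈ S, 0 ≤ coroot i (C.wt b)
  phi_add_eps : ∀ i : Index m n, i.val + 1 = m → ∀ b ∈ S,
    C.phi i b + C.eps i b = if coroot i (C.wt b) = 0 then 0 else 1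
  of_e : ∀ i, ∀ b ∈ S, ∀ b', C.e i b = some b' →
    (C.eps i b' : ℤ) = C.eps i b - 1 ∧ C.phi i b' = C.phi i b + 1 ∧
      C.wt b' = C.wt b + simpleRoot i
  of_f : ∀ i, ∀ b ∈ S, ∀ b', C.f i b = some b' →
    C.eps i b' = C.eps i b + 1 ∧ (C.phi i b' : ℤ) = C.phi i b - 1 ∧
      C.wt b' = C.wt b - simpleRoot i
  f_iff_e : ∀ i, ∀ b ∈ S, ∀ b' ∈ S, C.f i b = some b' ↔ C.e i b' = some b

/-- The crystals carried by `S` and `T` are isomorphic: there is an isomorphism of coloured oriented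
graphs (with an arrow `b → b'` of colour `i` if `f_i b = b'`) that preserves `wt`, `ε_i`, `φ_i`. -/
def Isomorphic {m n : ℕ} {B B' : Type} (C : CrystalMaps m n B) (S : Set B)
    (D : CrystalMaps m n B') (T : Set B') : Prop :=
  ∃ ψ : S ≃ T,
    (∀ b : S, D.wt (ψ b).val = C.wt b.val) ∧
    (∀ (i : Index m n) (b : S), D.eps i (ψ b).val = C.eps i b.val) ∧
    (∀ (i : Index m n) (b : S), D.phi i (ψ b).val = C.phi i b.val) ∧
    (∀ (i : Index m n) (b b' : S), C.f i b.val = some b'.val ↔ D.f i (ψ b).val = some (ψ b').val)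

/-- The maps of a direct sum (disjoint union) of copies of `B`, indexed by `ι`. -/
def CrystalMaps.copies {m n : ℕ} {B : Type} (C : CrystalMaps m n B) (ι : Type) :
    CrystalMaps m n (ι × B) where
  wt x := C.wt x.2
  eps i x := C.eps i x.2
  phi i x := C.phi i x.2
  e i x := (C.e i x.2).map fun b => (x.1, b)
  f i x := (C.f i x.2).map fun b => (x.1, b)

/-! ### The crystal of words -/

/-- The crystal of letters, `m̄ → ⋯ → 1̄ → 1 → ⋯ → n`. -/
def letterMaps (m n : ℕ) : CrystalMaps m n (Letter m n) where
  wt b := Pi.single b 1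
  eps i b := if b = i.hi then 1 else 0
  phi i b := if b = i.lo then 1 else 0
  e i b := if b = i.hi then some i.lo else none
  f i b := if b = i.lo then some i.hi else none

/-- The value `ε_i(b₁ ⊗ b₂)`, where `ε_i(b_k) = a_k` and `wt(b_k) = x_k`. The maxima here and in
`tensorPhi` are non-negative, so `Int.toNat` does not change them. -/
def tensorEps {m n : ℕ} (i : Index m n) (a₁ a₂ : ℕ) (x₁ x₂ : Weight m n) : ℕ :=
  if i.val + 1 < m then (max (a₁ : ℤ) (a₂ - coroot i x₁)).toNat
  else if i.val + 1 = m then (if 0 < coroot i x₁ then a₁ else a₂)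
  else (max ((a₁ : ℤ) - coroot i x₂) (a₂ : ℤ)).toNat

/-- The value `φ_i(b₁ ⊗ b₂)`, where `φ_i(b_k) = a_k` and `wt(b_k) = x_k`. -/
def tensorPhi {m n : ℕ} (i : Index m n) (a₁ a₂ : ℕ) (x₁ x₂ : Weight m n) : ℕ :=
  if i.val + 1 < m then (max ((a₁ : ℤ) + coroot i x₂) (a₂ : ℤ)).toNat
  else if i.val + 1 = m then (if 0 < coroot i x₁ then a₁ else a₂)
  else (max (a₁ : ℤ) (a₂ + coroot i x₁)).toNat

/-- The condition for `e_i (b₁ ⊗ b₂) = e_i b₁ ⊗ b₂`; otherwise `e_i (b₁ ⊗ b₂) = b₁ ⊗ e_i b₂`. Here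
`eps₁ = ε_i(b₁)`, `phi₁ = φ_i(b₁)`, `x₁ = wt(b₁)`, `eps₂ = ε_i(b₂)`, `phi₂ = φ_i(b₂)`. -/
abbrev TensorELeft {m n : ℕ} (i : Index m n) (eps₁ phi₁ : ℕ) (x₁ : Weight m n)
    (eps₂ phi₂ : ℕ) : Prop :=
  (i.val + 1 < m ∧ eps₂ ≤ phi₁) ∨ (i.val + 1 = m ∧ 0 < coroot i x₁) ∨
    (m < i.val + 1 ∧ phi₂ < eps₁)

/-- The condition for `f_i (b₁ ⊗ b₂) = f_i b₁ ⊗ b₂`; otherwise `f_i (b₁ ⊗ b₂) = b₁ ⊗ f_i b₂`. -/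
abbrev TensorFLeft {m n : ℕ} (i : Index m n) (eps₁ phi₁ : ℕ) (x₁ : Weight m n)
    (eps₂ phi₂ : ℕ) : Prop :=
  (i.val + 1 < m ∧ eps₂ < phi₁) ∨ (i.val + 1 = m ∧ 0 < coroot i x₁) ∨
    (m < i.val + 1 ∧ phi₂ ≤ eps₁)

/-- Finite words in the alphabet; `w₁ ⋯ w_r` stands for `w₁ ⊗ (w₂ ⊗ ( ⋯ ⊗ w_r))`. -/
abbrev Word (m n : ℕ) : Type := List (Letter m n)

/-- The weight of a word. -/
def wordWt {m n : ℕ} : Word m n → Weight m n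
  | [] => 0
  | b :: w => (letterMaps m n).wt b + wordWt w

/-- `ε_i` of a word; the empty word forms the trivial crystal. -/
def wordEps {m n : ℕ} (i : Index m n) : Word m n → ℕ
  | [] => 0
  | b :: w => tensorEps i ((letterMaps m n).eps i b) (wordEps i w) ((letterMaps m n).wt b) (wordWt w)

/-- `φ_i` of a word. -/
def wordPhi {m n : ℕ} (i : Index m n) : Word m n → ℕ
  | [] => 0
  | b :: w => tensorPhi i ((letterMaps m n).phi i b) (wordPhi i w) ((letterMaps m n).wt b) (wordWt w)

/-- The Kashiwara operator `e_i` on words. -/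
def wordE {m n : ℕ} (i : Index m n) : Word m n → Option (Word m n)
  | [] => none
  | b :: w =>
    if TensorELeft i ((letterMaps m n).eps i b) ((letterMaps m n).phi i b)
        ((letterMaps m n).wt b) (wordEps i w) (wordPhi i w)
    then ((letterMaps m n).e i b).map fun b' => b' :: w
    else (wordE i w).map fun w' => b :: w'

/-- The Kashiwara operator `f_i` on words. -/
def wordF {m n : ℕ} (i : Index m n) : Word m n → Option (Word m n)
  | [] => none
  | b :: w =>
    if TensorFLeft i ((letterMaps m n).eps i b) ((letterMaps m n).phi i b)
        ((letterMaps m n).wt b) (wordEps i w) (wordPhi i w)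
    then ((letterMaps m n).f i b).map fun b' => b' :: w
    else (wordF i w).map fun w' => b :: w'

/-- The crystal of words. -/
def wordMaps (m n : ℕ) : CrystalMaps m n (Word m n) where
  wt := wordWt
  eps := wordEps
  phi := wordPhi
  e := wordE
  f := wordF

/-! ### Hook semistandard tableaux -/

/-- `(m, n)`-hook partitions: the part `λ_{m+1}` (the row of index `m`) is at most `n`. -/
abbrev HookPartition (m n : ℕ) : Type := {μ : YoungDiagram // μ.rowLen m ≤ n}

/-- `(m, n)`-hook semistandard fillings of the Young diagram `μ`. A cell is a pair
`(row, column)`. -/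
structure IsHookSemistandard {m n : ℕ} (μ : YoungDiagram) (T : {c // c ∈ μ} → Letter m n) :
    Prop where
  row_weak : ∀ c d, c.val.1 = d.val.1 → c.val.2 < d.val.2 → T c ≤ T d
  col_weak : ∀ c d, c.val.2 = d.val.2 → c.val.1 < d.val.1 → T c ≤ T d
  col_strict : ∀ c d, c.val.2 = d.val.2 → c.val.1 < d.val.1 →
    degree (T c) = 0 → degree (T d) = 0 → T c < T d
  row_strict : ∀ c d, c.val.1 = d.val.1 → c.val.2 < d.val.2 →
    degree (T c) = 1 → degree (T d) = 1 → T c < T d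

/-- The column reading: the columns are read from right to left, each from top to bottom. -/
def columnReading {m n : ℕ} (μ : YoungDiagram) (T : {c // c ∈ μ} → Letter m n) : Word m n :=
  (List.range (μ.rowLen 0)).reverse.flatMap fun j =>
    List.ofFn fun k : Fin (μ.colLen j) => T ⟨(k.val, j), μ.mem_iff_lt_colLen.2 k.isLt⟩

/-- The set of `(m, n)`-hook semistandard tableaux of shape `μ`, viewed as a set of words by column
reading (which is injective on the fillings of a given shape). -/
def tableauWords (m n : ℕ) (μ : YoungDiagram) : Set (Word m n) :=
  {w | ∃ T : {c // c ∈ μ} → Letter m n, IsHookSemistandard μ T ∧ columnReading μ T = w}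

/-! ### Matrices -/

/-- Square matrices of non-negative integers with rows and columns indexed by the alphabet. -/
abbrev Mat (m n : ℕ) : Type := Matrix (Letter m n) (Letter m n) ℕ

/-- The set `M` of the matrices whose entries `a_{bb'}` with `|b| ≠ |b'|` are at most `1`. -/
def superMatrices (m n : ℕ) : Set (Mat m n) :=
  {A | ∀ b b', degree b ≠ degree b' → A b b' ≤ 1}

/-- The biword of `A`, which contains each pair `(b, b')` with multiplicity `a_{bb'}` and is weakly
increasing for the super lexicographic order: `(b, b') < (c, c')` if `b' < c'`, or
`b' = c'`, `|b'| = 0` and `b > c`, or `b' = c'`, `|b'| = 1` and `b < c`. -/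
def biword {m n : ℕ} (A : Mat m n) : List (Letter m n × Letter m n) :=
  (List.finRange (m + n)).flatMap fun b' =>
    (if degree b' = 0 then (List.finRange (m + n)).reverse else List.finRange (m + n)).flatMap
      fun b => List.replicate (A b b') (b, b')

/-- The word of the first components of the biword of `A`. -/
def topWord {m n : ℕ} (A : Mat m n) : Word m n := (biword A).map Prod.fst

/-- The word of the second components of the biword of `A`. -/
def bottomWord {m n : ℕ} (A : Mat m n) : Word m n := (biword A).map Prod.snd

/-- The matrix `A(v, w)` of a pair of words of the same length: `a_{bb'}` is the number of the
positions `k` with `(v_k, w_k) = (b, b')`. -/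
def matrixOf {m n : ℕ} (v w : Word m n) : Mat m n := fun b b' => (v.zip w).count (b, b')

/-- The operator `e_i` on matrices: it is applied to the first word of the biword. -/
def matE {m n : ℕ} (i : Index m n) (A : Mat m n) : Option (Mat m n) :=
  (wordE i (topWord A)).map fun w => matrixOf w (bottomWord A)

/-- The operator `f_i` on matrices. -/
def matF {m n : ℕ} (i : Index m n) (A : Mat m n) : Option (Mat m n) :=
  (wordF i (topWord A)).map fun w => matrixOf w (bottomWord A)

/-- The operator `e_i^*` on matrices: write `A = A(k, l)` where `(l, k)` is weakly increasing for
the super lexicographic order, that is, `(l, k)` is the biword of the transpose of `A`, and replace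
`l` by `e_i l`. -/
def matEStar {m n : ℕ} (i : Index m n) (A : Mat m n) : Option (Mat m n) :=
  (wordE i (topWord A.transpose)).map fun l => matrixOf (bottomWord A.transpose) l

/-- The operator `f_i^*` on matrices. -/
def matFStar {m n : ℕ} (i : Index m n) (A : Mat m n) : Option (Mat m n) :=
  (wordF i (topWord A.transpose)).map fun l => matrixOf (bottomWord A.transpose) l

/-- The set of the symmetric matrices in `M`. -/
def symmetricMatrices (m n : ℕ) : Set (Mat m n) :=
  {A | A ∈ superMatrices m n ∧ A.transpose = A}

/-- The diagonal operator `e_i e_i^*` (with `e_i 0 = 0`). -/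
def diagE {m n : ℕ} (i : Index m n) (A : Mat m n) : Option (Mat m n) := (matEStar i A).bind (matE i)

/-- The diagonal operator `f_i f_i^*` (with `f_i 0 = 0`). -/
def diagF {m n : ℕ} (i : Index m n) (A : Mat m n) : Option (Mat m n) := (matFStar i A).bind (matF i)

/-- The set of the `k` with `x^k A ≠ 0`, for a partial operator `x` extended by `x 0 = 0`. -/
def powersNeZero {B : Type} (x : B → Option B) (A : B) : Set ℕ :=
  {k | (fun y : Option B => y.bind x)^[k] (some A) ≠ none}

/-- The maps for the diagonal action: the weight is that of the first word of the biword, that is,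
`∑_b (∑_b' a_{bb'}) ε_b`, and `ε_i`, `φ_i` are the largest `k` with `(e_i e_i^*)^k A ≠ 0` and with
`(f_i f_i^*)^k A ≠ 0` respectively. -/
noncomputable def diagonalMaps (m n : ℕ) : CrystalMaps m n (Mat m n) where
  wt A := wordWt (topWord A)
  eps i A := sSup (powersNeZero (diagE i) A)
  phi i A := sSup (powersNeZero (diagF i) A)
  e := diagE
  f := diagF

end HookCrystal

/-! The theorem is the symmetric case of a super version of the Robinson–Schensted–Knuth
correspondence. Write `ColLt a b` if `b` may stand below `a` in a column. Then columns are
`ColLt`-chains, and `b` may stand to the right of `a` in a row exactly if `¬ ColLt b a`. Both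
`ColLt` and its negation are transitive, so barred and unbarred letters can be treated together by
the classical plactic arguments.

Column insertion of the first word of the biword of `A` gives a tableau `P = matTab A`, and the
recording tableau is `Q = matTab A.transpose`. The pair `(P, Q)` determines `A`
(`matTab_injective`), and every pair of tableaux of the same shape occurs (`exists_matTab`). Hence
`A` is symmetric exactly if `P = Q`, and the symmetric matrices correspond bijectively to the
tableaux. The hook condition on the shape holds for every tableau (`rowLen_shape_le`).

The operators on words respect plactic equivalence (`Knuth.sameCrystal`), send readings of tableaux
to readings of tableaux of the same shape (`exists_tab_of_good`), and keep a biword sorted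
(`pairwise_biLe_of_good`). So `e_i`, `f_i` act on `P` as on words and fix `Q`, while the starred
operators act on `Q` and fix `P` (`matOp_eq_some_iff`, `matOpStar_eq_some_iff`). The two actions
therefore commute, and on symmetric matrices the diagonal operators are the word operators on `P`
(`diagOp_eq_some_iff`). All crystal axioms are transported from words.

Two facts rest on Greene's invariants, the largest total sizes of `k` disjoint row subwords
(`RowColorable`): that a plactic class contains only one tableau (`Knuth.tab_eq`), and that the
recording tableau of `A` is the insertion tableau of the transpose (`Dual.colLen_restr`). The
invariants are constant on plactic classes, they are the sums of the first `k` row lengths for a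
tableau, and they do not change under transposition of a sorted biword. A tableau is recovered from
the shapes of its restrictions to the letters `< t`, so the invariants of these restrictions
suffice. -/

namespace HookCrystal

/-! ### Row colourings of words -/

section Greene

variable {α : Type*} (D : α → α → Prop)

/-- Two letters of a coloured word, the first to the left of the second, may carry their colours:
if they share a colour `< k`, the second may not stand below the first in a column. -/
def Compat (k : ℕ) (p q : α × ℕ) : Prop := p.2 = q.2 → p.2 < k → ¬ D p.1 q.1

/-- There are `k` disjoint subwords of `w`, none of which contains an instance of `D`, with at least
`N` letters in total. -/
def RowColorable (k N : ℕ) (w : List α) : Prop :=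
  ∃ L : List (α × ℕ), L.map Prod.fst = w ∧ L.Pairwise (Compat D k) ∧
    N ≤ L.countP (fun p => decide (p.2 < k))

/-- The elementary (plactic) relations. -/
inductive KnuthStep : List α → List α → Prop
  | lower (u v : List α) (x y z : α) : D x y → ¬ D z y →
      KnuthStep (u ++ x :: z :: y :: v) (u ++ z :: x :: y :: v)
  | upper (u v : List α) (x y z : α) : D y z → ¬ D y x →
      KnuthStep (u ++ y :: z :: x :: v) (u ++ y :: x :: z :: v)

/-- Plactic equivalence of words. -/
def Knuth : List α → List α → Prop := Relation.EqvGen (KnuthStep D)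

variable {D}

theorem map_fst_eq_append {L : List (α × ℕ)} {u w : List α} (h : L.map Prod.fst = u ++ w) :
    ∃ U W, L = U ++ W ∧ U.map Prod.fst = u ∧ W.map Prod.fst = w := by
  obtain ⟨U, W, h1, h2, h3⟩ := List.map_eq_append_iff.1 h
  exact ⟨U, W, h1, h2, h3⟩

theorem map_fst_eq_cons {L : List (α × ℕ)} {x : α} {w : List α} (h : L.map Prod.fst = x :: w) :
    ∃ a W, L = (x, a) :: W ∧ W.map Prod.fst = w := by
  obtain ⟨⟨p, a⟩, W, h1, h2, h3⟩ := List.map_eq_cons_iff.1 h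
  subst h2
  exact ⟨a, W, h1, h3⟩

/-- Every letter keeps its colour. The only new pair in left-to-right order is `(z, x)`, and `D z x`
with `D x y` would give `D z y`. -/
theorem RowColorable.lower_left (ht : ∀ a b c, D a b → D b c → D a c) {k N : ℕ} {u v : List α}
    {x y z : α} (hxy : D x y) (hzy : ¬ D z y)
    (h : RowColorable D k N (u ++ x :: z :: y :: v)) :
    RowColorable D k N (u ++ z :: x :: y :: v) := by
  obtain ⟨L, h1, h2, h3⟩ := h
  obtain ⟨U, W₁, rfl, rfl, hW₁⟩ := map_fst_eq_append h1
  obtain ⟨a, W₂, rfl, hW₂⟩ := map_fst_eq_cons hW₁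
  obtain ⟨b, W₃, rfl, hW₃⟩ := map_fst_eq_cons hW₂
  obtain ⟨c, W, rfl, rfl⟩ := map_fst_eq_cons hW₃
  refine ⟨U ++ (z, b) :: (x, a) :: (y, c) :: W, by simp, ?_, ?_⟩
  · have hzx : Compat D k (z, b) (x, a) := fun _ _ h => hzy (ht _ _ _ h hxy)
    simp only [List.pairwise_append, List.pairwise_cons, List.mem_cons, forall_eq_or_imp] at h2 ⊢
    obtain ⟨hU, ⟨⟨_, hx, hx'⟩, hz, hy⟩, hUW⟩ := h2
    exact ⟨hU, ⟨⟨hzx, hz⟩, ⟨hx, hx'⟩, hy⟩, fun p hp =>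
      ⟨(hUW p hp).2.1, (hUW p hp).1, (hUW p hp).2.2⟩⟩
  · refine h3.trans (le_of_eq ?_)
    simp only [List.countP_append, List.countP_cons]
    omega

/-- The colouring survives unless `z` and `x` share a colour `a < k`. In that case `y` has another
colour, because `D x y`, and the classes of `x` and `y` are recombined without changing the number
of coloured letters. -/
theorem RowColorable.lower_right (ht : ∀ a b c, D a b → D b c → D a c)
    (hn : ∀ a b c, ¬ D a b → ¬ D b c → ¬ D a c) {k N : ℕ} {u v : List α}
    {x y z : α} (hxy : D x y) (hzy : ¬ D z y)
    (h : RowColorable D k N (u ++ z :: x :: y :: v)) :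
    RowColorable D k N (u ++ x :: z :: y :: v) := by
  obtain ⟨L, h1, h2, h3⟩ := h
  obtain ⟨U, W₁, rfl, rfl, hW₁⟩ := map_fst_eq_append h1
  obtain ⟨b, W₂, rfl, hW₂⟩ := map_fst_eq_cons hW₁
  obtain ⟨a, W₃, rfl, hW₃⟩ := map_fst_eq_cons hW₂
  obtain ⟨c, W, rfl, rfl⟩ := map_fst_eq_cons hW₃
  simp only [List.countP_append, List.countP_cons, decide_eq_true_eq] at h3
  simp only [List.pairwise_append, List.pairwise_cons, List.mem_cons, forall_eq_or_imp] at h2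
  obtain ⟨hU, ⟨⟨hzx, hzy', hzW⟩, ⟨hxy', hxW⟩, hyW, hW⟩, hUW⟩ := h2
  by_cases hab : a = b ∧ a < k
  · obtain ⟨rfl, hak⟩ := hab
    have hac : a ≠ c := fun h => hxy' h hak hxy
    by_cases hck : c < k
    -- The classes end in `z x W_a` and `y W_c`, where `W_a`, `W_c` are the parts of the tail `W` of
    -- colours `a`, `c`. They are replaced by `z y W_c` in colour `a` and `x W_a` in colour `c`; the
    -- transposition `s` recolours the tail.
    · let s : ℕ → ℕ := fun j => if j = a then c else if j = c then a else j
      have hs : ∀ j, s j < k ↔ j < k := by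
        intro j; simp only [s]; split_ifs <;> omega
      refine ⟨U ++ (x, c) :: (z, a) :: (y, a) :: W.map (fun p => (p.1, s p.2)), ?_, ?_, ?_⟩
      · simp [Function.comp_def]
      · simp only [List.pairwise_append, List.pairwise_cons, List.mem_cons, forall_eq_or_imp,
          List.pairwise_map, List.forall_mem_map]
        have hzv : ∀ q ∈ W, q.2 = c → ¬ D z q.1 := fun q hq h =>
          hn _ _ _ hzy (hyW q hq h.symm hck)
        refine ⟨hU, ⟨⟨fun h => absurd h.symm hac, fun h => absurd h.symm hac, ?_⟩,
          ⟨fun _ _ => hzy, ?_⟩, ?_, ?_⟩, ?_⟩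
        · intro q hq h _
          have : q.2 = a := by
            simp only [s] at h; split_ifs at h <;> omega
          exact hxW q hq this.symm hak
        · intro q hq h _
          have : q.2 = c := by
            simp only [s] at h; split_ifs at h <;> omega
          exact hzv q hq this
        · intro q hq h _
          have : q.2 = c := by
            simp only [s] at h; split_ifs at h <;> omega
          exact hyW q hq this.symm hck
        · refine hW.imp ?_
          intro p q hpq h hk
          have : p.2 = q.2 := by
            simp only [s] at h; split_ifs at h <;> omega
          exact hpq this ((hs _).1 hk)
        · intro p hp
          obtain ⟨h1, h2, h3, h4⟩ := hUW p hp
          refine ⟨fun h hk h' => h3 h hk (ht _ _ _ h' hxy), h1, fun h hk => hn _ _ _ (h1 h hk) hzy, ?_⟩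
          intro q hq h hk
          simp only at h hk
          by_cases hqa : q.2 = a
          · have hpc : p.2 = c := by simp only [s, hqa, if_true] at h; exact h
            exact hn _ _ _ (fun h' => h3 hpc hk (ht _ _ _ h' hxy)) (hxW q hq hqa.symm hak)
          · by_cases hqc : q.2 = c
            · have hpa : p.2 = a := by simp only [s, hqc, if_true, hac.symm, if_false] at h; exact h
              exact hn _ _ _ (h1 hpa hk) (hzv q hq hqc)
            · have hpq : p.2 = q.2 := by simp only [s, hqa, hqc, if_false] at h; exact h
              exact h4 q hq hpq hk
      · have e : List.countP (fun p : α × ℕ => decide (p.2 < k))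
            (W.map (fun p => (p.1, s p.2))) = List.countP (fun p => decide (p.2 < k)) W := by
          rw [List.countP_map]
          refine List.countP_congr ?_
          intro p _
          simp [hs]
        simp only [List.countP_append, List.countP_cons, decide_eq_true_eq, e]
        simp only [hak, hck, if_true] at h3 ⊢
        omega
    -- Here `y` was uncoloured: it takes the place of `x` in the class `a`, and `x` becomes
    -- uncoloured.
    · refine ⟨U ++ (x, c) :: (z, a) :: (y, a) :: W, by simp, ?_, ?_⟩
      · simp only [List.pairwise_append, List.pairwise_cons, List.mem_cons, forall_eq_or_imp]
        refine ⟨hU, ⟨⟨fun h => absurd h.symm hac, fun h => absurd h.symm hac, fun q _ _ h => absurd h hck⟩,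
          ⟨fun _ _ => hzy, hzW⟩, fun q hq h hk h' => hxW q hq h hk (ht _ _ _ hxy h'), hW⟩, ?_⟩
        intro p hp
        obtain ⟨h1, h2, h3, h4⟩ := hUW p hp
        exact ⟨fun h hk => absurd (lt_of_eq_of_lt (Eq.symm h) hk) hck, h1, fun h hk => hn _ _ _ (h1 h hk) hzy, h4⟩
      · simp only [List.countP_append, List.countP_cons, decide_eq_true_eq]
        simp only [hak, hck, if_true, if_false] at h3 ⊢
        omega
  · refine ⟨U ++ (x, a) :: (z, b) :: (y, c) :: W, by simp, ?_, ?_⟩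
    · have hxz : Compat D k (x, a) (z, b) := fun h h' => absurd ⟨h, h'⟩ hab
      simp only [List.pairwise_append, List.pairwise_cons, List.mem_cons, forall_eq_or_imp]
      exact ⟨hU, ⟨⟨hxz, hxy', hxW⟩, ⟨hzy', hzW⟩, hyW, hW⟩, fun p hp =>
        ⟨(hUW p hp).2.1, (hUW p hp).1, (hUW p hp).2.2⟩⟩
    · simp only [List.countP_append, List.countP_cons, decide_eq_true_eq]
      omega

/-- Reversing words and the relation `D` turns the relation `upper` into `lower` with `x` and `z`
exchanged, so only `lower` has to be treated by hand. -/
theorem rowColorable_reverse {k N : ℕ} {w : List α} :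
    RowColorable (fun a b => D b a) k N w.reverse ↔ RowColorable D k N w := by
  constructor
  · rintro ⟨L, h1, h2, h3⟩
    refine ⟨L.reverse, by rw [List.map_reverse, h1, List.reverse_reverse], ?_, by simpa using h3⟩
    rw [List.pairwise_reverse]
    exact h2.imp @fun p q h (e : q.2 = p.2) hk => h e.symm (by rwa [← e])
  · rintro ⟨L, h1, h2, h3⟩
    refine ⟨L.reverse, by rw [List.map_reverse, h1], ?_, by simpa using h3⟩
    rw [List.pairwise_reverse]
    exact h2.imp @fun p q h (e : q.2 = p.2) hk => h e.symm (by rwa [← e])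

theorem KnuthStep.rowColorable_iff (ht : ∀ a b c, D a b → D b c → D a c)
    (hn : ∀ a b c, ¬ D a b → ¬ D b c → ¬ D a c) {w w' : List α} (h : KnuthStep D w w') (k N : ℕ) :
    RowColorable D k N w ↔ RowColorable D k N w' := by
  cases h with
  | lower u v x y z h1 h2 =>
    exact ⟨.lower_left ht h1 h2, .lower_right ht hn h1 h2⟩
  | upper u v x y z h1 h2 =>
    rw [← rowColorable_reverse, ← rowColorable_reverse (w := u ++ y :: x :: z :: v)]
    have ht' : ∀ a b c, D b a → D c b → D c a := fun a b c h h' => ht _ _ _ h' h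
    have hn' : ∀ a b c, ¬ D b a → ¬ D c b → ¬ D c a := fun a b c h h' => hn _ _ _ h' h
    simp only [List.reverse_append, List.reverse_cons, List.append_assoc, List.cons_append,
      List.nil_append]
    exact ⟨.lower_right (D := fun a b => D b a) ht' hn' h1 h2,
      .lower_left (D := fun a b => D b a) ht' h1 h2⟩

theorem Knuth.rowColorable_iff (ht : ∀ a b c, D a b → D b c → D a c)
    (hn : ∀ a b c, ¬ D a b → ¬ D b c → ¬ D a c) {w w' : List α} (h : Knuth D w w') (k N : ℕ) :
    RowColorable D k N w ↔ RowColorable D k N w' := by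
  induction h with
  | rel _ _ h => exact h.rowColorable_iff ht hn k N
  | refl => rfl
  | symm _ _ _ ih => exact ih.symm
  | trans _ _ _ _ _ ih1 ih2 => exact ih1.trans ih2

theorem KnuthStep.append {w w' : List α} (h : KnuthStep D w w') (u v : List α) :
    KnuthStep D (u ++ w ++ v) (u ++ w' ++ v) := by
  cases h with
  | lower a b x y z h1 h2 => simpa using KnuthStep.lower (u ++ a) (b ++ v) x y z h1 h2
  | upper a b x y z h1 h2 => simpa using KnuthStep.upper (u ++ a) (b ++ v) x y z h1 h2

theorem Knuth.append {w w' : List α} (h : Knuth D w w') (u v : List α) :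
    Knuth D (u ++ w ++ v) (u ++ w' ++ v) := by
  induction h with
  | rel _ _ h => exact .rel _ _ (h.append u v)
  | refl => exact .refl _
  | symm _ _ _ ih => exact .symm _ _ ih
  | trans _ _ _ _ _ ih1 ih2 => exact .trans _ _ _ ih1 ih2

/-- Plactic equivalence is compatible with the restriction to an order ideal of letters. -/
theorem Knuth.filter {P : α → Bool}
    (hlow : ∀ x y z, D x y → ¬ D z y → P z = true → P x = true ∧ P y = true)
    (hupp : ∀ x y z, D y z → ¬ D y x → P z = true → P x = true ∧ P y = true)
    {w w' : List α} (h : Knuth D w w') : Knuth D (w.filter P) (w'.filter P) := by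
  induction h with
  | rel _ _ h =>
    cases h with
    | lower u v x y z h1 h2 =>
      by_cases hz : P z = true
      · obtain ⟨hx, hy⟩ := hlow x y z h1 h2 hz
        simp only [List.filter_append, List.filter_cons, hx, hy, hz, if_true]
        exact .rel _ _ (.lower _ _ _ _ _ h1 h2)
      · simp only [List.filter_append, List.filter_cons, hz]
        exact .refl _
    | upper u v x y z h1 h2 =>
      by_cases hz : P z = true
      · obtain ⟨hx, hy⟩ := hupp x y z h1 h2 hz
        simp only [List.filter_append, List.filter_cons, hx, hy, hz, if_true]
        exact .rel _ _ (.upper _ _ _ _ _ h1 h2)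
      · simp only [List.filter_append, List.filter_cons, hz]
        exact .refl _
  | refl => exact .refl _
  | symm _ _ _ ih => exact .symm _ _ ih
  | trans _ _ _ _ _ ih1 ih2 => exact .trans _ _ _ ih1 ih2

end Greene

/-! ### Tableaux as lists of columns -/

section Tableaux

variable {m n : ℕ}

/-- The letter `b` may stand below `a` in a column of a tableau. -/
def ColLt (a b : Letter m n) : Prop := a.val < b.val ∨ (a.val = b.val ∧ m ≤ a.val)

instance (a b : Letter m n) : Decidable (ColLt a b) := by unfold ColLt; infer_instance

theorem ColLt.trans : ∀ a b c : Letter m n, ColLt a b → ColLt b c → ColLt a c := by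
  unfold ColLt; intros; omega

/-- Since `¬ ColLt b a` is the row condition for `b` to the right of `a`, this makes rows transitive
as `ColLt.trans` makes columns transitive. The degrees enter only through the clause for equal
letters in `ColLt`. -/
theorem ColLt.cotrans : ∀ a b c : Letter m n, ¬ ColLt a b → ¬ ColLt b c → ¬ ColLt a c := by
  unfold ColLt; intros; omega

theorem ColLt.le {a b : Letter m n} (h : ColLt a b) : a.val ≤ b.val := by
  unfold ColLt at h; omega

theorem le_of_not_colLt {a b : Letter m n} (h : ¬ ColLt b a) : a.val ≤ b.val := by
  unfold ColLt at h; omega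

/-- Columns, read from top to bottom. -/
def IsColumn (c : List (Letter m n)) : Prop := c.Pairwise ColLt

/-- The column `d` may stand immediately to the right of `c`. -/
def Adj : List (Letter m n) → List (Letter m n) → Prop
  | _, [] => True
  | [], _ :: _ => False
  | x :: c, y :: d => ¬ ColLt y x ∧ Adj c d

/-- Tableaux, given by the list of their columns from left to right. -/
def IsTab : List (List (Letter m n)) → Prop
  | [] => True
  | c :: T => IsColumn c ∧ Adj c (T.headD []) ∧ IsTab T

/-- The column reading of a list of columns. -/
def readCols : List (List (Letter m n)) → Word m n
  | [] => []
  | c :: T => readCols T ++ c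

/-- The length of the column of index `j`. -/
def colLen (T : List (List (Letter m n))) (j : ℕ) : ℕ := (T.getD j []).length

@[simp] theorem colLen_nil (j : ℕ) : colLen ([] : List (List (Letter m n))) j = 0 := rfl
@[simp] theorem colLen_cons_zero (c : List (Letter m n)) (T) : colLen (c :: T) 0 = c.length := rfl
@[simp] theorem colLen_cons_succ (c : List (Letter m n)) (T) (j : ℕ) :
    colLen (c :: T) (j + 1) = colLen T j := rfl

@[simp] theorem adj_nil (c : List (Letter m n)) : Adj c [] := by cases c <;> trivial

theorem Adj.length_le : ∀ {c d : List (Letter m n)}, Adj c d → d.length ≤ c.length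
  | _, [], _ => by simp
  | [], _ :: _, h => h.elim
  | _ :: _, _ :: _, h => by simpa using Adj.length_le h.2

theorem Adj.trans : ∀ {c d e : List (Letter m n)}, Adj c d → Adj d e → Adj c e
  | _, _, [], _, _ => by simp
  | _, [], _ :: _, _, h => h.elim
  | [], _ :: _, _ :: _, h, _ => h.elim
  | _ :: _, _ :: _, _ :: _, h, h' => ⟨ColLt.cotrans _ _ _ h'.1 h.1, h.2.trans h'.2⟩

theorem Adj.not_colLt : ∀ {c d : List (Letter m n)} {r : ℕ} {a b : Letter m n}, Adj c d →
    (d)[r]? = some b → (c)[r]? = some a → ¬ ColLt b a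
  | _, [], _, _, _, _, h, _ => by simp at h
  | [], _ :: _, _, _, _, h, _, _ => h.elim
  | x :: c, y :: d, 0, a, b, h, h1, h2 => by
    simp at h1 h2; subst h1 h2; exact h.1
  | x :: c, y :: d, r + 1, a, b, h, h1, h2 => by
    simp at h1 h2; exact Adj.not_colLt h.2 h1 h2

theorem IsTab.adj_of_mem {T : List (List (Letter m n))} : ∀ {c}, IsTab (c :: T) → ∀ d ∈ T, Adj c d := by
  induction T with
  | nil => simp
  | cons e T ih =>
    intro c h d hd
    rcases List.mem_cons.1 hd with rfl | hd
    · exact h.2.1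
    · exact Adj.trans (d := e) h.2.1 (ih h.2.2 d hd)

theorem IsTab.isColumn {T : List (List (Letter m n))} (h : IsTab T) : ∀ c ∈ T, IsColumn c := by
  induction T with
  | nil => simp
  | cons e T ih =>
    intro c hc
    rcases List.mem_cons.1 hc with rfl | hc
    · exact h.1
    · exact ih h.2.2 c hc

theorem IsTab.colLen_succ_le {T : List (List (Letter m n))} (h : IsTab T) (j : ℕ) :
    colLen T (j + 1) ≤ colLen T j := by
  induction T generalizing j with
  | nil => simp
  | cons c T ih =>
    cases j with
    | zero =>
      have := h.2.1.length_le
      cases T <;> simp_all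
    | succ j => simpa using ih h.2.2 j

theorem IsTab.colLen_antitone {T : List (List (Letter m n))} (h : IsTab T) : Antitone (colLen T) :=
  antitone_nat_of_succ_le h.colLen_succ_le

theorem mem_readCols {T : List (List (Letter m n))} {a : Letter m n} :
    a ∈ readCols T ↔ ∃ c ∈ T, a ∈ c := by
  induction T with
  | nil => simp [readCols]
  | cons c T ih => simp [readCols, ih, or_comm]

/-! ### Greene's theorem for tableaux -/

/-- Any two letters of a column are related by `ColLt`, so no colour `< k` occurs twice. -/
theorem countP_le_of_isColumn {k : ℕ} {L : List (Letter m n × ℕ)} (h : IsColumn (L.map Prod.fst))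
    (h' : L.Pairwise (Compat ColLt k)) : L.countP (fun p => decide (p.2 < k)) ≤ min k L.length := by
  refine le_min ?_ List.countP_le_length
  rw [List.countP_eq_length_filter]
  have hnd : ((L.filter (fun p => decide (p.2 < k))).map Prod.snd).Nodup := by
    rw [List.Nodup, List.pairwise_map, List.pairwise_filter]
    have h2 := List.pairwise_map.1 h
    refine (h2.and h').imp ?_
    rintro p q ⟨h3, h4⟩ h5 - h6
    exact h4 h6 (by simpa using h5) h3
  have := (List.toFinset_card_of_nodup hnd).symm
  rw [List.length_map] at this
  rw [this]
  refine (Finset.card_le_card (t := Finset.range k) ?_).trans (by simp)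
  intro j hj
  simp only [List.mem_toFinset, List.mem_map, List.mem_filter, decide_eq_true_eq] at hj
  obtain ⟨p, ⟨_, hp⟩, rfl⟩ := hj
  exact Finset.mem_range.2 hp

theorem countP_zipIdx (k : ℕ) (c : List (Letter m n)) (s : ℕ) :
    (c.zipIdx s).countP (fun p => decide (p.2 < k)) = min (k - s) c.length := by
  induction c generalizing s with
  | nil => simp
  | cons x c ih =>
    simp only [List.zipIdx_cons, List.countP_cons, ih, List.length_cons, decide_eq_true_eq]
    split_ifs <;> omega

/-- The upper bound holds column by column. It is attained when each letter is coloured by the index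
of its row, so that the first `k` rows are the coloured ones. -/
theorem rowColorable_readCols {T : List (List (Letter m n))} (h : IsTab T) (k N : ℕ) :
    RowColorable ColLt k N (readCols T) ↔ N ≤ (T.map fun c => min k c.length).sum := by
  constructor
  · rintro ⟨L, h1, h2, h3⟩
    refine h3.trans ?_
    clear h3
    induction T generalizing L with
    | nil =>
      have : L = [] := List.map_eq_nil_iff.1 h1
      simp [this]
    | cons c T ih =>
      obtain ⟨U, W, rfl, hU, rfl⟩ := map_fst_eq_append h1
      rw [List.pairwise_append] at h2
      have := ih h.2.2 U hU h2.1
      have hW := countP_le_of_isColumn h.1 h2.2.1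
      simp only [List.countP_append, List.map_cons, List.sum_cons, List.length_map]
      omega
  · intro hN
    -- `zipIdx` attaches to each letter of a column its row index.
    let col : List (List (Letter m n)) → List (Letter m n × ℕ) :=
      fun T => T.foldr (fun c L => L ++ c.zipIdx) []
    have hcol : ∀ (T : List (List (Letter m n))) p, p ∈ col T → ∃ c ∈ T, p ∈ c.zipIdx := by
      intro T
      induction T with
      | nil => simp [col]
      | cons c T ih =>
        intro p hp
        simp only [col, List.foldr_cons, List.mem_append] at hp
        rcases hp with hp | hp
        · obtain ⟨d, hd, hp⟩ := ih p hp
          exact ⟨d, by simp [hd], hp⟩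
        · exact ⟨c, by simp, hp⟩
    refine ⟨col T, ?_, ?_, hN.trans (le_of_eq ?_)⟩
    · clear h hN
      induction T with
      | nil => rfl
      | cons c T ih => 
        show List.map _ (col T ++ c.zipIdx) = readCols T ++ c
        rw [List.map_append, ih, List.zipIdx_map_fst]
    · clear hN
      induction T with
      | nil => exact List.Pairwise.nil
      | cons c T ih =>
        show List.Pairwise _ (col T ++ c.zipIdx)
        rw [List.pairwise_append]
        refine ⟨ih h.2.2, ?_, ?_⟩
        · have := (List.nodup_zipIdx_map_snd c)
          rw [List.Nodup, List.pairwise_map] at this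
          exact this.imp fun {p q} h e => absurd e h
        -- Letters of one row in different columns: the right-hand column is read earlier, so the
        -- row condition is exactly the one required.
        · intro p hp q hq e _
          obtain ⟨d, hd, hp⟩ := hcol T p hp
          have ha := IsTab.adj_of_mem h d hd
          rw [List.mem_zipIdx_iff_getElem?] at hp hq
          rw [e] at hp
          exact ha.not_colLt hp hq
    · clear h hN
      induction T with
      | nil => rfl
      | cons c T ih =>
        show _ = List.countP _ (col T ++ c.zipIdx)
        rw [List.map_cons, List.sum_cons, ih, List.countP_append, countP_zipIdx]
        simp [add_comm]

/-- The columns get shorter to the right, so those with more than `k` entries form an initial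
segment, whose size is the length of row `k`. -/
theorem lt_colLen_iff {T : List (List (Letter m n))} (h : IsTab T) (k j : ℕ) :
    k < colLen T j ↔ j < T.countP (fun c => decide (k < c.length)) := by
  induction T generalizing j with
  | nil => simp
  | cons c T ih =>
    have hall : ¬ k < c.length → T.countP (fun c => decide (k < c.length)) = 0 := by
      intro hk
      rw [List.countP_eq_zero]
      intro d hd
      have := (IsTab.adj_of_mem h d hd).length_le
      simp only [decide_eq_true_eq]
      omega
    simp only [List.countP_cons, decide_eq_true_eq]
    cases j with
    | zero =>
      simp only [colLen_cons_zero]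
      split_ifs with hk
      · simp [hk]
      · simp [hk, hall hk]
    | succ j =>
      rw [colLen_cons_succ, ih h.2.2]
      split_ifs with hk
      · simp
      · simp [hall hk]

theorem colLen_eq_of_rowColorable {T T' : List (List (Letter m n))} (h : IsTab T) (h' : IsTab T')
    (hc : ∀ k N, RowColorable ColLt k N (readCols T) ↔ RowColorable ColLt k N (readCols T')) :
    colLen T = colLen T' := by
  have hs : ∀ k, (T.map fun c => min k c.length).sum = (T'.map fun c => min k c.length).sum := by
    intro k
    have := fun N => (rowColorable_readCols h k N).symm.trans
      ((hc k N).trans (rowColorable_readCols h' k N))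
    exact le_antisymm ((this _).1 le_rfl) ((this _).2 le_rfl)
  -- The increments of Greene's numbers in `k` are the row lengths, which determine the column
  -- lengths by `lt_colLen_iff`.
  have hd : ∀ (T : List (List (Letter m n))) k, (T.map fun c => min (k + 1) c.length).sum =
      (T.map fun c => min k c.length).sum + T.countP (fun c => decide (k < c.length)) := by
    intro T k
    induction T with
    | nil => rfl
    | cons c T ih =>
      simp only [List.map_cons, List.sum_cons, List.countP_cons, ih, decide_eq_true_eq]
      split_ifs <;> omega
  funext j
  refine le_antisymm ?_ ?_ <;>
  · refine le_of_forall_lt fun k hk => ?_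
    rw [lt_colLen_iff ‹_›] at hk ⊢
    have h1 := hd T k
    have h2 := hd T' k
    have h3 := hs k
    have h4 := hs (k + 1)
    omega

/-! ### Restriction to an initial interval of letters -/

/-- The subtableau of the letters `< t`. -/
def restr (t : ℕ) (T : List (List (Letter m n))) : List (List (Letter m n)) :=
  T.map fun c => c.filter fun a => decide (a.val < t)

theorem readCols_restr (t : ℕ) (T : List (List (Letter m n))) :
    readCols (restr t T) = (readCols T).filter fun a => decide (a.val < t) := by
  induction T with
  | nil => rfl
  | cons c T ih =>
    rw [readCols, List.filter_append, ← ih]; rfl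

theorem Adj.filter {t : ℕ} : ∀ {c d : List (Letter m n)}, Adj c d → IsColumn d →
    Adj (c.filter fun a => decide (a.val < t)) (d.filter fun a => decide (a.val < t))
  | _, [], _, _ => by simp
  | [], _ :: _, h, _ => h.elim
  | x :: c, y :: d, h, hd => by
    have hd' := List.pairwise_cons.1 hd
    by_cases hy : y.val < t
    · have hx : x.val < t := (le_of_not_colLt h.1).trans_lt hy
      simp only [List.filter_cons, hx, hy, decide_true, if_true]
      exact ⟨h.1, Adj.filter h.2 hd'.2⟩
    · have : (y :: d).filter (fun a => decide (a.val < t)) = [] := by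
        rw [List.filter_eq_nil_iff]
        intro a ha
        rcases List.mem_cons.1 ha with rfl | ha
        · simpa using hy
        · have := (hd'.1 a ha).le
          simp only [decide_eq_true_eq]; omega
      rw [this]; simp

theorem IsTab.restr {T : List (List (Letter m n))} (h : IsTab T) (t : ℕ) : IsTab (restr t T) := by
  induction T with
  | nil => trivial
  | cons c T ih =>
    refine ⟨List.Pairwise.filter _ h.1, ?_, ih h.2.2⟩
    cases T with
    | nil => exact adj_nil _
    | cons d T => exact Adj.filter h.2.1 h.2.2.1

theorem restr_of_le {t : ℕ} (T : List (List (Letter m n))) (ht : m + n ≤ t) : restr t T = T := by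
  unfold HookCrystal.restr
  conv_rhs => rw [← List.map_id T]
  refine List.map_congr_left fun c _ => ?_
  rw [id, List.filter_eq_self]
  intro a _
  have := a.isLt
  simp only [decide_eq_true_eq]; omega

/-- The increments in `t` are the multiplicities of the letters, and a column is a sorted list. -/
theorem column_eq_of_length_filter {c d : List (Letter m n)} (hc : IsColumn c) (hd : IsColumn d)
    (h : ∀ t : ℕ, (c.filter fun a => decide (a.val < t)).length =
      (d.filter fun a => decide (a.val < t)).length) : c = d := by
  have hp : c.Perm d := by
    rw [List.perm_iff_count]
    intro a
    have key : ∀ c : List (Letter m n), (c.filter fun b => decide (b.val < a.val + 1)).length =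
        (c.filter fun b => decide (b.val < a.val)).length + c.count a := by
      intro c
      induction c with
      | nil => rfl
      | cons b c ih =>
        simp only [List.filter_cons, List.count_cons, decide_eq_true_eq, beq_iff_eq, Fin.ext_iff]
        split_ifs <;> (try simp only [List.length_cons]) <;> omega
    have h1 := key c
    have h2 := key d
    have h3 := h a.val
    have h4 := h (a.val + 1)
    omega
  have hc' : c.Pairwise (· ≤ ·) := hc.imp fun h => h.le
  have hd' : d.Pairwise (· ≤ ·) := hd.imp fun h => h.le
  exact hp.eq_of_pairwise (fun a b _ _ h h' => le_antisymm h h') hc' hd'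

/-- `restr` keeps columns that become empty, so column `j` of the restriction always comes from
column `j` of the tableau, and each column can be recovered separately. -/
theorem tab_eq_of_colLen_restr : ∀ {T T' : List (List (Letter m n))}, IsTab T → IsTab T' →
    [] ∉ T → [] ∉ T' → (∀ t, colLen (restr t T) = colLen (restr t T')) → T = T'
  | [], [], _, _, _, _, _ => rfl
  | [], c :: T', _, _, _, h, h' => by
    have := congrFun (h' (m + n)) 0
    rw [restr_of_le _ le_rfl, restr_of_le _ le_rfl] at this
    exact absurd (List.length_eq_zero_iff.1 this.symm) fun e : c = [] => h (by simp [e])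
  | c :: T, [], _, _, h, _, h' => by
    have := congrFun (h' (m + n)) 0
    rw [restr_of_le _ le_rfl, restr_of_le _ le_rfl] at this
    exact absurd (List.length_eq_zero_iff.1 this) fun e : c = [] => h (by simp [e])
  | c :: T, c' :: T', h1, h2, h3, h4, h => by
    have e1 : c = c' := column_eq_of_length_filter h1.1 h2.1 fun t => congrFun (h t) 0
    have e2 : T = T' := tab_eq_of_colLen_restr h1.2.2 h2.2.2 (fun h => h3 (by simp [h]))
      (fun h => h4 (by simp [h])) fun t => funext fun j => congrFun (h t) (j + 1)
    rw [e1, e2]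

/-- In both elementary relations `z` is a largest letter. If `z` survives, so does the whole
relation; if `z` is removed, the two sides coincide. -/
theorem Knuth.restrict {w w' : Word m n} (h : Knuth ColLt w w') (t : ℕ) :
    Knuth ColLt (w.filter fun a => decide (a.val < t)) (w'.filter fun a => decide (a.val < t)) := by
  refine h.filter ?_ ?_ <;>
  · intro x y z h1 h2 h3
    unfold ColLt at h1 h2
    simp only [decide_eq_true_eq] at h3 ⊢
    omega

theorem Knuth.colLen_eq {T T' : List (List (Letter m n))} (h : IsTab T) (h' : IsTab T')
    (hk : Knuth ColLt (readCols T) (readCols T')) : colLen T = colLen T' :=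
  colLen_eq_of_rowColorable h h' fun k N => hk.rowColorable_iff ColLt.trans ColLt.cotrans k N

/-- Every plactic class contains at most one tableau. -/
theorem Knuth.tab_eq {T T' : List (List (Letter m n))} (h : IsTab T) (h' : IsTab T')
    (h0 : [] ∉ T) (h0' : [] ∉ T') (hk : Knuth ColLt (readCols T) (readCols T')) : T = T' := by
  refine tab_eq_of_colLen_restr h h' h0 h0' fun t => ?_
  refine Knuth.colLen_eq (h.restr t) (h'.restr t) ?_
  rw [readCols_restr, readCols_restr]
  exact hk.restrict t

end Tableaux

/-! ### Column insertion -/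

section Insertion

variable {m n : ℕ}

/-- The column obtained by inserting `x` into a column: `x` replaces the topmost entry that may not
stand above it, or is appended. -/
def colIns : List (Letter m n) → Letter m n → List (Letter m n)
  | [], x => [x]
  | y :: c, x => if ColLt y x then y :: colIns c x else x :: c

/-- The entry bumped by the insertion of `x` into a column, if any. -/
def bump : List (Letter m n) → Letter m n → Option (Letter m n)
  | [], _ => none
  | y :: c, x => if ColLt y x then bump c x else some y

/-- Column insertion into a tableau. -/
def ins : List (List (Letter m n)) → Letter m n → List (List (Letter m n))
  | [], x => [[x]]
  | c :: T, x => colIns c x :: (bump c x).elim T (ins T)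

/-- The index of the column that grows under column insertion. -/
def insCol : List (List (Letter m n)) → Letter m n → ℕ
  | [], _ => 0
  | c :: T, x => (bump c x).elim 0 fun y => insCol T y + 1

theorem bump_eq_none : ∀ {c : List (Letter m n)} {x}, bump c x = none ↔ ∀ a ∈ c, ColLt a x
  | [], x => by simp [bump]
  | y :: c, x => by
    simp only [bump, List.mem_cons, forall_eq_or_imp]
    split_ifs with h
    · simp [h, bump_eq_none]
    · simp [h]

theorem colIns_of_forall : ∀ {c : List (Letter m n)} {x}, (∀ a ∈ c, ColLt a x) →
    colIns c x = c ++ [x]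
  | [], x, _ => rfl
  | y :: c, x, h => by
    simp only [List.mem_cons, forall_eq_or_imp] at h
    simp [colIns, h.1, colIns_of_forall h.2]

theorem colIns_of_bump_eq_none {c : List (Letter m n)} {x} (h : bump c x = none) :
    colIns c x = c ++ [x] := colIns_of_forall (bump_eq_none.1 h)

theorem length_colIns : ∀ (c : List (Letter m n)) (x),
    (colIns c x).length = c.length + if bump c x = none then 1 else 0
  | [], x => rfl
  | y :: c, x => by
    by_cases h : ColLt y x
    · simp only [colIns, bump, h, if_true, List.length_cons, length_colIns c x]; omega
    · simp [colIns, bump, h]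

theorem mem_colIns_self : ∀ (c : List (Letter m n)) (x), x ∈ colIns c x
  | [], x => by simp [colIns]
  | y :: c, x => by
    simp only [colIns]; split_ifs <;> simp [mem_colIns_self]

theorem colIns_ne_nil (c : List (Letter m n)) (x) : colIns c x ≠ [] :=
  List.ne_nil_of_mem (mem_colIns_self c x)

theorem eq_or_mem_of_mem_colIns : ∀ {c : List (Letter m n)} {x a}, a ∈ colIns c x → a = x ∨ a ∈ c
  | [], x, a, h => by simpa [colIns] using h
  | y :: c, x, a, h => by
    simp only [colIns] at h
    split_ifs at h
    · rcases List.mem_cons.1 h with h | h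
      · simp [h]
      · rcases eq_or_mem_of_mem_colIns h with h | h <;> simp [h]
    · rcases List.mem_cons.1 h with h | h <;> simp [h]

theorem bump_spec : ∀ {c : List (Letter m n)} {x y}, bump c x = some y → ¬ ColLt y x ∧ y ∈ c
  | z :: c, x, y, h => by
    simp only [bump] at h
    split_ifs at h with h1
    · have := bump_spec h
      exact ⟨this.1, by simp [this.2]⟩
    · simp only [Option.some.injEq] at h
      subst h
      exact ⟨h1, by simp⟩

theorem IsColumn.colIns : ∀ {c : List (Letter m n)} {x}, IsColumn c → IsColumn (colIns c x)
  | [], x, _ => by simp [HookCrystal.colIns, IsColumn]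
  | y :: c, x, h => by
    have h' := List.pairwise_cons.1 h
    simp only [HookCrystal.colIns]
    split_ifs with h1
    · refine List.pairwise_cons.2 ⟨fun a ha => ?_, IsColumn.colIns h'.2⟩
      rcases eq_or_mem_of_mem_colIns ha with rfl | ha
      · exact h1
      · exact h'.1 a ha
    · refine List.pairwise_cons.2 ⟨fun a ha => ?_, h'.2⟩
      by_contra h2
      exact ColLt.cotrans _ _ _ h1 h2 (h'.1 a ha)

/-- The letter `x` travels to the left through `l` by relations `upper`. -/
theorem knuth_append_singleton {x : Letter m n} : ∀ {l : List (Letter m n)} {a},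
    IsColumn (a :: l) → ¬ ColLt a x → Knuth ColLt (a :: l ++ [x]) (a :: x :: l)
  | [], a, _, _ => .refl _
  | b :: l, a, h, hx => by
    have h' := List.pairwise_cons.1 h
    have hab := h'.1 b (by simp)
    have hbx : ¬ ColLt b x := fun h2 => hx (ColLt.trans _ _ _ hab h2)
    have h1 := (knuth_append_singleton h'.2 hbx).append [a] []
    simp only [List.append_nil] at h1
    exact .trans _ _ _ h1 (.rel _ _ (.upper [] l x a b hab hx))

/-- The bumped letter moves to the front of the column, that is, to the end of the reading of the
columns further right, where it is inserted next. -/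
theorem knuth_colIns : ∀ {c : List (Letter m n)} {x y}, IsColumn c → bump c x = some y →
    Knuth ColLt (c ++ [x]) (y :: colIns c x)
  | z :: c, x, y, hc, h => by
    have hc' := List.pairwise_cons.1 hc
    by_cases h1 : ColLt z x
    · simp only [bump, colIns, h1, if_true] at h ⊢
      have h2 := (knuth_colIns hc'.2 h).append [z] []
      simp only [List.append_nil] at h2
      refine .trans _ _ _ h2 ?_
      obtain ⟨hyx, hy⟩ := bump_spec h
      cases c with
      | nil => simp [bump] at h
      | cons w c =>
        have hzw : ColLt z w := hc'.1 w (by simp)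
        by_cases h3 : ColLt w x
        · simp only [colIns, h3, if_true]
          exact .rel _ _ (.lower [] _ z w y hzw fun h4 => hyx (ColLt.trans _ _ _ h4 h3))
        · simp only [colIns, h3, if_false]
          exact .rel _ _ (.lower [] _ z x y h1 hyx)
    · simp only [bump, colIns, h1, if_false, Option.some.injEq] at h ⊢
      subst h
      exact knuth_append_singleton hc h1

theorem Adj.colIns_left_of_none {c d : List (Letter m n)} (h : Adj c d) (e : List (Letter m n)) :
    Adj (c ++ e) d := by
  induction c generalizing d with
  | nil => cases d with
    | nil => simp
    | cons => exact h.elim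
  | cons x c ih => cases d with
    | nil => simp
    | cons y d => exact ⟨h.1, ih h.2⟩

theorem Adj.colIns_left : ∀ {c d : List (Letter m n)} {x y}, Adj c d → bump c x = some y →
    Adj (colIns c x) d
  | z :: c, [], x, y, _, _ => adj_nil _
  | z :: c, w :: d, x, y, h, hb => by
    simp only [bump, colIns] at hb ⊢
    split_ifs at hb ⊢ with h1
    · exact ⟨h.1, h.2.colIns_left hb⟩
    · exact ⟨ColLt.cotrans _ _ _ h.1 h1, h.2⟩

/-- The bumped letter `y` lands in `d` in its old row or higher, and every entry of `colIns c x` in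
these rows may stand to the left of `y`. -/
theorem Adj.colIns_colIns : ∀ {c d : List (Letter m n)} {x y}, Adj c d → bump c x = some y →
    Adj (colIns c x) (colIns d y)
  | z :: c, d, x, y, h, hb => by
    simp only [bump] at hb
    split_ifs at hb with h1
    · have hyz : ¬ ColLt y z := fun h2 => (bump_spec hb).1 (ColLt.trans _ _ _ h2 h1)
      simp only [colIns, h1, if_true]
      cases d with
      | nil => exact ⟨hyz, adj_nil _⟩
      | cons w d =>
        simp only [colIns]
        split_ifs with h2
        · exact ⟨h.1, h.2.colIns_colIns hb⟩
        · exact ⟨hyz, h.2.colIns_left hb⟩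
    · simp only [Option.some.injEq] at hb
      subst hb
      simp only [colIns, h1, if_false]
      cases d with
      | nil => exact ⟨h1, adj_nil _⟩
      | cons w d =>
        simp only [colIns, h.1, if_false]
        exact ⟨h1, h.2⟩

theorem Adj.of_colIns_left : ∀ {c d : List (Letter m n)} {x y}, Adj (colIns c x) d →
    bump c x = some y → (∀ e ∈ d, ¬ ColLt e y) → Adj c d
  | z :: c, [], x, y, _, _, _ => adj_nil _
  | z :: c, w :: d, x, y, h, hb, hd => by
    simp only [List.mem_cons, forall_eq_or_imp] at hd
    simp only [bump, colIns] at hb h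
    split_ifs at hb h with h1
    · exact ⟨h.1, h.2.of_colIns_left hb hd.2⟩
    · simp only [Option.some.injEq] at hb
      subst hb
      exact ⟨hd.1, h.2⟩

theorem Adj.exists_not_colLt : ∀ {c d : List (Letter m n)} {b}, Adj c d → b ∈ d →
    ∃ a ∈ c, ¬ ColLt b a
  | x :: c, y :: d, b, h, hb => by
    rcases List.mem_cons.1 hb with rfl | hb
    · exact ⟨x, by simp, h.1⟩
    · obtain ⟨a, ha, h'⟩ := h.2.exists_not_colLt hb
      exact ⟨a, by simp [ha], h'⟩
  | [], _ :: _, _, h, _ => h.elim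

/-- The converse of `Adj.colIns_colIns`, needed to know that reverse insertion yields a tableau. -/
theorem Adj.of_colIns_colIns : ∀ {c d : List (Letter m n)} {x y}, IsColumn c → IsColumn d →
    Adj (colIns c x) (colIns d y) → bump c x = some y → Adj c d
  | z :: c, [], x, y, _, _, _, _ => adj_nil _
  | z :: c, w :: d, x, y, hc, hd, h, hb => by
    have hc' := List.pairwise_cons.1 hc
    have hd' := List.pairwise_cons.1 hd
    by_cases h1 : ColLt z x <;> by_cases h2 : ColLt w y <;>
      simp only [bump, colIns, h1, h2, if_true, if_false, Option.some.injEq] at hb h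
    · exact ⟨h.1, h.2.of_colIns_colIns hc'.2 hd'.2 hb⟩
    · exact ⟨ColLt.cotrans _ _ _ h2 h.1, h.2.of_colIns_left hb fun e he h3 =>
        h2 (ColLt.trans _ _ _ (hd'.1 e he) h3)⟩
    · subst hb
      obtain ⟨a, ha, h3⟩ := h.2.exists_not_colLt (mem_colIns_self d z)
      exact absurd (hc'.1 a ha) h3
    · subst hb
      exact ⟨h2, h.2⟩

/-- In the new column, the inserted letter is the lowest entry that may stand to the left of the
bumped `y`; this identifies the row of the bump. -/
theorem colIns_injective : ∀ {c d : List (Letter m n)} {x x' y}, IsColumn c → IsColumn d →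
    bump c x = some y → bump d x' = some y → colIns c x = colIns d x' → c = d ∧ x = x'
  | z :: c, w :: d, x, x', y, hc, hd, hb, hb', h => by
    have hc' := List.pairwise_cons.1 hc
    have hd' := List.pairwise_cons.1 hd
    by_cases h1 : ColLt z x <;> by_cases h2 : ColLt w x' <;>
      simp only [bump, colIns, h1, h2, if_true, if_false, Option.some.injEq, List.cons.injEq]
        at hb hb' h ⊢
    · obtain ⟨e1, e2⟩ := colIns_injective hc'.2 hd'.2 hb hb' h.2
      exact ⟨⟨h.1, e1⟩, e2⟩
    · have := hd'.1 x (h.2 ▸ mem_colIns_self c x)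
      exact absurd (hb' ▸ this) (bump_spec hb).1
    · have := hc'.1 x' (h.2 ▸ mem_colIns_self d x')
      exact absurd (hb ▸ this) (bump_spec hb').1
    · exact ⟨⟨hb.trans hb'.symm, h.2⟩, h.1⟩

/-- Reverse bumping: `y` replaces the lowest entry that may stand to its left, and the replaced
entry is `x`. -/
theorem exists_colIns : ∀ {c : List (Letter m n)} {y}, IsColumn c → (∃ a ∈ c, ¬ ColLt y a) →
    ∃ c' x, IsColumn c' ∧ bump c' x = some y ∧ colIns c' x = c ∧ ∀ a ∈ c', a = y ∨ a ∈ c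
  | z :: c, y, hc, h => by
    have hc' := List.pairwise_cons.1 hc
    by_cases h1 : ∃ a ∈ c, ¬ ColLt y a
    · obtain ⟨c', x, h2, h3, h4, h5⟩ := exists_colIns hc'.2 h1
      have hx : ColLt z x := hc'.1 x (h4 ▸ mem_colIns_self c' x)
      refine ⟨z :: c', x, List.pairwise_cons.2 ⟨fun a ha => ?_, h2⟩, by simp [bump, hx, h3],
        by simp [colIns, hx, h4], fun a ha => ?_⟩
      · rcases h5 a ha with rfl | ha
        · by_contra h6
          exact (bump_spec h3).1 (by
            by_contra h7
            obtain ⟨b, hb, hyb⟩ := h1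
            exact ColLt.cotrans _ _ _ h6 hyb (hc'.1 b hb))
        · exact hc'.1 a ha
      · rcases List.mem_cons.1 ha with rfl | ha
        · simp
        · rcases h5 a ha with h6 | h6 <;> simp [h6]
    · push Not at h1
      have hz : ¬ ColLt y z := by
        obtain ⟨a, ha, h⟩ := h
        rcases List.mem_cons.1 ha with rfl | ha
        · exact h
        · exact absurd (h1 a ha) h
      exact ⟨y :: c, z, List.pairwise_cons.2 ⟨h1, hc'.2⟩, by simp [bump, hz], by simp [colIns, hz],
        fun a ha => by rcases List.mem_cons.1 ha with h2 | h2 <;> simp [h2]⟩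

theorem headD_ins (T : List (List (Letter m n))) (y) : (ins T y).headD [] = colIns (T.headD []) y := by
  cases T <;> simp [ins, colIns]

theorem IsTab.ins : ∀ {T : List (List (Letter m n))} {x}, IsTab T → IsTab (ins T x)
  | [], x, _ => ⟨by simp [IsColumn], adj_nil _, trivial⟩
  | c :: T, x, h => by
    simp only [HookCrystal.ins]
    cases hb : bump c x with
    | none =>
      refine ⟨h.1.colIns, ?_, h.2.2⟩
      rw [colIns_of_bump_eq_none hb]
      exact h.2.1.colIns_left_of_none _
    | some y =>
      refine ⟨h.1.colIns, ?_, h.2.2.ins⟩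
      simp only [Option.elim_some, headD_ins]
      exact h.2.1.colIns_colIns hb

theorem nil_notMem_ins : ∀ {T : List (List (Letter m n))} {x}, [] ∉ T → [] ∉ ins T x
  | [], x, _ => by simp [ins]
  | c :: T, x, h => by
    simp only [List.mem_cons, not_or] at h
    simp only [ins, List.mem_cons, not_or]
    refine ⟨(colIns_ne_nil c x).symm, ?_⟩
    cases bump c x with
    | none => exact h.2
    | some y => exact nil_notMem_ins h.2

theorem knuth_ins : ∀ {T : List (List (Letter m n))} {x}, IsTab T →
    Knuth ColLt (readCols T ++ [x]) (readCols (ins T x))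
  | [], x, _ => .refl _
  | c :: T, x, h => by
    cases hb : bump c x with
    | none =>
      simp only [ins, hb, readCols, Option.elim_none, colIns_of_bump_eq_none hb, List.append_assoc]
      exact .refl _
    | some y =>
      simp only [ins, hb, readCols, Option.elim_some, List.append_assoc]
      have h1 := (knuth_colIns h.1 hb).append (readCols T) []
      have h2 := (knuth_ins h.2.2 (x := y)).append [] (colIns c x)
      simp only [List.append_nil, List.nil_append, List.append_assoc, List.singleton_append] at h1 h2
      exact .trans _ _ _ h1 h2

theorem colLen_ins : ∀ (T : List (List (Letter m n))) (x) (j : ℕ),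
    colLen (ins T x) j = colLen T j + if j = insCol T x then 1 else 0
  | [], x, j => by
    cases j <;> simp [ins, insCol]
  | c :: T, x, j => by
    cases hb : bump c x <;> cases j <;>
      simp [ins, insCol, hb, length_colIns, colLen_ins T]

/-- Reverse bumping, started at the new box, recovers both the tableau and the inserted letter. The
column of the box must be prescribed, because reverse bumping may start at any corner. -/
theorem ins_injective : ∀ {T T' : List (List (Letter m n))} {x x'}, IsTab T → IsTab T' →
    [] ∉ T → [] ∉ T' → insCol T x = insCol T' x' → ins T x = ins T' x' → T = T' ∧ x = x'
  | [], [], x, x', _, _, _, _, _, h => by simpa [ins] using h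
  | [], c :: T, x, x', _, _, _, h1, h2, h => by
    cases hb : bump c x' with
    | none =>
      simp only [ins, hb, colIns_of_bump_eq_none hb, List.cons.injEq, Option.elim_none] at h
      have := congrArg List.length h.1
      simp only [List.length_append, List.length_cons, List.length_nil] at this
      exact absurd (List.length_eq_zero_iff.1 (by omega)) fun e : c = [] => h1 (by simp [e])
    | some y => simp [insCol, hb] at h2
  | c :: T, [], x, x', _, _, h1, _, h2, h => by
    cases hb : bump c x with
    | none =>
      simp only [ins, hb, colIns_of_bump_eq_none hb, List.cons.injEq, Option.elim_none] at h
      have := congrArg List.length h.1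
      simp only [List.length_append, List.length_cons, List.length_nil] at this
      exact absurd (List.length_eq_zero_iff.1 (by omega)) fun e : c = [] => h1 (by simp [e])
    | some y => simp [insCol, hb] at h2
  | c :: T, c' :: T', x, x', hT, hT', h1, h1', h2, h => by
    simp only [List.mem_cons, not_or] at h1 h1'
    cases hb : bump c x with
    | none =>
      cases hb' : bump c' x' with
      | none =>
        simp only [ins, hb, hb', colIns_of_bump_eq_none, List.cons.injEq, Option.elim_none] at h
        have := List.append_inj' h.1 rfl
        simp only [List.cons.injEq, and_true] at this
        simp [this, h.2]
      | some y' => simp [insCol, hb, hb'] at h2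
    | some y =>
      cases hb' : bump c' x' with
      | none => simp [insCol, hb, hb'] at h2
      | some y' =>
        simp only [ins, insCol, hb, hb', List.cons.injEq, Option.elim_some, add_left_inj] at h h2
        obtain ⟨e1, e2⟩ := ins_injective hT.2.2 hT'.2.2 h1.2 h1'.2 h2 h.2
        subst e2
        obtain ⟨e3, e4⟩ := colIns_injective hT.1 hT'.1 hb hb' h.1
        simp [e1, e3, e4]

/-- The inequality says that column `j` ends in a corner, from which reverse bumping starts. -/
theorem exists_ins : ∀ {T : List (List (Letter m n))} (j : ℕ), IsTab T → [] ∉ T →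
    colLen T (j + 1) < colLen T j →
    ∃ T' x, IsTab T' ∧ [] ∉ T' ∧ ins T' x = T ∧ insCol T' x = j
  | [], j, _, _, h => by simp at h
  | c :: T, 0, hT, h0, h => by
    simp only [List.mem_cons, not_or] at h0
    obtain ⟨c', x, rfl⟩ : ∃ c' x, c = c' ++ [x] := by
      rcases List.eq_nil_or_concat c with h1 | ⟨c', x, h1⟩
      · exact absurd h1.symm h0.1
      · exact ⟨c', x, by simpa using h1⟩
    have hc := List.pairwise_append.1 hT.1
    have hb : bump c' x = none := bump_eq_none.2 fun a ha => hc.2.2 a ha x (by simp)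
    cases T with
    | nil =>
      -- A column that loses its only letter has to be dropped, in order to satisfy `[] ∉ T'`.
      rcases eq_or_ne c' [] with rfl | hne
      · exact ⟨[], x, trivial, by simp, rfl, rfl⟩
      · exact ⟨[c'], x, ⟨hc.1, adj_nil _, trivial⟩, by simpa using hne.symm,
          by simp [ins, hb, colIns_of_bump_eq_none], by simp [insCol, hb]⟩
    | cons d T =>
      -- By the corner hypothesis no entry of `d` stands to the right of `x`.
      have hlen : d.length ≤ c'.length := by
        simp at h; omega
      have hadj : Adj c' d := by
        have := hT.2.1
        simp only [List.headD_cons] at this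
        clear hT hc hb h h0
        induction c' generalizing d with
        | nil =>
          simp at hlen; subst hlen; simp
        | cons a c' ih =>
          cases d with
          | nil => simp
          | cons b d => exact ⟨this.1, ih d (by simpa using hlen) this.2⟩
      refine ⟨c' :: d :: T, x, ⟨hc.1, hadj, hT.2.2⟩, ?_, by simp [ins, hb, colIns_of_bump_eq_none],
        by simp [insCol, hb]⟩
      rw [List.mem_cons, not_or]
      refine ⟨?_, h0.2⟩
      rintro rfl
      simp only [List.length_nil, Nat.le_zero, List.length_eq_zero_iff] at hlen
      exact h0.2 (by simp [hlen])
  | c :: T, j + 1, hT, h0, h => by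
    simp only [List.mem_cons, not_or] at h0
    obtain ⟨S, y, hS, hS0, rfl, hj⟩ := exists_ins j hT.2.2 h0.2 (by simpa using h)
    have hadj := hT.2.1
    rw [headD_ins] at hadj
    obtain ⟨c', x, h1, h2, rfl, _⟩ := exists_colIns hT.1
      (hadj.exists_not_colLt (mem_colIns_self _ y))
    have hd : IsColumn (S.headD []) := by
      cases S with
      | nil => exact List.Pairwise.nil
      | cons => exact hS.1
    refine ⟨c' :: S, x, ⟨h1, hadj.of_colIns_colIns h1 hd h2, hS⟩, ?_, by simp [ins, h2],
      by simp [insCol, h2, hj]⟩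
    rw [List.mem_cons, not_or]
    refine ⟨?_, hS0⟩
    rintro rfl
    simp [bump] at h2

/-- The second letter bumps an entry in the row of `x` or above it, hence it always bumps, and the
bumped letters satisfy the same row condition as `x` and `y`. -/
theorem exists_bump_bump : ∀ {c : List (Letter m n)} {x x' y}, bump c x = some x' →
    ¬ ColLt x y → ∃ y', bump (colIns c x) y = some y' ∧ ¬ ColLt x' y'
  | z :: c, x, x', y, hb, h => by
    simp only [bump, colIns] at hb ⊢
    split_ifs at hb ⊢ with h1
    · by_cases h2 : ColLt z y
      · simpa only [bump, h2, if_true] using exists_bump_bump hb h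
      · exact ⟨z, by simp [bump, h2], fun h3 => (bump_spec hb).1 (ColLt.trans _ _ _ h3 h1)⟩
    · simp only [Option.some.injEq] at hb
      subst hb
      exact ⟨x, by simp [bump, h], h1⟩

/-- Here the second bump happens strictly below the first one, so the bumped letters are in column
order like `x` and `y`. -/
theorem colLt_of_bump_bump : ∀ {c : List (Letter m n)} {x x' y y'}, IsColumn c →
    bump c x = some x' → ColLt x y → bump (colIns c x) y = some y' → ColLt x' y'
  | z :: c, x, x', y, y', hc, hb, h, hb' => by
    have hc' := List.pairwise_cons.1 hc
    simp only [bump, colIns] at hb hb'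
    split_ifs at hb hb' with h1
    · have h2 : ColLt z y := ColLt.trans _ _ _ h1 h
      simp only [bump, h2, if_true] at hb'
      exact colLt_of_bump_bump hc'.2 hb h hb'
    · simp only [Option.some.injEq] at hb
      subst hb
      simp only [bump, h, if_true] at hb'
      exact hc'.1 _ (bump_spec hb').2

/-- Under two successive insertions, the second new box lies strictly to the right of the first one
exactly if the two letters may stand in this order in a row word. -/
theorem insCol_lt_insCol_ins : ∀ {T : List (List (Letter m n))} {x y}, IsTab T →
    (insCol T x < insCol (ins T x) y ↔ ¬ ColLt x y)
  | [], x, y, _ => by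
    by_cases h : ColLt x y <;> simp [ins, insCol, bump, h]
  | c :: T, x, y, hT => by
    cases hb : bump c x with
    | none =>
      simp only [ins, insCol, hb, Option.elim_none]
      have hall := bump_eq_none.1 hb
      by_cases h : ColLt x y
      · have : bump (colIns c x) y = none := by
          rw [bump_eq_none]
          intro a ha
          rcases eq_or_mem_of_mem_colIns ha with rfl | ha
          · exact h
          · exact ColLt.trans _ _ _ (hall a ha) h
        simp [this, h]
      · cases hb' : bump (colIns c x) y with
        | none => exact absurd (bump_eq_none.1 hb' x (mem_colIns_self c x)) h
        | some y' => simp [h]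
    | some x' =>
      simp only [ins, insCol, hb, Option.elim_some]
      by_cases h : ColLt x y
      · cases hb' : bump (colIns c x) y with
        | none => simp [h]
        | some y' =>
          have h1 := colLt_of_bump_bump hT.1 hb h hb'
          have h2 := insCol_lt_insCol_ins (x := x') (y := y') hT.2.2
          simp only [Option.elim_some, add_lt_add_iff_right, h2, h, h1]
      · obtain ⟨y', hb', h1⟩ := exists_bump_bump hb h
        have h2 := insCol_lt_insCol_ins (x := x') (y := y') hT.2.2
        simp only [hb', Option.elim_some, add_lt_add_iff_right, h2, h, h1]

/-- The insertion tableau of a word. -/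
def pTab (w : Word m n) : List (List (Letter m n)) := w.foldl ins []

theorem pTab_concat (w : Word m n) (x) : pTab (w ++ [x]) = ins (pTab w) x := by
  simp [pTab]

theorem pTab_spec (w : Word m n) :
    IsTab (pTab w) ∧ [] ∉ pTab w ∧ Knuth ColLt w (readCols (pTab w)) := by
  induction w using List.reverseRecOn with
  | nil => exact ⟨trivial, by simp [pTab], .refl _⟩
  | append_singleton w x ih =>
    rw [pTab_concat]
    refine ⟨ih.1.ins, nil_notMem_ins ih.2.1, ?_⟩
    have := ih.2.2.append [] [x]
    exact .trans _ _ _ this (knuth_ins ih.1)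

theorem isTab_pTab (w : Word m n) : IsTab (pTab w) := (pTab_spec w).1

theorem nil_notMem_pTab (w : Word m n) : [] ∉ pTab w := (pTab_spec w).2.1

theorem knuth_readCols_pTab (w : Word m n) : Knuth ColLt w (readCols (pTab w)) := (pTab_spec w).2.2

theorem Knuth.pTab_eq {w w' : Word m n} (h : Knuth ColLt w w') : pTab w = pTab w' :=
  Knuth.tab_eq (isTab_pTab w) (isTab_pTab w') (nil_notMem_pTab w) (nil_notMem_pTab w')
    (.trans _ _ _ (.symm _ _ (knuth_readCols_pTab w)) (.trans _ _ _ h (knuth_readCols_pTab w')))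

theorem pTab_readCols {T : List (List (Letter m n))} (h : IsTab T) (h0 : [] ∉ T) :
    pTab (readCols T) = T :=
  Knuth.tab_eq (isTab_pTab _) h (nil_notMem_pTab _) h0 (.symm _ _ (knuth_readCols_pTab _))

/-- The shape of the subtableau of letters `< t` of the insertion tableau of `w` is the shape of the
insertion tableau of the subword of letters `< t`. -/
theorem colLen_restr_pTab (t : ℕ) (w : Word m n) :
    colLen (restr t (pTab w)) = colLen (pTab (w.filter fun a => decide (a.val < t))) := by
  refine Knuth.colLen_eq ((isTab_pTab w).restr t) (isTab_pTab _) ?_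
  rw [readCols_restr]
  exact .trans _ _ _ (.symm _ _ ((knuth_readCols_pTab w).restrict t)) (knuth_readCols_pTab _)

/-- Lets the length of a word be read off from the shape of its insertion tableau. -/
theorem sum_colLen (w : Word m n) : ((pTab w).map List.length).sum = w.length := by
  induction w using List.reverseRecOn with
  | nil => rfl
  | append_singleton w x ih =>
    rw [pTab_concat, List.length_append, ← ih, List.length_singleton]
    generalize pTab w = T
    induction T generalizing x with
    | nil => rfl
    | cons c T iT =>
      cases hb : bump c x with
      | none => simp [ins, hb, length_colIns]; omega
      | some y =>
        have := iT y
        simp only [ins, hb, List.map_cons, List.sum_cons, length_colIns, Option.elim_some] at this ⊢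
        simp only [reduceCtorEq, if_false]
        omega

end Insertion

/-! ### The signature rule -/

section Signature

variable {m n : ℕ}

/-- The number of unmatched closing letters `c`, if each `o` is an opening bracket. -/
def clos (o c : Letter m n) : Word m n → ℕ
  | [] => 0
  | b :: w => if b = c then clos o c w + 1 else if b = o then clos o c w - 1 else clos o c w

/-- The number of unmatched opening letters `o`, if each `c` is a closing bracket. -/
def opn (o c : Letter m n) : Word m n → ℕ
  | [] => 0
  | b :: w => if b = o ∧ clos o c w = 0 then opn o c w + 1 else opn o c w

/-- Replace the first unmatched opening letter by a closing one. -/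
def changeOpen (o c : Letter m n) : Word m n → Option (Word m n)
  | [] => none
  | b :: w => if b = o ∧ clos o c w = 0 then some (c :: w) else (changeOpen o c w).map (b :: ·)

/-- Replace the last unmatched closing letter by an opening one. -/
def changeClose (o c : Letter m n) : Word m n → Option (Word m n)
  | [] => none
  | b :: w => if clos o c w ≤ (if b = o then 1 else 0) then (if b = c then some (o :: w) else none)
      else (changeClose o c w).map (b :: ·)

variable {o c : Letter m n}

/-- The unmatched openings of `u` cancel closings of `v`; the truncated subtraction counts those
that remain. -/
theorem clos_append (h : o ≠ c) (u v : Word m n) :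
    clos o c (u ++ v) = clos o c u + (clos o c v - opn o c u) := by
  induction u with
  | nil => simp [clos, opn]
  | cons b u ih =>
    simp only [List.cons_append, clos, opn, ih]
    split_ifs <;> simp_all <;> omega

theorem opn_append (h : o ≠ c) (u v : Word m n) :
    opn o c (u ++ v) = opn o c v + (opn o c u - clos o c v) := by
  induction u with
  | nil => simp [opn]
  | cons b u ih =>
    simp only [List.cons_append, opn, ih, clos_append h]
    split_ifs <;> simp_all <;> omega

/-- Matched pairs do not contribute to either difference. This is the source of axiom (a) for the
indices other than `0`. -/
theorem opn_sub_clos (h : o ≠ c) (w : Word m n) :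
    (opn o c w : ℤ) - clos o c w = w.count o - w.count c := by
  induction w with
  | nil => rfl
  | cons b w ih =>
    simp only [clos, opn, List.count_cons, beq_iff_eq]
    split_ifs <;> simp_all <;> omega

/-- The conditions on `p` and `s` do not mention the letter between them, and they are the same in
`changeClose_eq_some`. Hence the two changes are inverse to each other. -/
theorem changeOpen_eq_some (h : o ≠ c) {w w' : Word m n} :
    changeOpen o c w = some w' ↔
      ∃ p s, w = p ++ o :: s ∧ w' = p ++ c :: s ∧ opn o c p = 0 ∧ clos o c s = 0 := by
  induction w generalizing w' with
  | nil => simp [changeOpen]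
  | cons b w ih =>
    simp only [changeOpen]
    have hcl : ∀ p s, clos o c s = 0 → clos o c (p ++ o :: s) = clos o c p := by
      intro p s hs
      rw [clos_append h]
      simp [clos, h, hs]
    split_ifs with hb
    · obtain ⟨rfl, hw⟩ := hb
      constructor
      · rintro e
        simp only [Option.some.injEq] at e
        exact ⟨[], w, rfl, by simp [e], rfl, hw⟩
      · rintro ⟨p, s, h1, rfl, h3, h4⟩
        cases p with
        | nil => simp_all
        | cons a p =>
          simp only [List.cons_append, List.cons.injEq] at h1
          obtain ⟨rfl, rfl⟩ := h1
          rw [hcl _ _ h4] at hw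
          simp [opn, hw] at h3
    · rw [Option.map_eq_some_iff]
      constructor
      · rintro ⟨v, hv, rfl⟩
        obtain ⟨p, s, rfl, rfl, h3, h4⟩ := ih.1 hv
        rw [hcl _ _ h4] at hb
        exact ⟨b :: p, s, rfl, rfl, by simp [opn, hb, h3], h4⟩
      · rintro ⟨p, s, h1, rfl, h3, h4⟩
        cases p with
        | nil =>
          simp only [List.nil_append, List.cons.injEq] at h1
          exact absurd ⟨h1.1, h1.2 ▸ h4⟩ hb
        | cons a p =>
          simp only [List.cons_append, List.cons.injEq] at h1
          obtain ⟨rfl, rfl⟩ := h1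
          refine ⟨p ++ c :: s, ih.2 ⟨p, s, rfl, rfl, ?_, h4⟩, rfl⟩
          simp only [opn] at h3
          split_ifs at h3
          exact h3

theorem changeClose_eq_some (h : o ≠ c) {w w' : Word m n} :
    changeClose o c w = some w' ↔
      ∃ p s, w = p ++ c :: s ∧ w' = p ++ o :: s ∧ opn o c p = 0 ∧ clos o c s = 0 := by
  induction w generalizing w' with
  | nil => simp [changeClose]
  | cons b w ih =>
    simp only [changeClose]
    have hcl : ∀ p s, opn o c p = 0 → clos o c s = 0 →
        clos o c (p ++ c :: s) = clos o c p + 1 := by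
      intro p s hp hs
      rw [clos_append h]
      simp [clos, hp, hs]
    -- The bound is `1` for an opening `b`, because `b` cancels one closing of `w`; the condition
    -- means that no unmatched closing of `w` is left.
    by_cases hb : clos o c w ≤ if b = o then 1 else 0
    · rw [if_pos hb]
      by_cases hc : b = c
      swap
      · simp only [hc, if_false, reduceCtorEq, false_iff]
        rintro ⟨p, s, h1, rfl, h3, h4⟩
        cases p with
        | nil => simp_all
        | cons a p =>
          simp only [List.cons_append, List.cons.injEq] at h1
          obtain ⟨rfl, rfl⟩ := h1
          have h5 : opn o c p = 0 := by
            simp only [opn] at h3; split_ifs at h3; exact h3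
          rw [hcl _ _ h5 h4] at hb
          split_ifs at hb with hbo
          · have : clos o c p = 0 := by omega
            simp [opn, hbo, this] at h3
          · omega
      subst hc
      simp only [h.symm, if_true, if_false, Nat.le_zero] at hb ⊢
      constructor
      · rintro e
        simp only [Option.some.injEq] at e
        exact ⟨[], w, rfl, by simp [e], rfl, hb⟩
      · rintro ⟨p, s, h1, rfl, h3, h4⟩
        cases p with
        | nil => simp_all
        | cons a p =>
          simp only [List.cons_append, List.cons.injEq] at h1
          obtain ⟨rfl, rfl⟩ := h1
          simp only [opn, h.symm, false_and, if_false] at h3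
          rw [hcl _ _ h3 h4] at hb
          simp at hb
    · rw [if_neg hb, Option.map_eq_some_iff]
      constructor
      · rintro ⟨v, hv, rfl⟩
        obtain ⟨p, s, rfl, rfl, h3, h4⟩ := ih.1 hv
        rw [hcl _ _ h3 h4] at hb
        refine ⟨b :: p, s, rfl, rfl, ?_, h4⟩
        simp only [opn]
        split_ifs with hbo
        · simp [hbo] at hb
        · exact h3
      · rintro ⟨p, s, h1, rfl, h3, h4⟩
        cases p with
        | nil =>
          simp only [List.nil_append, List.cons.injEq] at h1
          obtain ⟨rfl, rfl⟩ := h1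
          simp [h4] at hb
        | cons a p =>
          simp only [List.cons_append, List.cons.injEq] at h1
          obtain ⟨rfl, rfl⟩ := h1
          refine ⟨p ++ o :: s, ih.2 ⟨p, s, rfl, rfl, ?_, h4⟩, rfl⟩
          simp only [opn] at h3
          split_ifs at h3
          exact h3

theorem changeOpen_eq_none {w : Word m n} : changeOpen o c w = none ↔ opn o c w = 0 := by
  induction w with
  | nil => simp [changeOpen, opn]
  | cons b w ih =>
    simp only [changeOpen, opn]
    split_ifs <;> simp [ih]

theorem changeClose_eq_none (h : o ≠ c) {w : Word m n} :
    changeClose o c w = none ↔ clos o c w = 0 := by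
  induction w with
  | nil => simp [changeClose, clos]
  | cons b w ih =>
    simp only [changeClose, clos]
    split_ifs <;> simp_all; omega

/-! ### The crystal of words -/

theorem Index.lo_ne_hi (i : Index m n) : i.lo ≠ i.hi := by
  simp [Index.lo, Index.hi, Fin.ext_iff]

theorem coroot_eq (i : Index m n) (x : Weight m n) :
    coroot i x = x i.lo + if i.val + 1 = m then x i.hi else - x i.hi := by
  have hform : form (simpleRoot i) x =
      (-1) ^ degree i.lo * x i.lo - (-1) ^ degree i.hi * x i.hi := by
    unfold form simpleRoot
    simp only [Pi.sub_apply, sub_mul, mul_sub, Finset.sum_sub_distrib, Pi.single_apply, ite_mul,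
      one_mul, zero_mul, mul_ite, mul_zero, Finset.sum_ite_eq', Finset.mem_univ, if_true]
  unfold coroot
  rw [hform]
  have hl : i.lo.val = i.val := rfl
  have hh : i.hi.val = i.val + 1 := rfl
  simp only [degree, hl, hh]
  split_ifs <;> omega

theorem wordWt_apply (w : Word m n) (b : Letter m n) : wordWt w b = w.count b := by
  induction w with
  | nil => rfl
  | cons a w ih =>
    simp only [wordWt, letterMaps, Pi.add_apply, ih, List.count_cons, Pi.single_apply, beq_iff_eq]
    by_cases h : a = b
    · simp [h, add_comm]
    · simp [h, Ne.symm h]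

theorem coroot_wordWt (i : Index m n) (w : Word m n) : coroot i (wordWt w) =
    w.count i.lo + if i.val + 1 = m then (w.count i.hi : ℤ) else - w.count i.hi := by
  rw [coroot_eq, wordWt_apply, wordWt_apply]

theorem coroot_single (i : Index m n) (b : Letter m n) : coroot i (Pi.single b 1) =
    if b = i.lo then 1 else if b = i.hi then (if i.val + 1 = m then 1 else -1) else 0 := by
  have := i.lo_ne_hi
  rw [coroot_eq]
  simp only [Pi.single_apply, eq_comm (a := i.lo), eq_comm (a := i.hi)]
  split_ifs <;> simp_all

/-- For the barred indices `lo` opens and `hi` closes; `opn_sub_clos` turns the maxima of the tensor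
rule into the cancellation of brackets. -/
theorem wordEps_wordPhi_of_lt {i : Index m n} (hi : i.val + 1 < m) (w : Word m n) :
    wordEps i w = clos i.lo i.hi w ∧ wordPhi i w = opn i.lo i.hi w := by
  have hne := i.lo_ne_hi
  induction w with
  | nil => exact ⟨rfl, rfl⟩
  | cons b w ih =>
    have hs := opn_sub_clos hne w
    simp only [wordEps, wordPhi, tensorEps, tensorPhi, letterMaps, hi, if_true, coroot_single,
      coroot_wordWt, clos, opn, ih.1, ih.2, hi.ne, if_false]
    by_cases h1 : b = i.lo
    · subst h1
      simp only [hne, if_true, if_false, true_and]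
      split_ifs <;> omega
    · by_cases h2 : b = i.hi
      · subst h2
        simp only [hne.symm, if_true, if_false, false_and]
        omega
      · simp only [h1, h2, if_false, false_and]
        omega

/-- For the positive indices the tensor rule is the opposite one, so `hi` opens and `lo` closes. -/
theorem wordEps_wordPhi_of_gt {i : Index m n} (hi : m < i.val + 1) (w : Word m n) :
    wordEps i w = opn i.hi i.lo w ∧ wordPhi i w = clos i.hi i.lo w := by
  have hne := i.lo_ne_hi
  induction w with
  | nil => exact ⟨rfl, rfl⟩
  | cons b w ih =>
    have hs := opn_sub_clos hne.symm w
    simp only [wordEps, wordPhi, tensorEps, tensorPhi, letterMaps, hi.not_gt, if_false,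
      coroot_single, coroot_wordWt, clos, opn, ih.1, ih.2, hi.ne']
    by_cases h1 : b = i.lo
    · subst h1
      simp only [hne, if_true, if_false, false_and]
      omega
    · by_cases h2 : b = i.hi
      · subst h2
        simp only [hne.symm, if_true, if_false, true_and]
        split_ifs <;> omega
      · simp only [h1, h2, if_false, false_and]
        omega

/-- For the index `0` the first letter among `lo` and `hi` decides alone, without any cancellation.
-/
theorem wordEps_cons_of_eq {i : Index m n} (hi : i.val + 1 = m) (b : Letter m n) (w : Word m n) :
    wordEps i (b :: w) = if b = i.lo then 0 else if b = i.hi then 1 else wordEps i w := by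
  have hne := i.lo_ne_hi
  simp only [wordEps, tensorEps, letterMaps, hi, if_true, coroot_single, lt_self_iff_false, if_false]
  by_cases h1 : b = i.lo
  · simp [h1, hne]
  · by_cases h2 : b = i.hi <;> simp [h1, h2, hne.symm]

theorem wordPhi_cons_of_eq {i : Index m n} (hi : i.val + 1 = m) (b : Letter m n) (w : Word m n) :
    wordPhi i (b :: w) = if b = i.lo then 1 else if b = i.hi then 0 else wordPhi i w := by
  have hne := i.lo_ne_hi
  simp only [wordPhi, tensorPhi, letterMaps, hi, if_true, coroot_single, lt_self_iff_false, if_false]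
  by_cases h1 : b = i.lo
  · simp [h1]
  · by_cases h2 : b = i.hi <;> simp [h1, h2, hne.symm]

theorem wordE_of_lt {i : Index m n} (hi : i.val + 1 < m) (w : Word m n) :
    wordE i w = changeClose i.lo i.hi w := by
  have hne := i.lo_ne_hi
  induction w with
  | nil => rfl
  | cons b w ih =>
    have : ¬ m < i.val + 1 := by omega
    simp only [wordE, changeClose, ih, TensorELeft, hi, hi.ne, this, false_and, or_false, true_and,
      (wordEps_wordPhi_of_lt hi w).1, letterMaps]
    split_ifs <;> simp_all

theorem wordF_of_lt {i : Index m n} (hi : i.val + 1 < m) (w : Word m n) :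
    wordF i w = changeOpen i.lo i.hi w := by
  have hne := i.lo_ne_hi
  induction w with
  | nil => rfl
  | cons b w ih =>
    have : ¬ m < i.val + 1 := by omega
    simp only [wordF, changeOpen, ih, TensorFLeft, hi, hi.ne, this, false_and, or_false, true_and,
      (wordEps_wordPhi_of_lt hi w).1, letterMaps]
    split_ifs <;> simp_all

theorem wordE_of_gt {i : Index m n} (hi : m < i.val + 1) (w : Word m n) :
    wordE i w = changeOpen i.hi i.lo w := by
  have hne := i.lo_ne_hi
  induction w with
  | nil => rfl
  | cons b w ih =>
    have : ¬ i.val + 1 < m := by omega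
    simp only [wordE, changeOpen, ih, TensorELeft, hi, hi.ne', this, false_and, false_or, true_and,
      (wordEps_wordPhi_of_gt hi w).2, letterMaps]
    split_ifs <;> simp_all

theorem wordF_of_gt {i : Index m n} (hi : m < i.val + 1) (w : Word m n) :
    wordF i w = changeClose i.hi i.lo w := by
  have hne := i.lo_ne_hi
  induction w with
  | nil => rfl
  | cons b w ih =>
    have : ¬ i.val + 1 < m := by omega
    simp only [wordF, changeClose, ih, TensorFLeft, hi, hi.ne', this, false_and, false_or, true_and,
      (wordEps_wordPhi_of_gt hi w).2, letterMaps]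
    split_ifs <;> simp_all

theorem wordE_cons_of_eq {i : Index m n} (hi : i.val + 1 = m) (b : Letter m n) (w : Word m n) :
    wordE i (b :: w) = if b = i.lo then none else if b = i.hi then some (i.lo :: w) else
      (wordE i w).map (b :: ·) := by
  have hne := i.lo_ne_hi
  simp only [wordE, TensorELeft, hi, letterMaps, lt_self_iff_false, false_and, false_or, or_false,
    true_and, coroot_single, if_true]
  by_cases h1 : b = i.lo
  · simp [h1, hne]
  · by_cases h2 : b = i.hi <;> simp [h1, h2, hne.symm]

theorem wordF_cons_of_eq {i : Index m n} (hi : i.val + 1 = m) (b : Letter m n) (w : Word m n) :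
    wordF i (b :: w) = if b = i.lo then some (i.hi :: w) else if b = i.hi then none else
      (wordF i w).map (b :: ·) := by
  have hne := i.lo_ne_hi
  simp only [wordF, TensorFLeft, hi, letterMaps, lt_self_iff_false, false_and, false_or, or_false,
    true_and, coroot_single, if_true]
  by_cases h1 : b = i.lo
  · simp [h1]
  · by_cases h2 : b = i.hi <;> simp [h1, h2, hne.symm]

/-- The operators `e_i` and `f_i` act on the letter between the factors `p` and `s` of a word. -/
def Good (i : Index m n) (p s : Word m n) : Prop :=
  (i.val + 1 < m → opn i.lo i.hi p = 0 ∧ clos i.lo i.hi s = 0) ∧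
  (i.val + 1 = m → i.lo ∉ p ∧ i.hi ∉ p) ∧
  (m < i.val + 1 → opn i.hi i.lo p = 0 ∧ clos i.hi i.lo s = 0)

/-- One condition `Good` on the two sides serves all three kinds of indices and both operators,
which makes axiom (d) for words immediate. -/
theorem wordE_eq_some {i : Index m n} {w w' : Word m n} : wordE i w = some w' ↔
    ∃ p s, w = p ++ i.hi :: s ∧ w' = p ++ i.lo :: s ∧ Good i p s := by
  have hne := i.lo_ne_hi
  rcases lt_trichotomy (i.val + 1) m with hi | hi | hi
  · simp only [wordE_of_lt hi, changeClose_eq_some hne, Good, hi, hi.ne, hi.not_gt, true_imp_iff,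
      false_imp_iff, and_true]
  · simp only [Good, hi, true_imp_iff, lt_self_iff_false, false_imp_iff, and_true, true_and]
    induction w generalizing w' with
    | nil => simp [wordE]
    | cons b w ih =>
      rw [wordE_cons_of_eq hi]
      constructor
      · intro h
        split_ifs at h with h1 h2
        · simp only [Option.some.injEq] at h
          exact ⟨[], w, by simp [h2], by simp [h], by simp⟩
        · rw [Option.map_eq_some_iff] at h
          obtain ⟨v, hv, rfl⟩ := h
          obtain ⟨p, s, rfl, rfl, h3, h4⟩ := ih.1 hv
          exact ⟨b :: p, s, rfl, rfl, by simp [h3, Ne.symm h1], by simp [h4, Ne.symm h2]⟩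
      · rintro ⟨p, s, h1, rfl, h3, h4⟩
        cases p with
        | nil =>
          simp only [List.nil_append, List.cons.injEq] at h1
          simp [h1, hne.symm]
        | cons a p =>
          simp only [List.cons_append, List.cons.injEq] at h1
          obtain ⟨rfl, rfl⟩ := h1
          simp only [List.mem_cons, not_or] at h3 h4
          simp only [Ne.symm h3.1, Ne.symm h4.1, if_false, Option.map_eq_some_iff]
          exact ⟨p ++ i.lo :: s, ih.2 ⟨p, s, rfl, rfl, h3.2, h4.2⟩, rfl⟩
  · simp only [wordE_of_gt hi, changeOpen_eq_some hne.symm, Good, hi, hi.ne', hi.not_gt,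
      true_imp_iff, false_imp_iff, true_and]

theorem wordF_eq_some {i : Index m n} {w w' : Word m n} : wordF i w = some w' ↔
    ∃ p s, w = p ++ i.lo :: s ∧ w' = p ++ i.hi :: s ∧ Good i p s := by
  have hne := i.lo_ne_hi
  rcases lt_trichotomy (i.val + 1) m with hi | hi | hi
  · simp only [wordF_of_lt hi, changeOpen_eq_some hne, Good, hi, hi.ne, hi.not_gt, true_imp_iff,
      false_imp_iff, and_true]
  · simp only [Good, hi, true_imp_iff, lt_self_iff_false, false_imp_iff, and_true, true_and]
    induction w generalizing w' with
    | nil => simp [wordF]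
    | cons b w ih =>
      rw [wordF_cons_of_eq hi]
      constructor
      · intro h
        split_ifs at h with h1 h2
        · simp only [Option.some.injEq] at h
          exact ⟨[], w, by simp [h1], by simp [h], by simp⟩
        · rw [Option.map_eq_some_iff] at h
          obtain ⟨v, hv, rfl⟩ := h
          obtain ⟨p, s, rfl, rfl, h3, h4⟩ := ih.1 hv
          exact ⟨b :: p, s, rfl, rfl, by simp [h3, Ne.symm h1], by simp [h4, Ne.symm h2]⟩
      · rintro ⟨p, s, h1, rfl, h3, h4⟩
        cases p with
        | nil =>
          simp only [List.nil_append, List.cons.injEq] at h1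
          simp [h1]
        | cons a p =>
          simp only [List.cons_append, List.cons.injEq] at h1
          obtain ⟨rfl, rfl⟩ := h1
          simp only [List.mem_cons, not_or] at h3 h4
          simp only [Ne.symm h3.1, Ne.symm h4.1, if_false, Option.map_eq_some_iff]
          exact ⟨p ++ i.hi :: s, ih.2 ⟨p, s, rfl, rfl, h3.2, h4.2⟩, rfl⟩
  · simp only [wordF_of_gt hi, changeClose_eq_some hne.symm, Good, hi, hi.ne', hi.not_gt,
      true_imp_iff, false_imp_iff, true_and]

theorem wordE_eq_none {i : Index m n} {w : Word m n} : wordE i w = none ↔ wordEps i w = 0 := by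
  have hne := i.lo_ne_hi
  rcases lt_trichotomy (i.val + 1) m with hi | hi | hi
  · rw [wordE_of_lt hi, changeClose_eq_none hne, (wordEps_wordPhi_of_lt hi w).1]
  · induction w with
    | nil => simp [wordE, wordEps]
    | cons b w ih =>
      rw [wordE_cons_of_eq hi, wordEps_cons_of_eq hi]
      split_ifs <;> simp [ih]
  · rw [wordE_of_gt hi, changeOpen_eq_none, (wordEps_wordPhi_of_gt hi w).1]

theorem wordF_eq_none {i : Index m n} {w : Word m n} : wordF i w = none ↔ wordPhi i w = 0 := by
  have hne := i.lo_ne_hi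
  rcases lt_trichotomy (i.val + 1) m with hi | hi | hi
  · rw [wordF_of_lt hi, changeOpen_eq_none, (wordEps_wordPhi_of_lt hi w).2]
  · induction w with
    | nil => simp [wordF, wordPhi]
    | cons b w ih =>
      rw [wordF_cons_of_eq hi, wordPhi_cons_of_eq hi]
      split_ifs <;> simp [ih]
  · rw [wordF_of_gt hi, changeClose_eq_none hne.symm, (wordEps_wordPhi_of_gt hi w).2]

/-- The effect of replacing `lo` by `hi` at the position where the operators act. -/
theorem Good.spec {i : Index m n} {p s : Word m n} (h : Good i p s) :
    wordEps i (p ++ i.hi :: s) = wordEps i (p ++ i.lo :: s) + 1 ∧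
    wordPhi i (p ++ i.lo :: s) = wordPhi i (p ++ i.hi :: s) + 1 ∧
    wordWt (p ++ i.lo :: s) = wordWt (p ++ i.hi :: s) + simpleRoot i := by
  have hne := i.lo_ne_hi
  rw [← and_assoc]
  constructor
  · rcases lt_trichotomy (i.val + 1) m with hi | hi | hi
    · obtain ⟨h1, h2⟩ := h.1 hi
      simp only [wordEps_wordPhi_of_lt hi, clos_append hne, opn_append hne, clos, opn, h1, h2, hne,
        hne.symm, if_true, if_false, true_and, false_and]
    · obtain ⟨h1, h2⟩ := h.2.1 hi
      induction p with
      | nil => simp [wordEps_cons_of_eq hi, wordPhi_cons_of_eq hi, hne.symm]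
      | cons b p ih =>
        simp only [List.mem_cons, not_or] at h1 h2
        simp only [List.cons_append, wordEps_cons_of_eq hi, wordPhi_cons_of_eq hi, Ne.symm h1.1,
          Ne.symm h2.1, if_false]
        exact ih ⟨fun h => absurd h hi.not_lt, fun _ => ⟨h1.2, h2.2⟩, fun h => absurd h hi.not_gt⟩
          h1.2 h2.2
    · obtain ⟨h1, h2⟩ := h.2.2 hi
      simp only [wordEps_wordPhi_of_gt hi, clos_append hne.symm, opn_append hne.symm, clos, opn, h1,
        h2, hne, hne.symm, if_true, if_false, true_and, false_and]
  · funext b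
    simp only [Pi.add_apply, wordWt_apply, simpleRoot, Pi.sub_apply, Pi.single_apply,
      List.count_append, List.count_cons, beq_iff_eq, eq_comm (a := b)]
    split_ifs <;> push_cast <;> ring

theorem wordPhi_sub_wordEps {i : Index m n} (hi : i.val + 1 ≠ m) (w : Word m n) :
    (wordPhi i w : ℤ) - wordEps i w = coroot i (wordWt w) := by
  have hne := i.lo_ne_hi
  rw [coroot_wordWt]
  simp only [hi, if_false]
  rcases lt_or_gt_of_ne hi with hi | hi
  · have := opn_sub_clos hne w
    rw [(wordEps_wordPhi_of_lt hi w).1, (wordEps_wordPhi_of_lt hi w).2]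
    omega
  · have := opn_sub_clos hne.symm w
    rw [(wordEps_wordPhi_of_gt hi w).1, (wordEps_wordPhi_of_gt hi w).2]
    omega

theorem coroot_wordWt_nonneg {i : Index m n} (hi : i.val + 1 = m) (w : Word m n) :
    0 ≤ coroot i (wordWt w) := by
  rw [coroot_wordWt, if_pos hi]
  omega

theorem wordPhi_add_wordEps {i : Index m n} (hi : i.val + 1 = m) (w : Word m n) :
    wordPhi i w + wordEps i w = if coroot i (wordWt w) = 0 then 0 else 1 := by
  have hne := i.lo_ne_hi
  induction w with
  | nil => simp [wordPhi, wordEps, coroot_wordWt]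
  | cons b w ih =>
    rw [wordEps_cons_of_eq hi, wordPhi_cons_of_eq hi]
    simp only [coroot_wordWt, hi, if_true, List.count_cons, beq_iff_eq] at ih ⊢
    by_cases h1 : b = i.lo
    · subst h1
      simp only [hne, if_true, if_false]
      rw [if_neg (by omega)]
    · by_cases h2 : b = i.hi
      · subst h2
        simp only [hne.symm, if_true, if_false]
        rw [if_neg (by omega)]
      · simpa [h1, h2] using ih

theorem wordF_eq_some_iff_wordE {i : Index m n} {w w' : Word m n} :
    wordF i w = some w' ↔ wordE i w' = some w := by
  rw [wordE_eq_some, wordF_eq_some]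
  exact ⟨fun ⟨p, s, h1, h2, h3⟩ => ⟨p, s, h2, h1, h3⟩, fun ⟨p, s, h1, h2, h3⟩ => ⟨p, s, h2, h1, h3⟩⟩

theorem wordE_spec {i : Index m n} {w w' : Word m n} (h : wordE i w = some w') :
    (wordEps i w' : ℤ) = wordEps i w - 1 ∧ wordPhi i w' = wordPhi i w + 1 ∧
      wordWt w' = wordWt w + simpleRoot i := by
  obtain ⟨p, s, rfl, rfl, hg⟩ := wordE_eq_some.1 h
  obtain ⟨h1, h2, h3⟩ := hg.spec
  exact ⟨by omega, h2, h3⟩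

theorem wordF_spec {i : Index m n} {w w' : Word m n} (h : wordF i w = some w') :
    wordEps i w' = wordEps i w + 1 ∧ (wordPhi i w' : ℤ) = wordPhi i w - 1 ∧
      wordWt w' = wordWt w - simpleRoot i := by
  obtain ⟨p, s, rfl, rfl, hg⟩ := wordF_eq_some.1 h
  obtain ⟨h1, h2, h3⟩ := hg.spec
  exact ⟨h1, by omega, by rw [h3, add_sub_cancel_right]⟩

/-- A set of words that is stable under the operators is a crystal. -/
theorem isCrystalOn_wordMaps {S : Set (Word m n)}
    (he : ∀ i, ∀ w ∈ S, ∀ w', wordE i w = some w' → w' ∈ S)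
    (hf : ∀ i, ∀ w ∈ S, ∀ w', wordF i w = some w' → w' ∈ S) : IsCrystalOn (wordMaps m n) S where
  e_mem := he
  f_mem := hf
  phi_sub_eps _ hi w _ := wordPhi_sub_wordEps hi w
  coroot_zero_nonneg _ hi w _ := coroot_wordWt_nonneg hi w
  phi_add_eps _ hi w _ := wordPhi_add_wordEps hi w
  of_e _ _ _ _ h := wordE_spec h
  of_f _ _ _ _ h := wordF_spec h
  f_iff_e _ _ _ _ _ := wordF_eq_some_iff_wordE

end Signature

/-! ### Plactic equivalence and the operators -/

section Plactic

variable {m n : ℕ}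

/-- The words have the same `ε_i` and `φ_i`, and the operators preserve plactic equivalence. -/
structure SameCrystal (i : Index m n) (w w' : Word m n) : Prop where
  eps : wordEps i w = wordEps i w'
  phi : wordPhi i w = wordPhi i w'
  e : Option.Rel (Knuth ColLt) (wordE i w) (wordE i w')
  f : Option.Rel (Knuth ColLt) (wordF i w) (wordF i w')

theorem knuth_lower {x y z : Letter m n} (h : ColLt x y) (h' : ¬ ColLt z y) :
    Knuth ColLt [x, z, y] [z, x, y] := .rel _ _ (.lower [] [] x y z h h')

theorem knuth_upper {x y z : Letter m n} (h : ColLt y z) (h' : ¬ ColLt y x) :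
    Knuth ColLt [y, z, x] [y, x, z] := .rel _ _ (.upper [] [] x y z h h')

theorem Index.eq_lo_or (i : Index m n) (x : Letter m n) :
    (x = i.lo ∧ x.val = i.val) ∨ (x = i.hi ∧ x.val = i.val + 1) ∨
      (x ≠ i.lo ∧ x ≠ i.hi ∧ x.val ≠ i.val ∧ x.val ≠ i.val + 1) := by
  simp only [Index.lo, Index.hi, Fin.ext_iff, ne_eq]
  omega

theorem wordE_nil (i : Index m n) : wordE i [] = none := rfl

theorem wordF_nil (i : Index m n) : wordF i [] = none := rfl

-- A finite check: only whether each of the three letters is `lo`, `hi` or neither matters, besides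
-- the kind of the index. When both images exist, they are equal or again related by `lower` or
-- `upper`.
set_option maxHeartbeats 4000000 in
theorem sameCrystal_lower (i : Index m n) {x y z : Letter m n} (h : ColLt x y) (h' : ¬ ColLt z y) :
    SameCrystal i [x, z, y] [z, x, y] := by
  have hne := i.lo_ne_hi
  have hne' := hne.symm
  have hl : i.lo.val = i.val := rfl
  have hh : i.hi.val = i.val + 1 := rfl
  have hcl := h
  have hcl' := h'
  unfold ColLt at hcl hcl'
  rcases lt_trichotomy (i.val + 1) m with hi | hi | hi <;>
  rcases i.eq_lo_or x with hx | hx | hx <;> rcases i.eq_lo_or y with hy | hy | hy <;>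
  rcases i.eq_lo_or z with hz | hz | hz <;>
  first
  | (exfalso; omega)
  | (refine ⟨?_, ?_, ?_, ?_⟩ <;>
      first
      | simp [wordEps_wordPhi_of_lt hi, clos, opn, hx, hy, hz, hne, hne']; done
      | simp [wordEps_wordPhi_of_gt hi, clos, opn, hx, hy, hz, hne, hne']; done
      | simp [wordEps_cons_of_eq hi, wordPhi_cons_of_eq hi, hx, hy, hz, hne']; done
      | (first
          | simp only [wordE_of_lt hi, wordF_of_lt hi]
          | simp only [wordE_of_gt hi, wordF_of_gt hi]
          | simp only [wordE_cons_of_eq hi, wordF_cons_of_eq hi, wordE_nil, wordF_nil]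
         simp [clos, changeOpen, changeClose, hx, hy, hz, hne, hne']
         try first
          | exact knuth_lower (by unfold ColLt; omega) (by unfold ColLt; omega)
          | exact knuth_upper (by unfold ColLt; omega) (by unfold ColLt; omega)))

set_option maxHeartbeats 4000000 in
theorem sameCrystal_upper (i : Index m n) {x y z : Letter m n} (h : ColLt y z) (h' : ¬ ColLt y x) :
    SameCrystal i [y, z, x] [y, x, z] := by
  have hne := i.lo_ne_hi
  have hne' := hne.symm
  have hl : i.lo.val = i.val := rfl
  have hh : i.hi.val = i.val + 1 := rfl
  have hcl := h
  have hcl' := h'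
  unfold ColLt at hcl hcl'
  rcases lt_trichotomy (i.val + 1) m with hi | hi | hi <;>
  rcases i.eq_lo_or x with hx | hx | hx <;> rcases i.eq_lo_or y with hy | hy | hy <;>
  rcases i.eq_lo_or z with hz | hz | hz <;>
  first
  | (exfalso; omega)
  | (refine ⟨?_, ?_, ?_, ?_⟩ <;>
      first
      | simp [wordEps_wordPhi_of_lt hi, clos, opn, hx, hy, hz, hne, hne']; done
      | simp [wordEps_wordPhi_of_gt hi, clos, opn, hx, hy, hz, hne, hne']; done
      | simp [wordEps_cons_of_eq hi, wordPhi_cons_of_eq hi, hx, hy, hz, hne']; done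
      | (first
          | simp only [wordE_of_lt hi, wordF_of_lt hi]
          | simp only [wordE_of_gt hi, wordF_of_gt hi]
          | simp only [wordE_cons_of_eq hi, wordF_cons_of_eq hi, wordE_nil, wordF_nil]
         simp [clos, changeOpen, changeClose, hx, hy, hz, hne, hne']
         try first
          | exact knuth_lower (by unfold ColLt; omega) (by unfold ColLt; omega)
          | exact knuth_upper (by unfold ColLt; omega) (by unfold ColLt; omega)))

end Plactic

/-! ### Plactic relations inside longer words -/

section Context

variable {m n : ℕ}

theorem wordEps_append_of_eq {i : Index m n} (hi : i.val + 1 = m) (u v : Word m n) :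
    wordEps i (u ++ v) = if wordEps i u + wordPhi i u = 0 then wordEps i v else wordEps i u := by
  induction u with
  | nil => simp [wordEps, wordPhi]
  | cons b u ih =>
    rw [List.cons_append, wordEps_cons_of_eq hi, wordEps_cons_of_eq hi, wordPhi_cons_of_eq hi]
    split_ifs <;> simp_all

theorem wordPhi_append_of_eq {i : Index m n} (hi : i.val + 1 = m) (u v : Word m n) :
    wordPhi i (u ++ v) = if wordEps i u + wordPhi i u = 0 then wordPhi i v else wordPhi i u := by
  induction u with
  | nil => simp [wordEps, wordPhi]
  | cons b u ih =>
    rw [List.cons_append, wordPhi_cons_of_eq hi, wordEps_cons_of_eq hi, wordPhi_cons_of_eq hi]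
    split_ifs <;> simp_all

theorem wordEps_wordPhi_append_congr {i : Index m n} {t t' : Word m n}
    (h : wordEps i t = wordEps i t') (h' : wordPhi i t = wordPhi i t') (u v : Word m n) :
    wordEps i (u ++ t ++ v) = wordEps i (u ++ t' ++ v) ∧
      wordPhi i (u ++ t ++ v) = wordPhi i (u ++ t' ++ v) := by
  have hne := i.lo_ne_hi
  rcases lt_trichotomy (i.val + 1) m with hi | hi | hi
  · simp only [wordEps_wordPhi_of_lt hi, clos_append hne, opn_append hne] at h h' ⊢
    rw [h, h']; exact ⟨rfl, rfl⟩
  · simp only [wordEps_append_of_eq hi, wordPhi_append_of_eq hi, h, h', and_self]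
  · simp only [wordEps_wordPhi_of_gt hi, clos_append hne.symm, opn_append hne.symm] at h h' ⊢
    rw [h, h']; exact ⟨rfl, rfl⟩

theorem wordEps_add_wordPhi_eq_zero {i : Index m n} (hi : i.val + 1 = m) {w : Word m n} :
    (i.lo ∉ w ∧ i.hi ∉ w) ↔ wordEps i w = 0 ∧ wordPhi i w = 0 := by
  induction w with
  | nil => simp [wordEps, wordPhi]
  | cons b w ih =>
    rw [wordEps_cons_of_eq hi, wordPhi_cons_of_eq hi]
    have hne := i.lo_ne_hi
    by_cases h1 : b = i.lo
    · simp [h1]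
    · by_cases h2 : b = i.hi
      · simp [h2, hne.symm]
      · simpa [h1, h2, Ne.symm h1, Ne.symm h2] using ih

/-- `Good` sees the two sides only through `ε_i` and `φ_i`, so a factor of either side may be
replaced by one with the same values. -/
theorem good_iff {i : Index m n} {p s : Word m n} : Good i p s ↔
    (i.val + 1 < m → wordPhi i p = 0 ∧ wordEps i s = 0) ∧
    (i.val + 1 = m → wordEps i p = 0 ∧ wordPhi i p = 0) ∧
    (m < i.val + 1 → wordEps i p = 0 ∧ wordPhi i s = 0) := by
  unfold Good
  refine and_congr ?_ (and_congr ?_ ?_) <;> refine forall_congr' fun hi => ?_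
  · rw [(wordEps_wordPhi_of_lt hi _).1, (wordEps_wordPhi_of_lt hi _).2]
  · exact wordEps_add_wordPhi_eq_zero hi
  · rw [(wordEps_wordPhi_of_gt hi _).1, (wordEps_wordPhi_of_gt hi _).2]

theorem Good.congr {i : Index m n} {p s p' s' : Word m n} (h : Good i p s)
    (h1 : wordEps i p = wordEps i p') (h2 : wordPhi i p = wordPhi i p')
    (h3 : wordEps i s = wordEps i s') (h4 : wordPhi i s = wordPhi i s') : Good i p' s' := by
  rw [good_iff] at h ⊢
  rwa [← h1, ← h2, ← h3, ← h4]

theorem Good.of_append {i : Index m n} {p s u v : Word m n} (h : Good i (u ++ p) (s ++ v)) :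
    Good i p s := by
  have hne := i.lo_ne_hi
  refine ⟨fun hi => ?_, fun hi => ?_, fun hi => ?_⟩
  · have := h.1 hi
    rw [opn_append hne, clos_append hne] at this
    omega
  · have := h.2.1 hi
    simp only [List.mem_append, not_or] at this
    exact ⟨this.1.2, this.2.2⟩
  · have := h.2.2 hi
    rw [opn_append hne.symm, clos_append hne.symm] at this
    omega

/-- What `u` and `v` require of the middle factor concerns only the unmatched brackets of that
factor, hence only its `ε_i` and `φ_i`. -/
theorem Good.replace {i : Index m n} {p s p' s' u v : Word m n}
    (h : Good i (u ++ p) (s ++ v)) (h' : Good i p' s')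
    (h1 : wordEps i (p ++ i.lo :: s) = wordEps i (p' ++ i.lo :: s'))
    (h2 : wordPhi i (p ++ i.lo :: s) = wordPhi i (p' ++ i.lo :: s')) :
    Good i (u ++ p') (s' ++ v) := by
  have hne := i.lo_ne_hi
  have h0 := h.of_append
  refine ⟨fun hi => ?_, fun hi => ?_, fun hi => ?_⟩
  · obtain ⟨a1, a2⟩ := h.1 hi
    obtain ⟨b1, b2⟩ := h'.1 hi
    obtain ⟨c1, c2⟩ := h0.1 hi
    simp only [wordEps_wordPhi_of_lt hi, clos_append hne, opn_append hne, clos, opn, b1, b2, c1, c2,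
      hne, if_false, if_true, and_self] at h1 h2 a1 a2 ⊢
    omega
  · obtain ⟨a1, a2⟩ := h.2.1 hi
    obtain ⟨b1, b2⟩ := h'.2.1 hi
    simp only [List.mem_append, not_or] at a1 a2 ⊢
    exact ⟨⟨a1.1, b1⟩, ⟨a2.1, b2⟩⟩
  · obtain ⟨a1, a2⟩ := h.2.2 hi
    obtain ⟨b1, b2⟩ := h'.2.2 hi
    obtain ⟨c1, c2⟩ := h0.2.2 hi
    simp only [wordEps_wordPhi_of_gt hi, clos_append hne.symm, opn_append hne.symm, clos, opn, b1,
      b2, c1, c2, hne, if_false, if_true, false_and] at h1 h2 a1 a2 ⊢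
    omega

theorem eq_append_cons_cases {α : Type*} {u t v p s : List α} {x : α}
    (h : u ++ t ++ v = p ++ x :: s) :
    (∃ u', u = p ++ x :: u' ∧ s = u' ++ t ++ v) ∨
    (∃ p' s', t = p' ++ x :: s' ∧ p = u ++ p' ∧ s = s' ++ v) ∨
    (∃ v', v = v' ++ x :: s ∧ p = u ++ t ++ v') := by
  have key : ∀ {a b p s : List α}, a ++ b = p ++ x :: s →
      (∃ a', a = p ++ x :: a' ∧ s = a' ++ b) ∨ (∃ b', b = b' ++ x :: s ∧ p = a ++ b') := by
    intro a b p s h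
    rcases List.append_eq_append_iff.1 h with ⟨c, rfl, h2⟩ | ⟨c, rfl, h2⟩
    · exact .inr ⟨c, h2, rfl⟩
    · cases c with
      | nil => exact .inr ⟨[], by simpa using h2.symm, by simp⟩
      | cons y c =>
        simp only [List.cons_append, List.cons.injEq] at h2
        obtain ⟨rfl, rfl⟩ := h2
        exact .inl ⟨c, rfl, rfl⟩
  rcases key h with ⟨a', h1, h2⟩ | ⟨b', h1, h2⟩
  · rcases key h1 with ⟨a'', h3, h4⟩ | ⟨b'', h3, h4⟩
    · exact .inl ⟨a'', h3, by rw [h2, h4]⟩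
    · exact .inr (.inl ⟨b'', a', h3, h4, h2⟩)
  · exact .inr (.inr ⟨b', h1, h2⟩)

theorem optionRel_of {α : Type*} {r : α → α → Prop} {a b : Option α} (h : a = none ↔ b = none)
    (h' : ∀ x, a = some x → ∃ y, b = some y ∧ r x y) : Option.Rel r a b := by
  cases a with
  | none => rw [h.1 rfl]; exact .none
  | some x =>
    obtain ⟨y, rfl, hy⟩ := h' x rfl
    exact .some hy

theorem Option.Rel.exists_some {α : Type*} {r : α → α → Prop} {a b : Option α} {x : α}
    (h : Option.Rel r a b) (hx : a = some x) : ∃ y, b = some y ∧ r x y := by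
  cases h with
  | some h => cases hx; exact ⟨_, rfl, h⟩
  | none => cases hx

theorem SameCrystal.symm {i : Index m n} {w w' : Word m n} (h : SameCrystal i w w') :
    SameCrystal i w' w := by
  have key : ∀ {a b : Option (Word m n)}, Option.Rel (Knuth ColLt) a b →
      Option.Rel (Knuth ColLt) b a := by
    rintro a b (h | _)
    · exact .some (.symm _ _ h)
    · exact .none
  exact ⟨h.eps.symm, h.phi.symm, key h.e, key h.f⟩

theorem SameCrystal.trans {i : Index m n} {w w' w'' : Word m n} (h : SameCrystal i w w')
    (h' : SameCrystal i w' w'') : SameCrystal i w w'' := by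
  have key : ∀ {a b c : Option (Word m n)}, Option.Rel (Knuth ColLt) a b →
      Option.Rel (Knuth ColLt) b c → Option.Rel (Knuth ColLt) a c := by
    rintro a b c (h | _) h'
    · rcases h' with h' | _
      exact .some (.trans _ _ _ h h')
    · rcases h' with _ | _
      exact .none
  exact ⟨h.eps.trans h'.eps, h.phi.trans h'.phi, key h.e h'.e, key h.f h'.f⟩

theorem SameCrystal.refl (i : Index m n) (w : Word m n) : SameCrystal i w w := by
  have key : ∀ a : Option (Word m n), Option.Rel (Knuth ColLt) a a := by
    rintro (_ | a)
    · exact .none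
    · exact .some (.refl _)
  exact ⟨rfl, rfl, key _, key _⟩

/-- If the changed letter lies in `u` or `v`, the factor `t` is merely replaced by the equivalent
`t'`. If it lies in `t`, the operator acts on `t'` as well, and the equivalence of the images of `t`
and `t'` is used. -/
theorem SameCrystal.append {i : Index m n} {t t' : Word m n} (h : SameCrystal i t t')
    (hk : Knuth ColLt t t') (u v : Word m n) : SameCrystal i (u ++ t ++ v) (u ++ t' ++ v) := by
  have hc := wordEps_wordPhi_append_congr h.eps h.phi
  refine ⟨(hc u v).1, (hc u v).2, optionRel_of ?_ fun w hw => ?_, optionRel_of ?_ fun w hw => ?_⟩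
  · rw [wordE_eq_none, wordE_eq_none, (hc u v).1]
  · obtain ⟨p, s, h1, rfl, hg⟩ := wordE_eq_some.1 hw
    rcases eq_append_cons_cases h1 with ⟨u', rfl, rfl⟩ | ⟨p', s', rfl, rfl, rfl⟩ | ⟨v', rfl, rfl⟩
    · refine ⟨(p ++ i.lo :: u') ++ t' ++ v, wordE_eq_some.2 ⟨p, u' ++ t' ++ v, by simp, by simp,
        hg.congr rfl rfl (hc u' v).1 (hc u' v).2⟩, ?_⟩
      simpa using hk.append (p ++ i.lo :: u') v
    · have hg' := hg.of_append
      obtain ⟨y, hy, hky⟩ := Option.Rel.exists_some h.e (wordE_eq_some.2 ⟨p', s', rfl, rfl, hg'⟩)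
      obtain ⟨p'', s'', rfl, rfl, hg''⟩ := wordE_eq_some.1 hy
      -- `Good.replace` compares the factors with `lo` in place, which is after the action of `e_i`;
      -- `Good.spec` carries the equalities over from before the action.
      have e1 := hg'.spec
      have e2 := hg''.spec
      have e3 := h.eps
      have e4 := h.phi
      refine ⟨u ++ (p'' ++ i.lo :: s'') ++ v, wordE_eq_some.2 ⟨u ++ p'', s'' ++ v, by simp, by simp,
        hg.replace hg'' (by omega) (by omega)⟩, ?_⟩
      simpa using hky.append u v
    · refine ⟨u ++ t' ++ (v' ++ i.lo :: s), wordE_eq_some.2 ⟨u ++ t' ++ v', s, by simp, by simp,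
        hg.congr (hc u v').1 (hc u v').2 rfl rfl⟩, ?_⟩
      simpa using hk.append u (v' ++ i.lo :: s)
  · rw [wordF_eq_none, wordF_eq_none, (hc u v).2]
  · obtain ⟨p, s, h1, rfl, hg⟩ := wordF_eq_some.1 hw
    rcases eq_append_cons_cases h1 with ⟨u', rfl, rfl⟩ | ⟨p', s', rfl, rfl, rfl⟩ | ⟨v', rfl, rfl⟩
    · refine ⟨(p ++ i.hi :: u') ++ t' ++ v, wordF_eq_some.2 ⟨p, u' ++ t' ++ v, by simp, by simp,
        hg.congr rfl rfl (hc u' v).1 (hc u' v).2⟩, ?_⟩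
      simpa using hk.append (p ++ i.hi :: u') v
    · have hg' := hg.of_append
      obtain ⟨y, hy, hky⟩ := Option.Rel.exists_some h.f (wordF_eq_some.2 ⟨p', s', rfl, rfl, hg'⟩)
      obtain ⟨p'', s'', rfl, rfl, hg''⟩ := wordF_eq_some.1 hy
      refine ⟨u ++ (p'' ++ i.hi :: s'') ++ v, wordF_eq_some.2 ⟨u ++ p'', s'' ++ v, by simp, by simp,
        hg.replace hg'' h.eps h.phi⟩, ?_⟩
      simpa using hky.append u v
    · refine ⟨u ++ t' ++ (v' ++ i.hi :: s), wordF_eq_some.2 ⟨u ++ t' ++ v', s, by simp, by simp,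
        hg.congr (hc u v').1 (hc u v').2 rfl rfl⟩, ?_⟩
      simpa using hk.append u (v' ++ i.hi :: s)

/-- Plactic equivalence is compatible with the crystal structure of words. -/
theorem Knuth.sameCrystal {w w' : Word m n} (h : Knuth ColLt w w') (i : Index m n) :
    SameCrystal i w w' := by
  induction h with
  | rel _ _ h =>
    cases h with
    | lower u v x y z h1 h2 =>
      simpa using (sameCrystal_lower i h1 h2).append (knuth_lower h1 h2) u v
    | upper u v x y z h1 h2 =>
      simpa using (sameCrystal_upper i h1 h2).append (knuth_upper h1 h2) u v
  | refl => exact .refl i _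
  | symm _ _ _ ih => exact ih.symm
  | trans _ _ _ _ _ ih1 ih2 => exact ih1.trans ih2

theorem Knuth.perm {w w' : Word m n} (h : Knuth ColLt w w') : w.Perm w' := by
  induction h with
  | rel _ _ h =>
    cases h with
    | lower u v x y z _ _ => exact List.Perm.append_left u (.swap _ _ _)
    | upper u v x y z _ _ => exact List.Perm.append_left u (.cons _ (.swap _ _ _))
  | refl => exact .refl _
  | symm _ _ _ ih => exact ih.symm
  | trans _ _ _ _ _ ih1 ih2 => exact ih1.trans ih2

theorem Knuth.wordWt_eq {w w' : Word m n} (h : Knuth ColLt w w') : wordWt w = wordWt w' := by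
  funext b
  rw [wordWt_apply, wordWt_apply, h.perm.count_eq]

end Context

/-! ### Stability of tableaux under the operators -/

section Stability

variable {m n : ℕ}

theorem count_le_count_of_opn_eq_zero {o c : Letter m n} (h : o ≠ c) {w : Word m n}
    (hw : opn o c w = 0) : w.count o ≤ w.count c := by
  have := opn_sub_clos h w
  omega

theorem count_le_count_of_clos_eq_zero {o c : Letter m n} (h : o ≠ c) {w : Word m n}
    (hw : clos o c w = 0) : w.count c ≤ w.count o := by
  have := opn_sub_clos h w
  omega

/-- The letters before the position where the operators act. -/
theorem Good.count_left {i : Index m n} {u p s : Word m n} (h : Good i (u ++ p) s) :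
    (i.val + 1 < m → p.count i.lo ≤ p.count i.hi) ∧
    (i.val + 1 = m → p.count i.lo = 0 ∧ p.count i.hi = 0) ∧
    (m < i.val + 1 → p.count i.hi ≤ p.count i.lo) := by
  have h' : Good i p s := Good.of_append (v := []) (by simpa using h)
  exact ⟨fun hi => count_le_count_of_opn_eq_zero i.lo_ne_hi (h'.1 hi).1,
    fun hi => ⟨List.count_eq_zero.2 (h'.2.1 hi).1, List.count_eq_zero.2 (h'.2.1 hi).2⟩,
    fun hi => count_le_count_of_opn_eq_zero i.lo_ne_hi.symm (h'.2.2 hi).1⟩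

/-- The letters after the position where the operators act. -/
theorem Good.count_right {i : Index m n} {p s v : Word m n} (h : Good i p (s ++ v)) :
    (i.val + 1 < m → s.count i.hi ≤ s.count i.lo) ∧
    (m < i.val + 1 → s.count i.lo ≤ s.count i.hi) := by
  have h' : Good i p s := Good.of_append (u := []) h
  exact ⟨fun hi => count_le_count_of_clos_eq_zero i.lo_ne_hi (h'.1 hi).2,
    fun hi => count_le_count_of_clos_eq_zero i.lo_ne_hi.symm (h'.2.2 hi).2⟩

/-- `ColLt lo y` and `ColLt hi y` differ only for `y = hi` at a barred index and for `y = lo` at a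
positive one. Such a `y` directly after the position would be an unmatched closing bracket. -/
theorem Good.colLt_hi {i : Index m n} {p s : Word m n} {y : Letter m n} (h : Good i p (y :: s))
    (hy : ColLt i.lo y) : ColLt i.hi y := by
  have h1 := Good.count_right (s := [y]) (v := s) h
  have hl : i.lo.val = i.val := rfl
  have hh : i.hi.val = i.val + 1 := rfl
  have hne := i.lo_ne_hi
  simp only [List.count_singleton, beq_iff_eq] at h1
  unfold ColLt at hy ⊢
  rcases i.eq_lo_or y with ⟨rfl, hv⟩ | ⟨rfl, hv⟩ | hv
  · simp only [hne, if_true, if_false] at h1; omega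
  · simp only [hne.symm, if_true, if_false] at h1; omega
  · omega

theorem Good.not_colLt_lo {i : Index m n} {p s : Word m n} {y : Letter m n}
    (h : Good i p (y :: s)) (hy : ¬ ColLt i.hi y) : ¬ ColLt i.lo y := by
  have h1 := Good.count_right (s := [y]) (v := s) h
  have hl : i.lo.val = i.val := rfl
  have hh : i.hi.val = i.val + 1 := rfl
  have hne := i.lo_ne_hi
  simp only [List.count_singleton, beq_iff_eq] at h1
  unfold ColLt at hy ⊢
  rcases i.eq_lo_or y with ⟨rfl, hv⟩ | ⟨rfl, hv⟩ | hv
  · simp only [hne, if_true, if_false] at h1; omega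
  · simp only [hne.symm, if_true, if_false] at h1; omega
  · omega

/-- The exceptional letters are now `lo` at a barred index and `hi` at a positive one, which would
be unmatched openings directly before the position. At the index `0` they are `lo` and `hi`, neither
of which occurs before it. -/
theorem Good.colLt_lo {i : Index m n} {p s : Word m n} {y : Letter m n}
    (h : Good i (p ++ [y]) s) (hy : ColLt y i.hi) : ColLt y i.lo := by
  have h1 := Good.count_left (u := p) (p := [y]) h
  have hl : i.lo.val = i.val := rfl
  have hh : i.hi.val = i.val + 1 := rfl
  have hne := i.lo_ne_hi
  simp only [List.count_singleton, beq_iff_eq] at h1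
  unfold ColLt at hy ⊢
  rcases i.eq_lo_or y with ⟨rfl, hv⟩ | ⟨rfl, hv⟩ | hv
  · simp only [hne, if_true, if_false] at h1; omega
  · simp only [hne.symm, if_true, if_false] at h1; omega
  · omega

theorem Good.not_colLt_hi {i : Index m n} {p s : Word m n} {y : Letter m n}
    (h : Good i (p ++ [y]) s) (hy : ¬ ColLt y i.lo) : ¬ ColLt y i.hi := by
  have h1 := Good.count_left (u := p) (p := [y]) h
  have hl : i.lo.val = i.val := rfl
  have hh : i.hi.val = i.val + 1 := rfl
  have hne := i.lo_ne_hi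
  simp only [List.count_singleton, beq_iff_eq] at h1
  unfold ColLt at hy ⊢
  rcases i.eq_lo_or y with ⟨rfl, hv⟩ | ⟨rfl, hv⟩ | hv
  · simp only [hne, if_true, if_false] at h1; omega
  · simp only [hne.symm, if_true, if_false] at h1; omega
  · omega

/-- The letters that may stand above `lo` or to its left may do so for `hi`, and dually. -/
theorem Index.colLt_mono (i : Index m n) (y : Letter m n) :
    (ColLt y i.lo → ColLt y i.hi) ∧ (ColLt i.hi y → ColLt i.lo y) := by
  have hl : i.lo.val = i.val := rfl
  have hh : i.hi.val = i.val + 1 := rfl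
  unfold ColLt
  omega

theorem pairwise_replace {α : Type*} {R : α → α → Prop} (ht : ∀ a b c, R a b → R b c → R a c)
    {a b : List α} {x y : α} (h : (a ++ x :: b).Pairwise R)
    (ha : ∀ e, a.getLast? = some e → R e y) (hb : ∀ e, b.head? = some e → R y e) :
    (a ++ y :: b).Pairwise R := by
  rw [List.pairwise_append, List.pairwise_cons] at h ⊢
  obtain ⟨h1, ⟨h2, h3⟩, h4⟩ := h
  have hb' : ∀ e ∈ b, R y e := by
    cases b with
    | nil => simp
    | cons e b =>
      intro f hf
      have he := hb e rfl
      rcases List.mem_cons.1 hf with rfl | hf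
      · exact he
      · exact ht _ _ _ he ((List.pairwise_cons.1 h3).1 f hf)
  have ha' : ∀ e ∈ a, R e y := by
    rcases List.eq_nil_or_concat a with rfl | ⟨a, e, rfl⟩
    · simp
    · intro f hf
      simp only [List.concat_eq_append] at *
      have he := ha e (by simp)
      rcases List.mem_append.1 hf with hf | hf
      · exact ht _ _ _ ((List.pairwise_append.1 h1).2.2 f hf e (by simp)) he
      · rw [List.mem_singleton.1 hf]; exact he
  refine ⟨h1, ⟨hb', h3⟩, fun e he f hf => ?_⟩
  rcases List.mem_cons.1 hf with rfl | hf
  · exact ha' e he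
  · exact h4 e he f (by simp [hf])

theorem Adj.split_left : ∀ {a c d : List (Letter m n)}, Adj (a ++ c) d →
    d.length ≤ a.length ∧ Adj a d ∨
      ∃ d1 d2, d = d1 ++ d2 ∧ d1.length = a.length ∧ Adj a d1 ∧ Adj c d2
  | [], c, d, h => .inr ⟨[], d, rfl, rfl, adj_nil _, h⟩
  | x :: a, c, [], h => .inl ⟨by simp, adj_nil _⟩
  | x :: a, c, y :: d, h => by
    rcases Adj.split_left h.2 with ⟨h1, h2⟩ | ⟨d1, d2, rfl, h1, h2, h3⟩
    · exact .inl ⟨by simpa using h1, ⟨h.1, h2⟩⟩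
    · exact .inr ⟨y :: d1, d2, rfl, by simp [h1], ⟨h.1, h2⟩, h3⟩

theorem Adj.split_right : ∀ {l a b : List (Letter m n)}, Adj l (a ++ b) →
    ∃ l1 l2, l = l1 ++ l2 ∧ l1.length = a.length ∧ Adj l1 a ∧ Adj l2 b
  | l, [], b, h => ⟨[], l, rfl, rfl, adj_nil _, h⟩
  | [], x :: a, b, h => h.elim
  | y :: l, x :: a, b, h => by
    obtain ⟨l1, l2, rfl, h1, h2, h3⟩ := Adj.split_right (l := l) h.2
    exact ⟨y :: l1, l2, rfl, by simp [h1], ⟨h.1, h2⟩, h3⟩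

theorem Adj.append : ∀ {a b c d : List (Letter m n)}, a.length = b.length → Adj a b → Adj c d →
    Adj (a ++ c) (b ++ d)
  | [], [], _, _, _, _, h => h
  | _ :: _, _ :: _, _, _, hl, h, h' => ⟨h.1, Adj.append (by simpa using hl) h.2 h'⟩

theorem Adj.exists_not_colLt_left : ∀ {c d : List (Letter m n)} {a}, Adj c d →
    c.length = d.length → a ∈ c → ∃ b ∈ d, ¬ ColLt b a
  | x :: c, y :: d, a, h, hl, ha => by
    rcases List.mem_cons.1 ha with rfl | ha
    · exact ⟨y, by simp, h.1⟩
    · obtain ⟨b, hb, h'⟩ := h.2.exists_not_colLt_left (by simpa using hl) ha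
      exact ⟨b, by simp [hb], h'⟩

theorem Adj.replace_left {a b d : List (Letter m n)} {x y : Letter m n} (h : Adj (a ++ x :: b) d)
    (hxy : ∀ d1 z d2, d = d1 ++ z :: d2 → d1.length = a.length → Adj a d1 → ¬ ColLt z x →
      Adj b d2 → ¬ ColLt z y) : Adj (a ++ y :: b) d := by
  rcases h.split_left with ⟨_, h⟩ | ⟨d1, d2, rfl, h1, h2, h3⟩
  · exact h.colIns_left_of_none _
  · refine Adj.append h1.symm h2 ?_
    cases d2 with
    | nil => simp
    | cons z d2 => exact ⟨hxy d1 z d2 rfl h1 h2 h3.1 h3.2, h3.2⟩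

theorem Adj.replace_right {a b l : List (Letter m n)} {x y : Letter m n} (h : Adj l (a ++ x :: b))
    (hxy : ∀ l1 z l2, l = l1 ++ z :: l2 → l1.length = a.length → Adj l1 a → ¬ ColLt x z →
      Adj l2 b → ¬ ColLt y z) : Adj l (a ++ y :: b) := by
  obtain ⟨l1, l2, rfl, h1, h2, h3⟩ := h.split_right
  refine Adj.append h1 h2 ?_
  cases l2 with
  | nil => exact h3
  | cons z l2 => exact ⟨hxy l1 z l2 rfl h1 h2 h3.1 h3.2, h3.2⟩

/-- When `lo` becomes `hi`, only the entry `z` to its right can spoil the row. The column `d` is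
read before the position, so the brackets between `z` and the position must be balanced by letters
whose existence contradicts the shape of the two columns. -/
theorem Good.adj_right {i : Index m n} {a b d : List (Letter m n)} {p s : Word m n}
    (hg : Good i (p ++ (d ++ a)) (b ++ s)) (hc : IsColumn (a ++ i.lo :: b)) (hd : IsColumn d)
    (h : Adj (a ++ i.lo :: b) d) : Adj (a ++ i.hi :: b) d := by
  have hl : i.lo.val = i.val := rfl
  have hh : i.hi.val = i.val + 1 := rfl
  refine h.replace_left ?_
  rintro d1 z d2 rfl hlen hadj1 hz hadj2 hz'
  have hcol := List.pairwise_append.1 hc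
  have hdol := List.pairwise_append.1 hd
  have hcb := List.pairwise_cons.1 hcol.2.1
  have hdz := List.pairwise_cons.1 hdol.2.1
  rcases lt_trichotomy (i.val + 1) m with hi | hi | hi
  -- The opening `z = lo` has to be followed by some `hi` before the position. It cannot lie above
  -- `lo` in the column, so it lies in `d2`, and its left neighbour in `b` would be too small to
  -- follow the new `hi`.
  · have hzlo : z = i.lo := by
      rw [Fin.ext_iff]; unfold ColLt at hz hz'; omega
    subst hzlo
    have h1 := (Good.count_left (u := p ++ d1) (p := i.lo :: d2 ++ a) (by simpa using hg)).1 hi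
    have h2 : 0 < (i.lo :: d2 ++ a).count i.hi := lt_of_lt_of_le (by simp) h1
    rw [List.count_pos_iff] at h2
    simp only [List.cons_append, List.mem_cons, List.mem_append, i.lo_ne_hi.symm, false_or] at h2
    rcases h2 with h2 | h2
    · obtain ⟨y, hy, hyb⟩ := hadj2.exists_not_colLt h2
      cases b with
      | nil => simp at hy
      | cons e b =>
        have he : ColLt i.hi e := hg.colLt_hi (hcb.1 e (by simp))
        refine hyb ?_
        rcases List.mem_cons.1 hy with rfl | hy
        · exact he
        · exact ColLt.trans _ _ _ he ((List.pairwise_cons.1 hcb.2).1 y hy)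
    · have := (hcol.2.2 _ h2 _ List.mem_cons_self).le
      omega
  · have h1 := (Good.count_left (u := p ++ d1) (p := z :: (d2 ++ a)) (by simpa using hg)).2.1 hi
    simp only [List.count_eq_zero, List.mem_cons, not_or] at h1
    have h2 : z.val ≠ i.val := fun h => h1.1.1 (Fin.ext (by omega))
    have h3 : z.val ≠ i.val + 1 := fun h => h1.2.1 (Fin.ext (by omega))
    unfold ColLt at hz hz'
    omega
  · have hzhi : z = i.hi := by
      rw [Fin.ext_iff]; unfold ColLt at hz hz'; omega
    subst hzhi
    -- Unbarred letters may repeat in a column; `a2` is the block of letters `lo` directly above the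
    -- position. The entries of `d` beside this block are all `hi`, and `z` is one more `hi`, so
    -- there are more openings than closings.
    obtain ⟨a1, a2, rfl, ha1, ha2⟩ : ∃ a1 a2, a = a1 ++ a2 ∧ i.lo ∉ a1 ∧ ∀ x ∈ a2, x = i.lo := by
      refine ⟨a.filter (· ≠ i.lo), a.filter (· = i.lo), ?_, by simp, by simp⟩
      have : ∀ a : List (Letter m n), a.Pairwise ColLt → (∀ x ∈ a, ColLt x i.lo) →
          a = a.filter (· ≠ i.lo) ++ a.filter (· = i.lo) := by
        intro a
        induction a with
        | nil => simp
        | cons x a ih =>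
          intro h1 h2
          have h1' := List.pairwise_cons.1 h1
          by_cases hx : x = i.lo
          · have hall : ∀ y ∈ a, y = i.lo := by
              intro y hy
              have h3 := (h1'.1 y hy).le
              have h4 := (h2 y (by simp [hy])).le
              rw [hx] at h3
              rw [Fin.ext_iff]; omega
            have e1 : (x :: a).filter (· ≠ i.lo) = [] := by
              simp only [List.filter_eq_nil_iff, List.mem_cons, forall_eq_or_imp]
              exact ⟨by simp [hx], fun y hy => by simp [hall y hy]⟩
            have e2 : (x :: a).filter (· = i.lo) = x :: a := by
              simp only [List.filter_eq_self, List.mem_cons, forall_eq_or_imp]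
              exact ⟨by simp [hx], fun y hy => by simp [hall y hy]⟩
            rw [e1, e2, List.nil_append]
          · have := ih h1'.2 fun y hy => h2 y (by simp [hy])
            simp only [ne_eq, hx, not_false_eq_true, decide_true, List.filter_cons_of_pos,
              decide_false, Bool.false_eq_true, List.filter_cons_of_neg, List.cons_append]
            simpa using this
      exact this a hcol.1 fun x hx => hcol.2.2 x hx _ List.mem_cons_self
    rcases Adj.split_left hadj1 with ⟨h1, h2⟩ | ⟨e1, e2, rfl, h1, h2, h3⟩
    · have ha2' : a2 = [] := by
        rw [← List.length_eq_zero_iff]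
        rw [List.length_append] at hlen; omega
      subst ha2'
      have := (Good.count_left (u := p ++ d1) (p := i.hi :: d2 ++ a1)
        (by simpa using hg)).2.2 hi
      have h5 : (i.hi :: d2 ++ a1).count i.lo = 0 := by
        rw [List.count_eq_zero]
        simp only [List.cons_append, List.mem_cons, List.mem_append, i.lo_ne_hi, false_or, not_or]
        refine ⟨fun h6 => ?_, ha1⟩
        have := (hdz.1 _ h6).le
        omega
      rw [h5] at this
      simp at this
    · have hcnt := (Good.count_left (u := p ++ e1) (p := (e2 ++ i.hi :: d2) ++ (a1 ++ a2))
        (by simpa using hg)).2.2 hi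
      have he2 : ∀ x ∈ e2, x = i.hi := by
        intro x hx
        obtain ⟨y, hy, hxy⟩ := h3.exists_not_colLt hx
        rw [ha2 y hy] at hxy
        have h4 := (hdol.2.2 x (by simp [hx]) _ List.mem_cons_self).le
        rw [Fin.ext_iff]
        unfold ColLt at hxy
        omega
      have hle : e2.length = a2.length := by
        simp only [List.length_append] at hlen; omega
      have c1 : e2.count i.hi = e2.length := List.count_eq_length.2 fun x hx => (he2 x hx).symm
      have c2 : e2.count i.lo = 0 := by
        rw [List.count_eq_zero]
        exact fun h => i.lo_ne_hi (he2 _ h)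
      have c3 : d2.count i.lo = 0 := by
        rw [List.count_eq_zero]
        intro h6
        have := (hdz.1 _ h6).le
        omega
      have c4 : a1.count i.lo = 0 := List.count_eq_zero.2 ha1
      have c5 : a2.count i.lo ≤ a2.length := List.count_le_length
      simp only [List.count_append, List.count_cons, c1, c2, c3, c4, beq_iff_eq, i.lo_ne_hi.symm, 
        if_true, if_false] at hcnt
      omega

/-- The mirror image of `Good.adj_right`: the left column is read after the position, so closing
brackets are counted there. At the index `0` the row conditions for `lo` and `hi` to the right of
`z` coincide and nothing needs to be excluded. -/
theorem Good.adj_left {i : Index m n} {a b l : List (Letter m n)} {p s : Word m n}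
    (hg : Good i (p ++ a) (b ++ l ++ s)) (hc : IsColumn (a ++ i.hi :: b)) (hd : IsColumn l)
    (h : Adj l (a ++ i.hi :: b)) : Adj l (a ++ i.lo :: b) := by
  have hl : i.lo.val = i.val := rfl
  have hh : i.hi.val = i.val + 1 := rfl
  refine h.replace_right ?_
  rintro l1 z l2 rfl hlen hadj1 hz hadj2 hz'
  have hcol := List.pairwise_append.1 hc
  have hdol := List.pairwise_append.1 hd
  have hcb := List.pairwise_cons.1 hcol.2.1
  have hdz := List.pairwise_cons.1 hdol.2.1
  rcases lt_trichotomy (i.val + 1) m with hi | hi | hi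
  · have hzhi : z = i.hi := by
      rw [Fin.ext_iff]; unfold ColLt at hz hz'; omega
    subst hzhi
    have h1 := (Good.count_right (s := b ++ (l1 ++ [i.hi])) (v := l2 ++ s) (by simpa using hg)).1 hi
    have h2 : 0 < (b ++ (l1 ++ [i.hi])).count i.lo := lt_of_lt_of_le (by simp) h1
    rw [List.count_pos_iff] at h2
    simp only [List.mem_append, List.mem_singleton, i.lo_ne_hi, or_false] at h2
    rcases h2 with h2 | h2
    · have := (hcb.1 _ h2).le
      omega
    · obtain ⟨y, hy, hyb⟩ := hadj1.exists_not_colLt_left hlen h2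
      rcases List.eq_nil_or_concat a with rfl | ⟨a, e, rfl⟩
      · simp at hy
      · simp only [List.concat_eq_append, List.mem_append, List.mem_singleton] at *
        have he : ColLt e i.lo := Good.colLt_lo (p := p ++ a) (by simpa using hg)
          (hcol.2.2 e (by simp) _ (by simp))
        refine hyb ?_
        rcases hy with hy | rfl
        · exact ColLt.trans _ _ _ ((List.pairwise_append.1 hcol.1).2.2 y hy e (by simp)) he
        · exact he
  · unfold ColLt at hz hz'
    omega
  · have hzlo : z = i.lo := by
      rw [Fin.ext_iff]; unfold ColLt at hz hz'; omega
    subst hzlo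
    obtain ⟨b1, b2, rfl, hb1, hb2⟩ : ∃ b1 b2, b = b1 ++ b2 ∧ (∀ x ∈ b1, x = i.hi) ∧ i.hi ∉ b2 := by
      refine ⟨b.filter (· = i.hi), b.filter (· ≠ i.hi), ?_, by simp, by simp⟩
      have : ∀ b : List (Letter m n), b.Pairwise ColLt → (∀ x ∈ b, ColLt i.hi x) →
          b = b.filter (· = i.hi) ++ b.filter (· ≠ i.hi) := by
        intro b
        induction b with
        | nil => simp
        | cons x b ih =>
          intro h1 h2
          have h1' := List.pairwise_cons.1 h1
          have := ih h1'.2 fun y hy => h2 y (by simp [hy])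
          by_cases hx : x = i.hi
          · simp only [hx, decide_true, List.filter_cons_of_pos, ne_eq, not_true_eq_false,
              decide_false, Bool.false_eq_true, not_false_eq_true, List.filter_cons_of_neg,
              List.cons_append]
            simpa using this
          · have hall : ∀ y ∈ x :: b, y ≠ i.hi := by
              intro y hy h3
              have h4 := (h2 x (by simp)).le
              have h6 : x.val ≠ i.hi.val := fun h => hx (Fin.ext h)
              rcases List.mem_cons.1 hy with rfl | hy
              · exact hx h3
              · have h5 := (h1'.1 y hy).le
                rw [h3] at h5; omega
            have e1 : (x :: b).filter (· = i.hi) = [] := by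
              rw [List.filter_eq_nil_iff]
              exact fun y hy => by simp [hall y hy]
            have e2 : (x :: b).filter (· ≠ i.hi) = x :: b := by
              rw [List.filter_eq_self]
              exact fun y hy => by simp [hall y hy]
            rw [e1, e2, List.nil_append]
      exact this b hcb.2 hcb.1
    obtain ⟨m1, m2, rfl, h1, h2, h3⟩ := Adj.split_right hadj2
    have hcnt := (Good.count_right (s := (b1 ++ b2) ++ (l1 ++ i.lo :: m1)) (v := m2 ++ s)
      (by simpa using hg)).2 hi
    have hm1 : ∀ x ∈ m1, x = i.lo := by
      intro x hx
      obtain ⟨y, hy, hxy⟩ := h2.exists_not_colLt_left h1 hx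
      rw [hb1 y hy] at hxy
      have h4 := (hdz.1 x (by simp [hx])).le
      rw [Fin.ext_iff]
      unfold ColLt at hxy
      omega
    have c1 : m1.count i.lo = m1.length := List.count_eq_length.2 fun x hx => (hm1 x hx).symm
    have c2 : m1.count i.hi = 0 := by
      rw [List.count_eq_zero]
      exact fun h => i.lo_ne_hi (hm1 _ h).symm
    have c3 : l1.count i.hi = 0 := by
      rw [List.count_eq_zero]
      intro h6
      have := (hdol.2.2 _ h6 _ List.mem_cons_self).le
      omega
    have c4 : b2.count i.hi = 0 := List.count_eq_zero.2 hb2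
    have c5 : b1.count i.hi ≤ b1.length := List.count_le_length
    simp only [List.count_append, List.count_cons, c1, c2, c3, c4, beq_iff_eq, i.lo_ne_hi, 
      if_true, if_false] at hcnt
    omega

theorem readCols_append (L L' : List (List (Letter m n))) :
    readCols (L ++ L') = readCols L' ++ readCols L := by
  induction L with
  | nil => simp [readCols]
  | cons c L ih => simp [readCols, ih]

theorem exists_of_readCols_eq {T : List (List (Letter m n))} {p s : Word m n} {x : Letter m n}
    (h : readCols T = p ++ x :: s) : ∃ L a b L', T = L ++ (a ++ x :: b) :: L' ∧
      p = readCols L' ++ a ∧ s = b ++ readCols L := by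
  induction T generalizing s with
  | nil => simp [readCols] at h
  | cons c T ih =>
    have h' : [] ++ readCols T ++ c = p ++ x :: s := h
    rcases eq_append_cons_cases h' with ⟨u', h1, _⟩ | ⟨p', s', h1, h2, rfl⟩ | ⟨v', h1, h2⟩
    · simp at h1
    · obtain rfl : p = p' := h2
      obtain ⟨L, a, b, L', rfl, h3, rfl⟩ := ih h1
      exact ⟨c :: L, a, b, L', rfl, h3, by simp [readCols]⟩
    · exact ⟨[], v', s, T, by rw [h1]; rfl, by simpa using h2, by simp [readCols]⟩

theorem isTab_append_cons {L L' : List (List (Letter m n))} {c : List (Letter m n)} :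
    IsTab (L ++ c :: L') ↔ IsTab L ∧ (∀ l, L.getLast? = some l → Adj l c) ∧
      IsColumn c ∧ Adj c (L'.headD []) ∧ IsTab L' := by
  induction L with
  | nil => simp [IsTab]
  | cons d L ih =>
    cases L with
    | nil => simp [IsTab, and_left_comm]
    | cons e L =>
      have : (d :: e :: L).getLast? = (e :: L).getLast? := by simp
      rw [this]
      simp only [List.cons_append] at ih ⊢
      rw [IsTab, ih]
      simp [IsTab, and_assoc]

/-- Of the four neighbours of the changed entry, two are harmless by monotonicity: above and left
for `lo → hi`, below and right for `hi → lo`. The other two are controlled by `Good`. -/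
theorem exists_tab_of_good {i : Index m n} {T : List (List (Letter m n))} {p s : Word m n}
    {x y : Letter m n} (hT : IsTab T) (h0 : [] ∉ T) (h : readCols T = p ++ x :: s)
    (hg : Good i p s) (hxy : x = i.lo ∧ y = i.hi ∨ x = i.hi ∧ y = i.lo) :
    ∃ T', IsTab T' ∧ [] ∉ T' ∧ T'.map List.length = T.map List.length ∧
      readCols T' = p ++ y :: s := by
  obtain ⟨L, a, b, L', rfl, rfl, rfl⟩ := exists_of_readCols_eq h
  rw [isTab_append_cons] at hT
  obtain ⟨h1, h2, h3, h4, h5⟩ := hT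
  have hcol := List.pairwise_append.1 h3
  refine ⟨L ++ (a ++ y :: b) :: L', isTab_append_cons.2 ⟨h1, ?_, ?_, ?_, h5⟩, ?_, by simp,
    by simp [readCols_append, readCols]⟩
  · intro l hl
    have h6 := h2 l hl
    rcases hxy with ⟨rfl, rfl⟩ | ⟨rfl, rfl⟩
    · exact h6.replace_right fun _ z _ _ _ _ hz _ hz' => hz ((i.colLt_mono z).2 hz')
    · obtain ⟨M, rfl⟩ : ∃ M, L = M ++ [l] := List.getLast?_eq_some_iff.1 hl
      refine Good.adj_left (p := readCols L') (s := readCols M) ?_ h3 ?_ h6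
      · simpa [readCols_append, readCols] using hg
      · exact IsTab.isColumn h1 l (by simp)
  · refine pairwise_replace ColLt.trans h3 ?_ ?_
    · intro e he
      have h6 : ColLt e x := hcol.2.2 e (List.mem_of_getLast? he) x List.mem_cons_self
      rcases hxy with ⟨rfl, rfl⟩ | ⟨rfl, rfl⟩
      · exact (i.colLt_mono e).1 h6
      · obtain ⟨M, rfl⟩ : ∃ M, a = M ++ [e] := List.getLast?_eq_some_iff.1 he
        exact Good.colLt_lo (p := readCols L' ++ M) (by simpa using hg) h6
    · intro e he
      have h6 : ColLt x e := (List.pairwise_cons.1 hcol.2.1).1 e (List.mem_of_head? he)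
      rcases hxy with ⟨rfl, rfl⟩ | ⟨rfl, rfl⟩
      · cases b with
        | nil => simp at he
        | cons f b =>
          simp only [List.head?_cons, Option.some.injEq] at he
          subst he
          exact hg.colLt_hi h6
      · exact (i.colLt_mono e).2 h6
  · cases L' with
    | nil => exact adj_nil _
    | cons d L' =>
      rcases hxy with ⟨rfl, rfl⟩ | ⟨rfl, rfl⟩
      · exact Good.adj_right (p := readCols L') (s := readCols L)
          (by simpa [readCols] using hg) h3 h5.1 h4
      · exact Adj.replace_left h4 fun _ z _ _ _ _ hz _ hz' => hz ((i.colLt_mono z).1 hz')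
  · simp only [List.mem_append, List.mem_cons, not_or] at h0 ⊢
    exact ⟨h0.1, by simp, h0.2.2⟩

theorem exists_tab_of_wordF {i : Index m n} {T : List (List (Letter m n))} {w : Word m n}
    (hT : IsTab T) (h0 : [] ∉ T) (h : wordF i (readCols T) = some w) :
    ∃ T', IsTab T' ∧ [] ∉ T' ∧ T'.map List.length = T.map List.length ∧ readCols T' = w := by
  obtain ⟨p, s, h1, rfl, hg⟩ := wordF_eq_some.1 h
  exact exists_tab_of_good hT h0 h1 hg (.inl ⟨rfl, rfl⟩)

theorem exists_tab_of_wordE {i : Index m n} {T : List (List (Letter m n))} {w : Word m n}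
    (hT : IsTab T) (h0 : [] ∉ T) (h : wordE i (readCols T) = some w) :
    ∃ T', IsTab T' ∧ [] ∉ T' ∧ T'.map List.length = T.map List.length ∧ readCols T' = w := by
  obtain ⟨p, s, h1, rfl, hg⟩ := wordE_eq_some.1 h
  exact exists_tab_of_good hT h0 h1 hg (.inr ⟨rfl, rfl⟩)

end Stability

/-! ### Sorted biwords -/

section Biwords

variable {m n : ℕ}

/-- The super lexicographic order on the pairs that may occur in the biword of a matrix in `M`: a
pair `(b, b')` is below itself exactly if `|b| = |b'|`. -/
def BiLe (p q : Letter m n × Letter m n) : Prop :=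
  p.2.val < q.2.val ∨ p.2 = q.2 ∧ if p.2.val < m then ¬ ColLt p.1 q.1 else ColLt p.1 q.1

theorem BiLe.snd_le {p q : Letter m n × Letter m n} (h : BiLe p q) : p.2.val ≤ q.2.val := by
  rcases h with h | h
  · exact h.le
  · rw [h.1]

theorem BiLe.trans : ∀ p q r : Letter m n × Letter m n, BiLe p q → BiLe q r → BiLe p r := by
  rintro p q r h h'
  rcases h with h | ⟨h1, h2⟩
  · exact .inl (h.trans_le h'.snd_le)
  · rcases h' with h' | ⟨h3, h4⟩
    · exact .inl (by rwa [h1])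
    · refine .inr ⟨h1.trans h3, ?_⟩
      rw [← h1] at h4
      split_ifs at h2 h4 ⊢
      · exact ColLt.cotrans _ _ _ h2 h4
      · exact ColLt.trans _ _ _ h2 h4

theorem BiLe.antisymm {p q : Letter m n × Letter m n} (h : BiLe p q) (h' : BiLe q p) : p = q := by
  have e : p.2 = q.2 := Fin.ext (le_antisymm h.snd_le h'.snd_le)
  unfold BiLe at h h'
  rw [e] at h h'
  simp only [lt_self_iff_false, true_and, false_or] at h h'
  refine Prod.ext (Fin.ext ?_) e
  unfold ColLt at h h'
  split_ifs at h h' <;> omega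

theorem eq_of_count_eq {L L' : List (Letter m n × Letter m n)} (h : L.Pairwise BiLe)
    (h' : L'.Pairwise BiLe) (hc : ∀ p, L.count p = L'.count p) : L = L' :=
  (List.perm_iff_count.2 hc).eq_of_pairwise (fun _ _ _ _ h1 h2 => h1.antisymm h2) h h'

/-- Two pairs of letters may occur in the same row subword, in one of the two orders. -/
def Comparable (p q : Letter m n × Letter m n) : Prop :=
  (¬ ColLt p.1 q.1 ∧ ¬ ColLt q.2 p.2) ∨ (¬ ColLt q.1 p.1 ∧ ¬ ColLt p.2 q.2)

/-- `Comparable` is unchanged if the two pairs are exchanged, and also if the components of both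
pairs are exchanged. So it describes row subwords of a sorted biword and of its transpose at the
same time. -/
theorem BiLe.comparable_iff {p q : Letter m n × Letter m n} (h : BiLe p q) :
    Comparable p q ↔ ¬ ColLt p.1 q.1 := by
  unfold BiLe at h
  rw [Fin.ext_iff] at h
  unfold Comparable ColLt at *
  split_ifs at h <;> omega

theorem exists_perm_of_map_perm {α β : Type*} {f : α → β} {l' l'' : List β} (h : l'.Perm l'') :
    ∀ {l : List α}, l.map f = l' → ∃ k : List α, k.Perm l ∧ k.map f = l'' := by
  induction h with
  | nil => intro l h; exact ⟨l, .refl _, h⟩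
  | cons x _ ih =>
    intro l h
    obtain ⟨a, r, rfl, rfl, h'⟩ := List.map_eq_cons_iff.1 h
    obtain ⟨k, hk, hk'⟩ := ih h'
    exact ⟨a :: k, hk.cons a, by simp [hk']⟩
  | swap x y _ =>
    intro l h
    obtain ⟨a, r, rfl, rfl, h'⟩ := List.map_eq_cons_iff.1 h
    obtain ⟨b, r', rfl, rfl, rfl⟩ := List.map_eq_cons_iff.1 h'
    exact ⟨b :: a :: r', .swap _ _ _, rfl⟩
  | trans _ _ ih1 ih2 =>
    intro l h
    obtain ⟨k, hk, hk'⟩ := ih1 h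
    obtain ⟨k', h1, h2⟩ := ih2 hk'
    exact ⟨k', h1.trans hk, h2⟩

/-- The sorted biwords `L` and `L'` belong to transposed matrices. -/
structure Dual (L L' : List (Letter m n × Letter m n)) : Prop where
  left : L.Pairwise BiLe
  right : L'.Pairwise BiLe
  perm : L'.Perm (L.map Prod.swap)

theorem Dual.symm {L L' : List (Letter m n × Letter m n)} (h : Dual L L') : Dual L' L := by
  refine ⟨h.right, h.left, ?_⟩
  have := (h.perm.map Prod.swap).symm
  rwa [List.map_map, Prod.swap_swap_eq, List.map_id] at this

theorem Dual.filter {L L' : List (Letter m n × Letter m n)} (h : Dual L L') (t : ℕ) :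
    Dual (L.filter fun p => decide (p.2.val < t)) (L'.filter fun p => decide (p.1.val < t)) := by
  refine ⟨h.left.filter _, h.right.filter _, ?_⟩
  rw [show L.filter (fun p => decide (p.2.val < t)) =
    L.filter ((fun p => decide (p.1.val < t)) ∘ Prod.swap) from rfl, ← List.filter_map]
  exact h.perm.filter _

/-- The colours are attached to the pairs instead of the letters. Each class then consists of
pairwise comparable pairs, a property that does not depend on the order in which the pairs are
listed. -/
theorem Dual.rowColorable {L L' : List (Letter m n × Letter m n)} (h : Dual L L') {k N : ℕ}
    (hc : RowColorable ColLt k N (L.map Prod.fst)) : RowColorable ColLt k N (L'.map Prod.fst) := by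
  obtain ⟨C, h1, h2, h3⟩ := hc
  have hlen : L.length = (C.map Prod.snd).length := by
    have := congrArg List.length h1
    simpa using this.symm
  let E := L.zip (C.map Prod.snd)
  have hE1 : E.map Prod.fst = L := List.map_fst_zip hlen.le
  have hE2 : E.map Prod.snd = C.map Prod.snd := List.map_snd_zip hlen.ge
  have hEC : E.map (fun e => (e.1.1, e.2)) = C := by
    have a1 : (E.map (fun e => (e.1.1, e.2))).map Prod.fst = C.map Prod.fst := by
      rw [h1, ← hE1, List.map_map, List.map_map]; rfl
    have a2 : (E.map (fun e => (e.1.1, e.2))).map Prod.snd = C.map Prod.snd := by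
      rw [← hE2, List.map_map]; rfl
    rw [← List.zip_unzip (E.map _), ← List.zip_unzip C, List.unzip_eq_map, List.unzip_eq_map]
    simp only [a1, a2]
  let R : (Letter m n × Letter m n) × ℕ → (Letter m n × Letter m n) × ℕ → Prop :=
    fun e f => e.2 = f.2 → e.2 < k → Comparable e.1 f.1
  have hR : E.Pairwise R := by
    rw [← hEC, List.pairwise_map] at h2
    have h4 := h.left
    rw [← hE1, List.pairwise_map] at h4
    exact (h2.and h4).imp fun h e hk => h.2.comparable_iff.2 (h.1 e hk)
  -- `F` lists the swapped coloured pairs in the order of the transposed biword.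
  obtain ⟨F, hF, hF'⟩ := exists_perm_of_map_perm (f := Prod.fst) h.perm.symm
    (l := E.map (Prod.map Prod.swap id)) (by rw [← hE1, List.map_map, List.map_map]; rfl)
  have hRF : F.Pairwise R := by
    refine hF.symm.pairwise ?_ ?_
    · rw [List.pairwise_map]
      refine hR.imp fun {e f} h he hk => ?_
      rcases h he hk with ⟨a, b⟩ | ⟨a, b⟩
      · exact .inr ⟨b, a⟩
      · exact .inl ⟨b, a⟩
    · intro e f h he hk
      rcases h he.symm (by rwa [← he]) with ⟨a, b⟩ | ⟨a, b⟩
      · exact .inr ⟨a, b⟩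
      · exact .inl ⟨a, b⟩
  refine ⟨F.map (fun e => (e.1.1, e.2)), ?_, ?_, ?_⟩
  · rw [← hF', List.map_map, List.map_map]; rfl
  · rw [List.pairwise_map]
    have h4 := h.right
    rw [← hF', List.pairwise_map] at h4
    exact (hRF.and h4).imp fun h e hk => h.2.comparable_iff.1 (h.1 e hk)
  · rw [List.countP_map, hF.countP_eq, List.countP_map]
    rw [← hEC, List.countP_map] at h3
    exact h3

/-- The shape of the insertion tableau of the first components of the pairs in `L` whose second
component is `< t`. -/
def prefixShape (t : ℕ) (L : List (Letter m n × Letter m n)) : ℕ → ℕ :=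
  colLen (pTab ((L.filter fun p => decide (p.2.val < t)).map Prod.fst))

theorem colLen_pTab_eq {w w' : Word m n}
    (h : ∀ k N, RowColorable ColLt k N w ↔ RowColorable ColLt k N w') :
    colLen (pTab w) = colLen (pTab w') := by
  refine colLen_eq_of_rowColorable (isTab_pTab w) (isTab_pTab w') fun k N => ?_
  have h1 := fun w : Word m n =>
    (knuth_readCols_pTab w).rowColorable_iff ColLt.trans ColLt.cotrans k N
  rw [← h1 w, ← h1 w', h]

/-- The recording tableau: the insertion tableau of the transposed matrix records the shapes. -/
theorem Dual.colLen_restr {L L' : List (Letter m n × Letter m n)} (h : Dual L L') (t : ℕ) :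
    colLen (restr t (pTab (L'.map Prod.fst))) = prefixShape t L := by
  rw [colLen_restr_pTab, prefixShape]
  refine colLen_pTab_eq fun k N => ?_
  rw [List.filter_map]
  exact ⟨(h.filter t).symm.rowColorable, (h.filter t).rowColorable⟩

theorem filter_eq_self_of_last {L : List (Letter m n × Letter m n)} {p : Letter m n × Letter m n}
    (h : (L ++ [p]).Pairwise BiLe) {t : ℕ} (ht : p.2.val < t) :
    L.filter (fun p => decide (p.2.val < t)) = L := by
  rw [List.filter_eq_self]
  intro q hq
  have := ((List.pairwise_append.1 h).2.2 q hq p (by simp)).snd_le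
  simp only [decide_eq_true_eq]; omega

theorem prefixShape_of_last {L : List (Letter m n × Letter m n)} {p : Letter m n × Letter m n}
    (h : (L ++ [p]).Pairwise BiLe) {t : ℕ} (ht : p.2.val < t) :
    prefixShape t L = colLen (pTab (L.map Prod.fst)) := by
  rw [prefixShape, filter_eq_self_of_last h ht]

theorem prefixShape_concat_of_le {L : List (Letter m n × Letter m n)} {p : Letter m n × Letter m n}
    {t : ℕ} (ht : t ≤ p.2.val) : prefixShape t (L ++ [p]) = prefixShape t L := by
  rw [prefixShape, prefixShape, List.filter_append]
  simp [ht]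

theorem prefixShape_concat_of_lt {L : List (Letter m n × Letter m n)} {p : Letter m n × Letter m n}
    (h : (L ++ [p]).Pairwise BiLe) {t : ℕ} (ht : p.2.val < t) :
    prefixShape t (L ++ [p]) = colLen (pTab ((L ++ [p]).map Prod.fst)) := by
  rw [prefixShape, List.filter_append, filter_eq_self_of_last h ht]
  simp [ht]

theorem pTab_map_concat (L : List (Letter m n × Letter m n)) (p : Letter m n × Letter m n) :
    pTab ((L ++ [p]).map Prod.fst) = ins (pTab (L.map Prod.fst)) p.1 := by
  rw [List.map_append, List.map_singleton, pTab_concat]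

/-- The last box of the block of pairs with the same second component is the rightmost or the
leftmost one of the block, depending on the degree of that component. -/
theorem prefixShape_last {L : List (Letter m n × Letter m n)} {p : Letter m n × Letter m n}
    (h : (L ++ [p]).Pairwise BiLe) :
    (∀ j, prefixShape p.2.val L j ≤ colLen (pTab (L.map Prod.fst)) j) ∧
    ∀ j, (if p.2.val < m then insCol (pTab (L.map Prod.fst)) p.1 < j
      else j < insCol (pTab (L.map Prod.fst)) p.1) →
      prefixShape p.2.val L j = colLen (pTab (L.map Prod.fst)) j := by
  induction L using List.reverseRecOn generalizing p with
  | nil => exact ⟨fun _ => le_rfl, fun _ _ => rfl⟩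
  | append_singleton L q ih =>
    have hLq := (List.pairwise_append.1 h).1
    have hqp : BiLe q p := (List.pairwise_append.1 h).2.2 q (by simp) p (by simp)
    rcases hqp with hlt | ⟨heq, hqp⟩
    · rw [prefixShape_concat_of_lt hLq hlt]
      exact ⟨fun _ => le_rfl, fun _ _ => rfl⟩
    · obtain ⟨h1, h2⟩ := ih hLq
      rw [heq] at hqp h1 h2
      rw [prefixShape_concat_of_le (by rw [heq])]
      have hbox := insCol_lt_insCol_ins (x := q.1) (y := p.1) (isTab_pTab (L.map Prod.fst))
      rw [pTab_map_concat]
      simp only [colLen_ins]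
      refine ⟨fun j => (h1 j).trans (by omega), fun j hj => ?_⟩
      have h4 := h2 j
      by_cases h3 : p.2.val < m
      · rw [if_pos h3] at hqp hj h4
        have := hbox.2 hqp
        rw [h4 (by omega), if_neg (by omega), add_zero]
      · rw [if_neg h3] at hqp hj h4
        have := mt hbox.1 (not_not.2 hqp)
        rw [h4 (by omega), if_neg (by omega), add_zero]

/-- The last pair is peeled off. Its second component is the largest one and is visible in the
shapes; the box it created is the extreme box of its block by `prefixShape_last`. Reverse insertion
from this box gives the rest. -/
theorem eq_of_pTab_eq {L L' : List (Letter m n × Letter m n)} (h : L.Pairwise BiLe)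
    (h' : L'.Pairwise BiLe) (hT : pTab (L.map Prod.fst) = pTab (L'.map Prod.fst))
    (hs : ∀ t, prefixShape t L = prefixShape t L') : L = L' := by
  induction L using List.reverseRecOn generalizing L' with
  | nil =>
    have := sum_colLen (L'.map Prod.fst)
    rw [← hT] at this
    simp [pTab] at this
    exact (List.length_eq_zero_iff.1 this.symm).symm
  | append_singleton L p ih =>
    rcases List.eq_nil_or_concat L' with rfl | ⟨L', p', rfl⟩
    · have := sum_colLen ((L ++ [p]).map Prod.fst)
      rw [hT] at this
      simp [pTab] at this
    rw [List.concat_eq_append] at *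
    have key : ∀ {L L' : List (Letter m n × Letter m n)} {p p'}, (L ++ [p]).Pairwise BiLe →
        (L' ++ [p']).Pairwise BiLe →
        pTab ((L ++ [p]).map Prod.fst) = pTab ((L' ++ [p']).map Prod.fst) →
        (∀ t, prefixShape t (L ++ [p]) = prefixShape t (L' ++ [p'])) → ¬ p.2.val < p'.2.val := by
      intro L L' p p' h h' hT hs hlt
      have h1 := hs p'.2.val
      rw [prefixShape_concat_of_lt h hlt, prefixShape_concat_of_le le_rfl, hT, pTab_map_concat] at h1
      have h2 := congrFun h1 (insCol (pTab (L'.map Prod.fst)) p'.1)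
      rw [colLen_ins, if_pos rfl] at h2
      have h3 := (prefixShape_last h').1 (insCol (pTab (L'.map Prod.fst)) p'.1)
      omega
    have e2 : p.2 = p'.2 := by
      have h1 := key h h' hT hs
      have h2 := key h' h hT.symm fun t => (hs t).symm
      rw [Fin.ext_iff]; omega
    have hb := hs p.2.val
    rw [prefixShape_concat_of_le le_rfl, prefixShape_concat_of_le (by rw [e2])] at hb
    have p1 := prefixShape_last h
    have p2 := prefixShape_last h'
    rw [← e2] at p2
    rw [pTab_map_concat, pTab_map_concat] at hT
    have hc := fun j => congrFun (congrArg colLen hT) j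
    simp only [colLen_ins] at hc
    -- Both words add the same set of boxes in the last block, and in both the last box is extreme
    -- on the same side.
    have e3 : insCol (pTab (L.map Prod.fst)) p.1 = insCol (pTab (L'.map Prod.fst)) p'.1 := by
      set j := insCol (pTab (L.map Prod.fst)) p.1
      set j' := insCol (pTab (L'.map Prod.fst)) p'.1
      by_contra hne
      have a1 := hc j
      have a2 := hc j'
      have b1 := congrFun hb j
      have b2 := congrFun hb j'
      have c1 := p1.1 j
      have c2 := p1.1 j'
      have d1 := p2.1 j
      have d2 := p2.1 j'
      have f1 := p1.2 j'
      have f2 := p2.2 j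
      simp only [if_true, hne, Ne.symm hne, if_false] at a1 a2
      split_ifs at f1 f2 <;> omega
    obtain ⟨e4, e5⟩ := ins_injective (isTab_pTab _) (isTab_pTab _) (nil_notMem_pTab _)
      (nil_notMem_pTab _) e3 hT
    have e6 : L = L' := by
      refine ih (List.pairwise_append.1 h).1 (List.pairwise_append.1 h').1 e4 fun t => ?_
      by_cases ht : p.2.val < t
      · rw [prefixShape_of_last h ht, prefixShape_of_last h' (by rwa [← e2]), e4]
      · have := hs t
        rwa [prefixShape_concat_of_le (by omega), prefixShape_concat_of_le (by rw [← e2]; omega)]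
          at this
    rw [e6, Prod.ext e5 e2]

end Biwords

/-! ### Every pair of tableaux of the same shape comes from a sorted biword -/

section Surjectivity

variable {m n : ℕ}

theorem exists_first_split {α : Type*} {P : α → Prop} {l : List α} (h : ∃ a ∈ l, P a) :
    ∃ l₁ a l₂, l = l₁ ++ a :: l₂ ∧ P a ∧ ∀ x ∈ l₁, ¬ P x := by
  induction l with
  | nil => simp at h
  | cons b l ih =>
    by_cases hb : P b
    · exact ⟨[], b, l, rfl, hb, by simp⟩
    · obtain ⟨l₁, a, l₂, e, ha, h1⟩ := ih (by simpa [hb] using h)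
      exact ⟨b :: l₁, a, l₂, by rw [e]; rfl, ha, by simpa [hb] using h1⟩

theorem exists_last_split {α : Type*} {P : α → Prop} {l : List α} (h : ∃ a ∈ l, P a) :
    ∃ l₁ a l₂, l = l₁ ++ a :: l₂ ∧ P a ∧ ∀ x ∈ l₂, ¬ P x := by
  obtain ⟨l₁, a, l₂, e, ha, h1⟩ := exists_first_split (l := l.reverse) (by simpa using h)
  refine ⟨l₂.reverse, a, l₁.reverse, ?_, ha, by simpa using h1⟩
  rw [← List.reverse_reverse l, e]; simp

theorem colLen_append_concat (L L' : List (List (Letter m n))) (c : List (Letter m n)) (b) (i : ℕ) :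
    colLen (L ++ (c ++ [b]) :: L') i = colLen (L ++ c :: L') i + if i = L.length then 1 else 0 := by
  induction L generalizing i with
  | nil => cases i <;> simp
  | cons d L ih => cases i <;> simp [ih]

theorem colLen_restr (t : ℕ) (T : List (List (Letter m n))) (j : ℕ) :
    colLen (restr t T) j = ((T.getD j []).filter fun a => decide (a.val < t)).length := by
  induction T generalizing j with
  | nil => simp [restr]
  | cons c T ih =>
    cases j with
    | zero => simp [restr]
    | succ j => simpa [restr] using ih j

theorem restr_eq_self {t : ℕ} {T : List (List (Letter m n))} (h : ∀ a ∈ readCols T, a.val < t) :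
    restr t T = T := by
  unfold restr
  conv_rhs => rw [← List.map_id T]
  refine List.map_congr_left fun c hc => ?_
  rw [id, List.filter_eq_self]
  intro a ha
  simpa using h a (mem_readCols.2 ⟨c, hc, ha⟩)

theorem map_length_eq_of_colLen_eq : ∀ {T T' : List (List (Letter m n))}, [] ∉ T → [] ∉ T' →
    colLen T = colLen T' → T.map List.length = T'.map List.length
  | [], [], _, _, _ => rfl
  | [], c :: T', _, h, h' => by
    have := congrFun h' 0
    exact absurd (List.length_eq_zero_iff.1 this.symm) fun e : c = [] => h (by simp [e])
  | c :: T, [], h, _, h' => by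
    have := congrFun h' 0
    exact absurd (List.length_eq_zero_iff.1 this) fun e : c = [] => h (by simp [e])
  | c :: T, d :: T', h, h0, h' => by
    simp only [List.mem_cons, not_or] at h h0
    have e1 : c.length = d.length := congrFun h' 0
    have e2 := map_length_eq_of_colLen_eq h.2 h0.2 (funext fun j => congrFun h' (j + 1))
    simp [e1, e2]

/-- An entry of `d` to the right of the removed `b` would violate `hd`. -/
theorem Adj.left_of_concat {c d : List (Letter m n)} {b : Letter m n} (h : Adj (c ++ [b]) d)
    (hd : ∀ z ∈ d, ColLt z b) : Adj c d := by
  rcases h.split_left with h | ⟨d1, d2, rfl, -, h1, h2⟩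
  · exact h.2
  · cases d2 with
    | nil => simpa using h1
    | cons y d2 => exact absurd (hd y (by simp)) h2.1

theorem Adj.right_of_concat {c d : List (Letter m n)} {b : Letter m n} (h : Adj c (d ++ [b])) :
    Adj c d := by
  obtain ⟨l1, l2, rfl, -, h1, -⟩ := h.split_right
  exact h1.colIns_left_of_none _

/-- Removing the extreme box with the largest entry from a tableau. -/
theorem exists_corner {U : List (List (Letter m n))} (hU : IsTab U) (h0 : readCols U ≠ []) :
    ∃ (U₀ : List (List (Letter m n))) (j : ℕ) (b : Letter m n), IsTab U₀ ∧
      (readCols U).length = (readCols U₀).length + 1 ∧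
      (∀ a ∈ readCols U, a.val ≤ b.val) ∧ (∀ a ∈ readCols U₀, a.val ≤ b.val) ∧
      (∀ t ≤ b.val, restr t U₀ = restr t U) ∧
      (∀ i, colLen U i = colLen U₀ i + if i = j then 1 else 0) ∧
      ∀ i, colLen (restr b.val U₀) i < colLen U₀ i → if b.val < m then i < j else j ≤ i := by
  obtain ⟨b, hb, hmax⟩ : ∃ b ∈ readCols U, ∀ a ∈ readCols U, a.val ≤ b.val := by
    obtain ⟨b, hb, h⟩ := (readCols U).toFinset.exists_max_image (fun a => a.val)
      ⟨_, List.mem_toFinset.2 (List.head_mem h0)⟩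
    exact ⟨b, List.mem_toFinset.1 hb, fun a ha => h a (List.mem_toFinset.2 ha)⟩
  -- A barred `b` is removed from its rightmost column and an unbarred one from its leftmost column,
  -- since this is where the last box of a block lies by the row bumping rule.
  obtain ⟨L, d, L', rfl, hd, hLL⟩ : ∃ L d L', U = L ++ d :: L' ∧ b ∈ d ∧
      if b.val < m then ∀ x ∈ L', b ∉ x else ∀ x ∈ L, b ∉ x := by
    by_cases hm : b.val < m
    · simpa only [hm, if_true] using exists_last_split (P := fun x => b ∈ x) (mem_readCols.1 hb)
    · simpa only [hm, if_false] using exists_first_split (P := fun x => b ∈ x) (mem_readCols.1 hb)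
  obtain ⟨hL, hl, hc, hr, hL'⟩ := isTab_append_cons.1 hU
  obtain ⟨c, rfl⟩ : ∃ c, d = c ++ [b] := by
    rcases List.eq_nil_or_concat d with rfl | ⟨c, z, rfl⟩
    · simp at hd
    · rw [List.concat_eq_append] at *
      refine ⟨c, ?_⟩
      rw [List.mem_append, List.mem_singleton] at hd
      rcases hd with hd | rfl
      · have h1 := ((List.pairwise_append.1 hc).2.2 b hd z (by simp)).le
        have h2 := hmax z (mem_readCols.2 ⟨c ++ [z], by simp, by simp⟩)
        rw [Fin.ext (le_antisymm h1 h2)]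
      · rfl
  have hmax' : ∀ a ∈ readCols (L ++ c :: L'), a.val ≤ b.val := by
    intro a ha
    refine hmax a ?_
    simp only [readCols_append, readCols, List.mem_append] at ha ⊢
    tauto
  -- The column `c` may be empty now and is kept, so that the other columns do not move.
  refine ⟨L ++ c :: L', L.length, b, ?_, ?_, hmax, hmax', ?_, colLen_append_concat L L' c b, ?_⟩
  · refine isTab_append_cons.2 ⟨hL, fun l h => (hl l h).right_of_concat,
      (List.pairwise_append.1 hc).1, hr.left_of_concat fun z hz => ?_, hL'⟩
    have hz' : L'.headD [] ∈ L' := by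
      cases L' with
      | nil => simp at hz
      | cons => simp
    have h1 := hmax z (mem_readCols.2 ⟨L'.headD [], List.mem_append_right _ (List.mem_cons_of_mem _ hz'), hz⟩)
    unfold ColLt
    by_cases hm : b.val < m
    · rw [if_pos hm] at hLL
      have h2 : z ≠ b := fun e => hLL _ hz' (e ▸ hz)
      rw [Ne, Fin.ext_iff] at h2
      omega
    · omega
  · simp [readCols_append, readCols]; omega
  · intro t ht
    simp [restr, ht]
  · intro i hi
    rw [colLen_restr] at hi
    have hbi : b ∈ (L ++ c :: L').getD i [] := by
      by_contra hne
      refine hi.ne (congrArg List.length (List.filter_eq_self.2 fun a ha => ?_))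
      have h1 : a ∈ readCols (L ++ c :: L') := by
        refine mem_readCols.2 ⟨_, ?_, ha⟩
        by_cases hlt : i < (L ++ c :: L').length
        · rw [List.getD_eq_getElem _ _ hlt]; exact List.getElem_mem hlt
        · rw [List.getD_eq_default _ _ (by omega)] at ha; simp at ha
      have h2 := hmax' a h1
      have h3 : a ≠ b := fun e => hne (e ▸ ha)
      rw [Ne, Fin.ext_iff] at h3
      simp only [decide_eq_true_eq]; omega
    have hget : ∀ (K : List (List (Letter m n))) (i : ℕ), b ∈ K.getD i [] → ∃ x ∈ K, b ∈ x := by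
      intro K i h
      by_cases hlt : i < K.length
      · rw [List.getD_eq_getElem _ _ hlt] at h; exact ⟨_, List.getElem_mem hlt, h⟩
      · rw [List.getD_eq_default _ _ (by omega)] at h; simp at h
    split_ifs at hLL ⊢ with hm
    · by_contra hlt
      rw [List.getD_append_right _ _ _ _ (by omega)] at hbi
      obtain ⟨k, hk⟩ : ∃ k, i - L.length = k := ⟨_, rfl⟩
      rw [hk] at hbi
      cases k with
      | zero =>
        have := (List.pairwise_append.1 hc).2.2 b (by simpa using hbi) b (by simp)
        unfold ColLt at this; omega
      | succ k =>
        obtain ⟨x, hx, hbx⟩ := hget L' k (by simpa using hbi)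
        exact hLL x hx hbx
    · by_contra hlt
      rw [List.getD_append _ _ _ _ (by omega)] at hbi
      obtain ⟨x, hx, hbx⟩ := hget L i hbi
      exact hLL x hx hbx

theorem pairwise_concat_of_last {α : Type*} {R : α → α → Prop}
    (ht : ∀ a b c, R a b → R b c → R a c) {l : List α} {x y : α}
    (h : (l ++ [x]).Pairwise R) (hxy : R x y) : (l ++ [x] ++ [y]).Pairwise R := by
  refine List.pairwise_append.2 ⟨h, by simp, fun a ha b hb => ?_⟩
  rw [List.mem_singleton.1 hb]
  rcases List.mem_append.1 ha with ha | ha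
  · exact ht _ _ _ ((List.pairwise_append.1 h).2.2 a ha x (by simp)) hxy
  · rwa [List.mem_singleton.1 ha]

/-- Induction on the number of boxes: a corner with the largest entry `b` is removed from `U`, the
corresponding box is removed from `T` by reverse insertion, which ejects `x`, and `(x, b)` becomes
the last pair. No condition `[] ∉ U` is imposed, because removing corners can create empty columns.
-/
theorem exists_sorted {T U : List (List (Letter m n))} (hT : IsTab T) (h0 : [] ∉ T)
    (hU : IsTab U) (hs : colLen T = colLen U) :
    ∃ L : List (Letter m n × Letter m n), L.Pairwise BiLe ∧ pTab (L.map Prod.fst) = T ∧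
      ∀ t, prefixShape t L = colLen (restr t U) := by
  obtain ⟨N, hN⟩ : ∃ N, (readCols U).length = N := ⟨_, rfl⟩
  induction N generalizing T U with
  | zero =>
    have hz : ∀ V : List (List (Letter m n)), (readCols V).length = 0 → colLen V = fun _ => 0 := by
      intro V hV
      funext j
      by_contra hne
      have hj : j < V.length := by
        by_contra hlt
        exact hne (by rw [colLen, List.getD_eq_default _ _ (by omega)]; rfl)
      obtain ⟨a, ha⟩ := List.exists_mem_of_ne_nil (V.getD j []) fun e => hne (by rw [colLen, e]; rfl)
      rw [List.getD_eq_getElem _ _ hj] at ha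
      have := mem_readCols.2 ⟨_, List.getElem_mem hj, ha⟩
      rw [List.length_eq_zero_iff.1 hV] at this
      simp at this
    have hT0 : T = [] := by
      cases T with
      | nil => rfl
      | cons c T =>
        have := congrFun (hs.trans (hz U hN)) 0
        exact absurd (List.length_eq_zero_iff.1 this) fun e : c = [] => h0 (by simp [e])
    refine ⟨[], .nil, by rw [hT0]; rfl, fun t => ?_⟩
    rw [hz (restr t U)]
    · rfl
    · rw [readCols_restr, List.length_eq_zero_iff.1 hN]; rfl
  | succ N ih =>
    obtain ⟨U₀, j, b, hU0, hlen, hmax, hmax0, hres, hcol, hpos⟩ :=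
      exists_corner hU (fun e => by simp [e] at hN)
    obtain ⟨T₀, x, hT0, h00, rfl, hj⟩ := exists_ins j hT h0 (by
      rw [hs, hcol, hcol, if_pos rfl, if_neg (by omega)]
      have := hU0.colLen_succ_le j
      omega)
    have hs0 : colLen T₀ = colLen U₀ := by
      funext i
      have := congrFun hs i
      rw [colLen_ins, hj, hcol] at this
      omega
    obtain ⟨L, hL, hLT, hLs⟩ := ih hT0 h00 hU0 hs0 (by omega)
    -- The entries of `U₀` are at most `b`, so the prefix of `L` below `b + 1` already has the full
    -- shape. Counting boxes shows that this prefix is `L`.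
    have hbL : ∀ p ∈ L, p.2.val ≤ b.val := by
      have h1 := hLs (b.val + 1)
      rw [restr_eq_self fun a ha => Nat.lt_succ_of_le (hmax0 a ha), ← hs0, ← hLT, prefixShape] at h1
      have h2 := congrArg List.sum (map_length_eq_of_colLen_eq (nil_notMem_pTab _)
        (nil_notMem_pTab _) h1)
      rw [sum_colLen, sum_colLen, List.length_map, List.length_map] at h2
      intro p hp
      have := List.length_filter_eq_length_iff.1 h2 p hp
      simpa [Nat.lt_succ_iff] using this
    have hsort : (L ++ [(x, b)]).Pairwise BiLe := by
      rcases List.eq_nil_or_concat L with rfl | ⟨K, q, rfl⟩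
      · simp
      · rw [List.concat_eq_append] at *
        refine pairwise_concat_of_last BiLe.trans hL ?_
        rcases (hbL q (by simp)).lt_or_eq with hlt | heq
        · exact .inl hlt
        · have heq' : q.2 = b := Fin.ext heq
          refine .inr ⟨heq', ?_⟩
          have h1 := (prefixShape_last hL).1 (insCol (pTab (K.map Prod.fst)) q.1)
          have h2 := congrFun (hLs q.2.val) (insCol (pTab (K.map Prod.fst)) q.1)
          rw [prefixShape_concat_of_le le_rfl] at h2
          -- The box created by the previous pair `q` is occupied by `b` in `U₀`, so `hpos` fixes
          -- its side relative to `j`; the row bumping rule translates this into the order of `q.1`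
          -- and `x`.
          have h3 := hpos (insCol (pTab (K.map Prod.fst)) q.1) (by
            rw [← heq, ← h2, ← hs0, ← hLT, pTab_map_concat, colLen_ins, if_pos rfl]
            omega)
          have h4 := insCol_lt_insCol_ins (x := q.1) (y := x) (isTab_pTab (K.map Prod.fst))
          rw [← pTab_map_concat, hLT, hj] at h4
          rw [heq]
          split_ifs at h3 ⊢ with hm
          · exact h4.1 h3
          · exact not_not.1 fun h => absurd (h4.2 h) (by omega)
    have hfin : pTab ((L ++ [(x, b)]).map Prod.fst) = ins T₀ x := by rw [pTab_map_concat, hLT]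
    refine ⟨L ++ [(x, b)], hsort, hfin, fun t => ?_⟩
    by_cases ht : t ≤ b.val
    · rw [prefixShape_concat_of_le ht, hLs, hres t ht]
    · rw [prefixShape_concat_of_lt hsort (by simpa using ht), hfin, hs,
        restr_eq_self fun a ha => (hmax a ha).trans_lt (by omega)]

end Surjectivity

/-! ### Matrices and sorted biwords -/

section Matrices

variable {m n : ℕ}

/-- The letters in the order in which they occur in a block of the biword. -/
def blockOrder (b' : Letter m n) : List (Letter m n) :=
  if degree b' = 0 then (List.finRange (m + n)).reverse else List.finRange (m + n)

theorem degree_eq_zero {b : Letter m n} : degree b = 0 ↔ b.val < m := by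
  unfold degree; split_ifs <;> simp_all

theorem count_blockOrder (b b' : Letter m n) : (blockOrder b').count b = 1 := by
  have h := List.count_eq_one_of_mem (List.nodup_finRange (m + n)) (List.mem_finRange b)
  unfold blockOrder
  split_ifs
  · rw [List.count_reverse, h]
  · exact h

theorem count_flatMap_of_count_eq_one {α β : Type*} [DecidableEq α] [BEq β] [LawfulBEq β]
    {l : List α}
    {a : α} (h : l.count a = 1) {f : α → List β} {x : β} (hf : ∀ c ∈ l, c ≠ a → x ∉ f c) :
    (l.flatMap f).count x = (f a).count x := by
  induction l with
  | nil => simp at h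
  | cons c l ih =>
    rw [List.flatMap_cons, List.count_append]
    by_cases hc : c = a
    · subst hc
      rw [List.count_cons_self] at h
      have h' : c ∉ l := List.count_eq_zero.1 (by omega)
      rw [Nat.add_eq_left, List.count_eq_zero, List.mem_flatMap]
      rintro ⟨d, hd, hx⟩
      exact hf d (by simp [hd]) (fun e => h' (e ▸ hd)) hx
    · rw [List.count_cons_of_ne hc] at h
      rw [ih h fun d hd => hf d (by simp [hd]), List.count_eq_zero.2 (hf c (by simp) hc), zero_add]

theorem count_biword (A : Mat m n) (p : Letter m n × Letter m n) : (biword A).count p = A p.1 p.2 := by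
  have h := List.count_eq_one_of_mem (List.nodup_finRange (m + n)) (List.mem_finRange p.2)
  refine (count_flatMap_of_count_eq_one h ?_).trans
    ((count_flatMap_of_count_eq_one (count_blockOrder p.1 p.2) ?_).trans List.count_replicate_self)
  · intro c _ hc hx
    obtain ⟨d, _, hx⟩ := List.mem_flatMap.1 hx
    rw [List.eq_of_mem_replicate hx] at hc
    exact hc rfl
  · intro c _ hc hx
    rw [List.eq_of_mem_replicate hx] at hc
    exact hc rfl

/-- The bound on the entries with `|b| ≠ |b'|` is what allows sorting by `BiLe`: a pair may be
repeated only if `BiLe` relates it to itself. -/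
theorem pairwise_biword {A : Mat m n} (hA : A ∈ superMatrices m n) : (biword A).Pairwise BiLe := by
  have hlt : (List.finRange (m + n)).Pairwise (· < ·) := List.pairwise_lt_finRange _
  have hb : ∀ b' : Letter m n, (blockOrder b').Pairwise fun b c =>
      if b'.val < m then c < b else b < c := by
    intro b'
    unfold blockOrder
    simp only [degree_eq_zero]
    split_ifs with h
    · rwa [List.pairwise_reverse]
    · exact hlt
  unfold biword
  refine List.pairwise_flatMap.2 ⟨fun b' _ => ?_, hlt.imp fun {b' c'} h p hp q hq => ?_⟩
  · refine List.pairwise_flatMap.2 ⟨fun b _ => ?_, (hb b').imp fun {b c} h p hp q hq => ?_⟩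
    · rw [List.pairwise_replicate]
      have h := hA b b'
      unfold BiLe ColLt
      unfold degree at h
      split_ifs at h ⊢ <;> simp at h <;> simp <;> omega
    · rw [List.eq_of_mem_replicate hp, List.eq_of_mem_replicate hq]
      refine .inr ⟨rfl, ?_⟩
      rw [Fin.lt_def, Fin.lt_def] at h
      unfold ColLt
      split_ifs at h ⊢ <;> dsimp only at * <;> omega
  · obtain ⟨_, _, hp⟩ := List.mem_flatMap.1 hp
    obtain ⟨_, _, hq⟩ := List.mem_flatMap.1 hq
    rw [List.eq_of_mem_replicate hp, List.eq_of_mem_replicate hq]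
    exact .inl h

/-- The matrix of a biword. -/
def toMat (L : List (Letter m n × Letter m n)) : Mat m n := fun b b' => L.count (b, b')

theorem matrixOf_map (L : List (Letter m n × Letter m n)) :
    matrixOf (L.map Prod.fst) (L.map Prod.snd) = toMat L := by
  have h : (L.map Prod.fst).zip (L.map Prod.snd) = L := by
    rw [List.zip_map']
    exact List.map_id L
  funext b b'
  rw [matrixOf, h, toMat]

theorem toMat_biword (A : Mat m n) : toMat (biword A) = A := by
  funext b b'
  rw [toMat, count_biword]

theorem toMat_mem {L : List (Letter m n × Letter m n)} (h : L.Pairwise BiLe) :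
    toMat L ∈ superMatrices m n := by
  intro b b' hne
  by_contra hlt
  rw [not_le, toMat] at hlt
  have h1 : [(b, b'), (b, b')].Sublist L := by
    have := List.replicate_sublist_iff.2 (Nat.succ_le_of_lt hlt)
    simpa [List.replicate] using this
  have h2 : BiLe (b, b') (b, b') := by simpa using h.sublist h1
  unfold BiLe ColLt at h2
  unfold degree at hne
  split_ifs at hne h2 <;> simp at hne h2 <;> omega

theorem biword_toMat {L : List (Letter m n × Letter m n)} (h : L.Pairwise BiLe) :
    biword (toMat L) = L :=
  eq_of_count_eq (pairwise_biword (toMat_mem h)) h fun p => count_biword _ p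

theorem transpose_mem {A : Mat m n} (hA : A ∈ superMatrices m n) :
    A.transpose ∈ superMatrices m n := fun b b' h => hA b' b (Ne.symm h)

theorem dual_biword {A : Mat m n} (hA : A ∈ superMatrices m n) :
    Dual (biword A) (biword A.transpose) := by
  refine ⟨pairwise_biword hA, pairwise_biword (transpose_mem hA), List.perm_iff_count.2 fun p => ?_⟩
  rw [count_biword, ← Prod.swap_swap p, List.count_map_of_injective _ _ Prod.swap_injective,
    count_biword]
  rfl

/-- The insertion tableau of a matrix. -/
def matTab (A : Mat m n) : List (List (Letter m n)) := pTab (topWord A)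

theorem isTab_matTab (A : Mat m n) : IsTab (matTab A) := isTab_pTab _

theorem nil_notMem_matTab (A : Mat m n) : [] ∉ matTab A := nil_notMem_pTab _

theorem colLen_restr_matTab_transpose {A : Mat m n} (hA : A ∈ superMatrices m n) (t : ℕ) :
    colLen (restr t (matTab A.transpose)) = prefixShape t (biword A) :=
  (dual_biword hA).colLen_restr t

theorem matTab_injective {A B : Mat m n} (hA : A ∈ superMatrices m n) (hB : B ∈ superMatrices m n)
    (h : matTab A = matTab B) (h' : matTab A.transpose = matTab B.transpose) : A = B := by
  rw [← toMat_biword A, ← toMat_biword B]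
  refine congrArg toMat (eq_of_pTab_eq (pairwise_biword hA) (pairwise_biword hB) h fun t => ?_)
  rw [← colLen_restr_matTab_transpose hA, ← colLen_restr_matTab_transpose hB, h']

/-- `exists_sorted` realises `U` only through the shapes of its restrictions, and these identify `U`
with the insertion tableau of the transpose. -/
theorem exists_matTab {T U : List (List (Letter m n))} (hT : IsTab T) (hT0 : [] ∉ T) (hU : IsTab U)
    (hU0 : [] ∉ U) (h : colLen T = colLen U) :
    ∃ A ∈ superMatrices m n, matTab A = T ∧ matTab A.transpose = U := by
  obtain ⟨L, h1, h2, h3⟩ := exists_sorted hT hT0 hU h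
  refine ⟨toMat L, toMat_mem h1, ?_, ?_⟩
  · rw [matTab, topWord, biword_toMat h1, h2]
  · refine tab_eq_of_colLen_restr (isTab_matTab _) hU (nil_notMem_matTab _) hU0 fun t => ?_
    rw [colLen_restr_matTab_transpose (toMat_mem h1), biword_toMat h1, h3]

end Matrices

/-! ### The operators on matrices -/

section Operators

variable {m n : ℕ}

/-- The operators `f_i` and `e_i` on words, for `u = true` and `u = false` respectively. -/
def wordOp (u : Bool) (i : Index m n) : Word m n → Option (Word m n) :=
  if u then wordF i else wordE i

/-- The letter changed by `wordOp`. -/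
def opSrc (u : Bool) (i : Index m n) : Letter m n := if u then i.lo else i.hi

/-- The letter produced by `wordOp`. -/
def opTgt (u : Bool) (i : Index m n) : Letter m n := if u then i.hi else i.lo

/-- The number of times that `wordOp` may be applied. -/
def wordNum (u : Bool) (i : Index m n) : Word m n → ℕ := if u then wordPhi i else wordEps i

theorem wordOp_eq_some {u : Bool} {i : Index m n} {w w' : Word m n} : wordOp u i w = some w' ↔
    ∃ p s, w = p ++ opSrc u i :: s ∧ w' = p ++ opTgt u i :: s ∧ Good i p s := by
  cases u
  · exact wordE_eq_some
  · exact wordF_eq_some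

theorem wordOp_eq_none {u : Bool} {i : Index m n} {w : Word m n} :
    wordOp u i w = none ↔ wordNum u i w = 0 := by
  cases u
  · exact wordE_eq_none
  · exact wordF_eq_none

theorem wordNum_of_wordOp {u : Bool} {i : Index m n} {w w' : Word m n}
    (h : wordOp u i w = some w') : wordNum u i w' + 1 = wordNum u i w := by
  cases u
  · have := (wordE_spec h).1
    change wordEps i w' + 1 = wordEps i w
    omega
  · have := (wordF_spec h).2.1
    change wordPhi i w' + 1 = wordPhi i w
    omega

theorem exists_tab_of_wordOp {u : Bool} {i : Index m n} {T : List (List (Letter m n))} {w : Word m n}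
    (hT : IsTab T) (h0 : [] ∉ T) (h : wordOp u i (readCols T) = some w) :
    ∃ T', IsTab T' ∧ [] ∉ T' ∧ T'.map List.length = T.map List.length ∧ readCols T' = w := by
  cases u
  · exact exists_tab_of_wordE hT h0 h
  · exact exists_tab_of_wordF hT h0 h

theorem Knuth.wordOp {w w' : Word m n} (h : Knuth ColLt w w') (u : Bool) (i : Index m n) :
    Option.Rel (Knuth ColLt) (wordOp u i w) (wordOp u i w') := by
  cases u
  · exact (h.sameCrystal i).e
  · exact (h.sameCrystal i).f

/-- The operator takes the reading of `pTab w` to the reading of a tableau of the same shape, which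
lies in the plactic class of `w'` and is therefore `pTab w'`. -/
theorem wordOp_pTab {u : Bool} {i : Index m n} {w w' : Word m n} (h : wordOp u i w = some w') :
    wordOp u i (readCols (pTab w)) = some (readCols (pTab w')) ∧
      (pTab w').map List.length = (pTab w).map List.length := by
  obtain ⟨v, hv, hk⟩ := Option.Rel.exists_some ((knuth_readCols_pTab w).wordOp u i) h
  obtain ⟨T, hT, h0, hl, rfl⟩ := exists_tab_of_wordOp (isTab_pTab w) (nil_notMem_pTab w) hv
  rw [hk.pTab_eq, pTab_readCols hT h0]
  exact ⟨hv, hl⟩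

theorem wordOp_pTab_eq_none {u : Bool} {i : Index m n} {w : Word m n} :
    wordOp u i (readCols (pTab w)) = none ↔ wordOp u i w = none := by
  have h := (knuth_readCols_pTab w).wordOp u i
  revert h
  generalize wordOp u i (readCols (pTab w)) = a
  generalize wordOp u i w = b
  rintro (_ | _) <;> simp

theorem colLen_eq_of_map_length {T T' : List (List (Letter m n))}
    (h : T.map List.length = T'.map List.length) : colLen T = colLen T' := by
  have key : ∀ (T : List (List (Letter m n))) j, colLen T j = (T.map List.length).getD j 0 := by
    intro T j
    rw [show (0 : ℕ) = List.length ([] : List (Letter m n)) from rfl, List.getD_map]; rfl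
  funext j
  rw [key, key, h]

/-- The operators `f_i` and `e_i` on matrices, for `u = true` and `u = false` respectively. -/
def matOp (u : Bool) (i : Index m n) (A : Mat m n) : Option (Mat m n) :=
  (wordOp u i (topWord A)).map fun w => matrixOf w (bottomWord A)

/-- The operators `f_i^*` and `e_i^*`, for `u = true` and `u = false` respectively. -/
def matOpStar (u : Bool) (i : Index m n) (A : Mat m n) : Option (Mat m n) :=
  (wordOp u i (topWord A.transpose)).map fun l => matrixOf (bottomWord A.transpose) l

theorem matrixOf_comm (v w : Word m n) : matrixOf v w = (matrixOf w v).transpose := by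
  funext b b'
  change (v.zip w).count (b, b') = (w.zip v).count (b', b)
  rw [← List.zip_swap w v, ← Prod.swap_prod_mk,
    List.count_map_of_injective _ _ Prod.swap_injective]

theorem matOpStar_eq (u : Bool) (i : Index m n) (A : Mat m n) :
    matOpStar u i A = (matOp u i A.transpose).map Matrix.transpose := by
  rw [matOpStar, matOp, Option.map_map]
  congr 1
  funext l
  exact matrixOf_comm _ _

/-- Inside a block of equal second components the first components form a row or a column word, and
`Good` excludes the neighbours that the change could spoil. So the biword of the image needs no
sorting. -/
theorem pairwise_biLe_of_good {u : Bool} {i : Index m n} {b : Letter m n}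
    {K L : List (Letter m n × Letter m n)} (h : (K ++ (opSrc u i, b) :: L).Pairwise BiLe)
    (hg : Good i (K.map Prod.fst) (L.map Prod.fst)) :
    (K ++ (opTgt u i, b) :: L).Pairwise BiLe := by
  have h' := List.pairwise_append.1 h
  refine pairwise_replace BiLe.trans h (fun e he => ?_) (fun e he => ?_)
  · obtain ⟨K, rfl⟩ := List.getLast?_eq_some_iff.1 he
    rw [List.map_append, List.map_singleton] at hg
    rcases h'.2.2 e (by simp) _ List.mem_cons_self with h1 | ⟨h1, h2⟩
    · exact .inl h1
    · refine .inr ⟨h1, ?_⟩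
      cases u <;> simp only [opSrc, opTgt, if_true, if_false, Bool.false_eq_true] at h2 ⊢ <;>
        split_ifs at h2 ⊢
      · exact mt (i.colLt_mono _).1 h2
      · exact hg.colLt_lo h2
      · exact hg.not_colLt_hi h2
      · exact (i.colLt_mono _).1 h2
  · obtain ⟨L, rfl⟩ := List.head?_eq_some_iff.1 he
    rw [List.map_cons] at hg
    rcases (List.pairwise_cons.1 h'.2.1).1 e (by simp) with h1 | ⟨h1, h2⟩
    · exact .inl h1
    · refine .inr ⟨h1, ?_⟩
      dsimp only at h2 ⊢
      cases u <;> simp only [opSrc, opTgt, if_true, if_false, Bool.false_eq_true] at h2 ⊢ <;>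
        split_ifs at h2 ⊢
      · exact hg.not_colLt_lo h2
      · exact (i.colLt_mono _).2 h2
      · exact mt (i.colLt_mono _).2 h2
      · exact hg.colLt_hi h2

theorem matOp_eq_some {u : Bool} {i : Index m n} {A B : Mat m n} (hA : A ∈ superMatrices m n)
    (h : matOp u i A = some B) : B ∈ superMatrices m n ∧ ∃ K b L,
      biword A = K ++ (opSrc u i, b) :: L ∧ biword B = K ++ (opTgt u i, b) :: L ∧
      Good i (K.map Prod.fst) (L.map Prod.fst) := by
  obtain ⟨w, hw, rfl⟩ := Option.map_eq_some_iff.1 h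
  obtain ⟨p, s, h1, rfl, hg⟩ := wordOp_eq_some.1 hw
  obtain ⟨K, R, h2, rfl, h3⟩ := List.map_eq_append_iff.1 h1
  obtain ⟨⟨a, b⟩, L, rfl, h4, rfl⟩ := List.map_eq_cons_iff.1 h3
  change a = _ at h4
  subst h4
  have hs := pairwise_biword hA
  rw [h2] at hs
  have hs' := pairwise_biLe_of_good hs hg
  have e : matrixOf (K.map Prod.fst ++ opTgt u i :: L.map Prod.fst) (bottomWord A) =
      toMat (K ++ (opTgt u i, b) :: L) := by
    rw [← matrixOf_map, bottomWord, h2]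
    simp
  rw [e]
  exact ⟨toMat_mem hs', K, b, L, h2, biword_toMat hs', hg⟩

theorem exists_eq_filter_append {L : List (Letter m n × Letter m n)} (h : L.Pairwise BiLe) (t : ℕ) :
    ∃ R, L = (L.filter fun p => decide (p.2.val < t)) ++ R := by
  induction L with
  | nil => exact ⟨[], rfl⟩
  | cons a L ih =>
    obtain ⟨h1, h2⟩ := List.pairwise_cons.1 h
    by_cases ha : a.2.val < t
    · obtain ⟨R, hR⟩ := ih h2
      refine ⟨R, ?_⟩
      rw [List.filter_cons_of_pos (by simpa using ha), List.cons_append, ← hR]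
    · refine ⟨a :: L, ?_⟩
      rw [List.filter_eq_nil_iff.2, List.nil_append]
      intro p hp
      have : a.2.val ≤ p.2.val := by
        rcases List.mem_cons.1 hp with rfl | hp
        · exact le_rfl
        · exact (h1 p hp).snd_le
      simp only [decide_eq_true_eq]; omega

/-- A prefix of the biword either misses the changed pair, or contains it; in the latter case the
operator acts on the prefix at the same place, by `Good.of_append`, and preserves its shape. -/
theorem prefixShape_of_good {u : Bool} {i : Index m n} {b : Letter m n}
    {K L : List (Letter m n × Letter m n)} (h : (K ++ (opSrc u i, b) :: L).Pairwise BiLe)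
    (hg : Good i (K.map Prod.fst) (L.map Prod.fst)) (t : ℕ) :
    prefixShape t (K ++ (opTgt u i, b) :: L) = prefixShape t (K ++ (opSrc u i, b) :: L) := by
  have h' := List.pairwise_append.1 h
  by_cases ht : b.val < t
  · obtain ⟨R, hR⟩ := exists_eq_filter_append (List.pairwise_cons.1 h'.2.1).2 t
    have hK : K.filter (fun p => decide (p.2.val < t)) = K := by
      rw [List.filter_eq_self]
      intro p hp
      have : p.2.val ≤ b.val := (h'.2.2 p hp _ List.mem_cons_self).snd_le
      simp only [decide_eq_true_eq]; omega
    rw [hR, List.map_append] at hg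
    have hg' := Good.of_append (u := []) hg
    refine colLen_eq_of_map_length (wordOp_pTab (u := u) (i := i) (wordOp_eq_some.2
      ⟨K.map Prod.fst, _, ?_, ?_, hg'⟩)).2
    · rw [List.filter_append, hK, List.filter_cons_of_pos (by simpa using ht), List.map_append,
        List.map_cons]
    · rw [List.filter_append, hK, List.filter_cons_of_pos (by simpa using ht), List.map_append,
        List.map_cons]
  · simp [prefixShape, ht]

theorem matTab_of_matOp {u : Bool} {i : Index m n} {A B : Mat m n} (hA : A ∈ superMatrices m n)
    (h : matOp u i A = some B) :
    wordOp u i (readCols (matTab A)) = some (readCols (matTab B)) ∧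
      matTab B.transpose = matTab A.transpose := by
  obtain ⟨hB, K, b, L, h1, h2, hg⟩ := matOp_eq_some hA h
  constructor
  · refine (wordOp_pTab (wordOp_eq_some.2 ⟨K.map Prod.fst, L.map Prod.fst, ?_, ?_, hg⟩)).1
    · rw [topWord, h1]; simp
    · rw [topWord, h2]; simp
  · refine tab_eq_of_colLen_restr (isTab_matTab _) (isTab_matTab _) (nil_notMem_matTab _)
      (nil_notMem_matTab _) fun t => ?_
    rw [colLen_restr_matTab_transpose hA, colLen_restr_matTab_transpose hB, h1, h2]
    refine prefixShape_of_good ?_ hg t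
    rw [← h1]
    exact pairwise_biword hA

theorem readCols_injective {T U : List (List (Letter m n))} (hT : IsTab T) (hT0 : [] ∉ T)
    (hU : IsTab U) (hU0 : [] ∉ U) (h : readCols T = readCols U) : T = U := by
  rw [← pTab_readCols hT hT0, h, pTab_readCols hU hU0]

theorem matTab_eq_of_readCols {A B : Mat m n} (h : readCols (matTab A) = readCols (matTab B)) :
    matTab A = matTab B :=
  readCols_injective (isTab_matTab _) (nil_notMem_matTab _) (isTab_matTab _) (nil_notMem_matTab _) h

theorem exists_matOp {u : Bool} {i : Index m n} {A : Mat m n}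
    (h : wordOp u i (readCols (matTab A)) ≠ none) : ∃ B, matOp u i A = some B := by
  rw [matTab, Ne, wordOp_pTab_eq_none] at h
  obtain ⟨w, hw⟩ := Option.ne_none_iff_exists'.1 h
  exact ⟨_, by rw [matOp, hw]; rfl⟩

/-- The operators on matrices act on the insertion tableau and fix the recording tableau. -/
theorem matOp_eq_some_iff {u : Bool} {i : Index m n} {A B : Mat m n} (hA : A ∈ superMatrices m n) :
    matOp u i A = some B ↔ B ∈ superMatrices m n ∧
      wordOp u i (readCols (matTab A)) = some (readCols (matTab B)) ∧
      matTab B.transpose = matTab A.transpose := by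
  refine ⟨fun h => ⟨(matOp_eq_some hA h).1, matTab_of_matOp hA h⟩, fun ⟨hB, h1, h2⟩ => ?_⟩
  obtain ⟨C, hC⟩ := exists_matOp (u := u) (i := i) (A := A) (by rw [h1]; simp)
  obtain ⟨h3, h4⟩ := matTab_of_matOp hA hC
  rw [h1, Option.some_inj] at h3
  rw [hC, matTab_injective (matOp_eq_some hA hC).1 hB (matTab_eq_of_readCols h3.symm)
    (h4.trans h2.symm)]

/-- Transposition exchanges the insertion and the recording tableau, so this is `matOp_eq_some_iff`
for the transposed matrix. -/
theorem matOpStar_eq_some_iff {u : Bool} {i : Index m n} {A B : Mat m n}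
    (hA : A ∈ superMatrices m n) :
    matOpStar u i A = some B ↔ B ∈ superMatrices m n ∧
      wordOp u i (readCols (matTab A.transpose)) = some (readCols (matTab B.transpose)) ∧
      matTab B = matTab A := by
  have h : matOpStar u i A = some B ↔ matOp u i A.transpose = some B.transpose := by
    rw [matOpStar_eq, Option.map_eq_some_iff]
    constructor
    · rintro ⟨C, h, rfl⟩; rwa [Matrix.transpose_transpose]
    · exact fun h => ⟨_, h, Matrix.transpose_transpose _⟩
  rw [h, matOp_eq_some_iff (transpose_mem hA), Matrix.transpose_transpose,
    Matrix.transpose_transpose]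
  have h' : B.transpose ∈ superMatrices m n ↔ B ∈ superMatrices m n :=
    ⟨fun h => by simpa using transpose_mem h, transpose_mem⟩
  rw [h']

theorem exists_matOpStar {u : Bool} {i : Index m n} {A : Mat m n}
    (h : wordOp u i (readCols (matTab A.transpose)) ≠ none) : ∃ B, matOpStar u i A = some B := by
  obtain ⟨B, hB⟩ := exists_matOp h
  exact ⟨B.transpose, by rw [matOpStar_eq, hB]; rfl⟩

theorem matOpStar_bind_matOp {u : Bool} {i : Index m n} {A B : Mat m n}
    (hA : A ∈ superMatrices m n) :
    (matOpStar u i A).bind (matOp u i) = some B ↔ B ∈ superMatrices m n ∧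
      wordOp u i (readCols (matTab A)) = some (readCols (matTab B)) ∧
      wordOp u i (readCols (matTab A.transpose)) = some (readCols (matTab B.transpose)) := by
  rw [Option.bind_eq_some_iff]
  constructor
  · rintro ⟨C, h1, h2⟩
    obtain ⟨hC, h3, h4⟩ := (matOpStar_eq_some_iff hA).1 h1
    obtain ⟨hB, h5, h6⟩ := (matOp_eq_some_iff hC).1 h2
    exact ⟨hB, by rw [← h4, h5], by rw [h3, h6]⟩
  · rintro ⟨hB, h1, h2⟩
    obtain ⟨C, hC'⟩ := exists_matOpStar (u := u) (i := i) (A := A) (by rw [h2]; simp)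
    obtain ⟨hC, h3, h4⟩ := (matOpStar_eq_some_iff hA).1 hC'
    refine ⟨C, hC', (matOp_eq_some_iff hC).2 ⟨hB, by rw [h4, h1], matTab_eq_of_readCols ?_⟩⟩
    rw [h3, Option.some_inj] at h2
    exact h2.symm

theorem matOp_bind_matOpStar {u : Bool} {i : Index m n} {A B : Mat m n}
    (hA : A ∈ superMatrices m n) :
    (matOp u i A).bind (matOpStar u i) = some B ↔ B ∈ superMatrices m n ∧
      wordOp u i (readCols (matTab A)) = some (readCols (matTab B)) ∧
      wordOp u i (readCols (matTab A.transpose)) = some (readCols (matTab B.transpose)) := by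
  rw [Option.bind_eq_some_iff]
  constructor
  · rintro ⟨C, h1, h2⟩
    obtain ⟨hC, h3, h4⟩ := (matOp_eq_some_iff hA).1 h1
    obtain ⟨hB, h5, h6⟩ := (matOpStar_eq_some_iff hC).1 h2
    exact ⟨hB, by rw [h3, h6], by rw [← h4, h5]⟩
  · rintro ⟨hB, h1, h2⟩
    obtain ⟨C, hC'⟩ := exists_matOp (u := u) (i := i) (A := A) (by rw [h1]; simp)
    obtain ⟨hC, h3, h4⟩ := (matOp_eq_some_iff hA).1 hC'
    refine ⟨C, hC', (matOpStar_eq_some_iff hC).2 ⟨hB, by rw [h4, h2], matTab_eq_of_readCols ?_⟩⟩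
    rw [h3, Option.some_inj] at h1
    exact h1.symm

/-- Both composites amount to applying the word operator to each of the two tableaux, independently.
-/
theorem matOpStar_bind_matOp_comm (u : Bool) (i : Index m n) {A : Mat m n}
    (hA : A ∈ superMatrices m n) :
    (matOpStar u i A).bind (matOp u i) = (matOp u i A).bind (matOpStar u i) := by
  ext B
  rw [matOpStar_bind_matOp hA, matOp_bind_matOpStar hA]

/-- The diagonal operators `𝐟_i` and `𝐞_i`, for `u = true` and `u = false` respectively. -/
def diagOp (u : Bool) (i : Index m n) (A : Mat m n) : Option (Mat m n) :=
  (matOpStar u i A).bind (matOp u i)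

/-- The pairs of tableaux of `A` and of its transpose are interchanged, so they coincide if the two
tableaux are equal. -/
theorem eq_transpose_of_matTab {A : Mat m n} (hA : A ∈ superMatrices m n)
    (h : matTab A.transpose = matTab A) : A ∈ symmetricMatrices m n :=
  ⟨hA, matTab_injective (transpose_mem hA) hA h (by rw [Matrix.transpose_transpose, h])⟩

theorem diagOp_eq_some_iff {u : Bool} {i : Index m n} {A B : Mat m n}
    (hA : A ∈ symmetricMatrices m n) :
    diagOp u i A = some B ↔ B ∈ symmetricMatrices m n ∧
      wordOp u i (readCols (matTab A)) = some (readCols (matTab B)) := by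
  rw [diagOp, matOpStar_bind_matOp hA.1, hA.2]
  constructor
  · rintro ⟨hB, h1, h2⟩
    rw [h1, Option.some_inj] at h2
    exact ⟨eq_transpose_of_matTab hB (matTab_eq_of_readCols h2.symm), h1⟩
  · rintro ⟨hB, h1⟩
    exact ⟨hB.1, h1, by rw [hB.2, h1]⟩

theorem exists_symmetric {T : List (List (Letter m n))} (hT : IsTab T) (h0 : [] ∉ T) :
    ∃ A ∈ symmetricMatrices m n, matTab A = T := by
  obtain ⟨A, hA, h1, h2⟩ := exists_matTab hT h0 hT h0 rfl
  exact ⟨A, eq_transpose_of_matTab hA (h2.trans h1.symm), h1⟩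

theorem diagOp_eq_none_iff {u : Bool} {i : Index m n} {A : Mat m n}
    (hA : A ∈ symmetricMatrices m n) :
    diagOp u i A = none ↔ wordOp u i (readCols (matTab A)) = none := by
  rw [← not_iff_not, ← Ne, ← Ne, Option.ne_none_iff_exists', Option.ne_none_iff_exists']
  constructor
  · rintro ⟨B, hB⟩
    exact ⟨_, ((diagOp_eq_some_iff hA).1 hB).2⟩
  · rintro ⟨w, hw⟩
    obtain ⟨T, hT, h0, -, rfl⟩ := exists_tab_of_wordOp (isTab_matTab A) (nil_notMem_matTab A) hw
    obtain ⟨B, hB, rfl⟩ := exists_symmetric hT h0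
    exact ⟨B, (diagOp_eq_some_iff hA).2 ⟨hB, hw⟩⟩

/-- `N` drops by one along `x` and vanishes where `x` is undefined, so exactly the powers up to `N
a` survive. -/
theorem powersNeZero_eq {B : Type} {x : B → Option B} {N : B → ℕ} {S : Set B}
    (h0 : ∀ a ∈ S, x a = none → N a = 0)
    (h1 : ∀ a ∈ S, ∀ b, x a = some b → b ∈ S ∧ N b + 1 = N a) {a : B} (ha : a ∈ S) :
    powersNeZero x a = Set.Iic (N a) := by
  ext k
  induction k generalizing a with
  | zero => simp [powersNeZero]
  | succ k ih =>
    have e : k + 1 ∈ powersNeZero x a ↔ (fun y : Option B => y.bind x)^[k] (x a) ≠ none := Iff.rfl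
    rw [e]
    cases hx : x a with
    | none =>
      rw [h0 a ha hx, Set.mem_Iic, Function.iterate_fixed rfl]
      simp
    | some b =>
      obtain ⟨hb, hN⟩ := h1 a ha b hx
      have := ih hb
      rw [Set.mem_Iic] at this ⊢
      rw [← hN, Nat.succ_le_succ_iff, ← this]
      rfl

theorem powersNeZero_diagOp (u : Bool) (i : Index m n) {A : Mat m n}
    (hA : A ∈ symmetricMatrices m n) :
    powersNeZero (diagOp u i) A = Set.Iic (wordNum u i (readCols (matTab A))) := by
  refine powersNeZero_eq (N := fun A => wordNum u i (readCols (matTab A)))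
    (fun A hA h => ?_) (fun A hA B h => ?_) hA
  · rw [diagOp_eq_none_iff hA] at h
    exact wordOp_eq_none.1 h
  · have := (diagOp_eq_some_iff hA).1 h
    exact ⟨this.1, wordNum_of_wordOp this.2⟩

theorem sSup_powersNeZero (u : Bool) (i : Index m n) {A : Mat m n}
    (hA : A ∈ symmetricMatrices m n) :
    sSup (powersNeZero (diagOp u i) A) = wordNum u i (readCols (matTab A)) := by
  rw [powersNeZero_diagOp u i hA, csSup_Iic]

theorem wordWt_matTab (A : Mat m n) : wordWt (topWord A) = wordWt (readCols (matTab A)) :=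
  (knuth_readCols_pTab _).wordWt_eq

end Operators

/-! ### Shapes and fillings of Young diagrams -/

section Shapes

variable {m n : ℕ}

/-- The Young diagram of a tableau. -/
def shape (T : List (List (Letter m n))) (hT : IsTab T) : YoungDiagram where
  cells := (Finset.range (colLen T 0) ×ˢ Finset.range T.length).filter fun c => c.1 < colLen T c.2
  isLowerSet := by
    rintro ⟨a, b⟩ ⟨c, d⟩ ⟨h1, h2⟩ h
    dsimp only at h1 h2
    simp only [Finset.coe_filter, Finset.mem_product, Finset.mem_range, Set.mem_ofPred_eq] at h ⊢
    have := hT.colLen_antitone h2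
    omega

theorem lt_length_of_lt_colLen {T : List (List (Letter m n))} {i j : ℕ} (h : i < colLen T j) :
    j < T.length := by
  by_contra hlt
  rw [colLen, List.getD_eq_default _ _ (by omega)] at h
  simp at h

theorem colLen_shape {T : List (List (Letter m n))} (hT : IsTab T) :
    (shape T hT).colLen = colLen T := by
  funext j
  refine eq_of_forall_lt_iff fun i => ?_
  rw [← YoungDiagram.mem_iff_lt_colLen, ← YoungDiagram.mem_cells]
  simp only [shape, Finset.mem_filter, Finset.mem_product, Finset.mem_range, and_iff_right_iff_imp]
  intro h
  exact ⟨h.trans_le (hT.colLen_antitone (Nat.zero_le j)), lt_length_of_lt_colLen h⟩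

theorem youngDiagram_eq_of_colLen {μ ν : YoungDiagram} (h : μ.colLen = ν.colLen) : μ = ν := by
  ext ⟨i, j⟩
  rw [YoungDiagram.mem_cells, YoungDiagram.mem_cells, YoungDiagram.mem_iff_lt_colLen,
    YoungDiagram.mem_iff_lt_colLen, h]

theorem IsTab.isColumn_getD {T : List (List (Letter m n))} (h : IsTab T) (j : ℕ) :
    IsColumn (T.getD j []) := by
  by_cases hj : j < T.length
  · rw [List.getD_eq_getElem _ _ hj]; exact h.isColumn _ (List.getElem_mem hj)
  · rw [List.getD_eq_default _ _ (by omega)]; exact .nil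

theorem IsTab.adj_getD_succ : ∀ {T : List (List (Letter m n))}, IsTab T → ∀ j,
    Adj (T.getD j []) (T.getD (j + 1) [])
  | [], _, _ => trivial
  | [_], h, 0 => h.2.1
  | _ :: _ :: _, h, 0 => h.2.1
  | c :: T, h, j + 1 => by simpa using h.2.2.adj_getD_succ j

theorem IsTab.adj_getD {T : List (List (Letter m n))} (h : IsTab T) {j k : ℕ} (hjk : j < k) :
    Adj (T.getD j []) (T.getD k []) := by
  induction k, hjk using Nat.le_induction with
  | base => exact h.adj_getD_succ j
  | succ k _ ih => exact ih.trans (h.adj_getD_succ k)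

theorem isTab_of_getD : ∀ {T : List (List (Letter m n))}, (∀ j, IsColumn (T.getD j [])) →
    (∀ j, Adj (T.getD j []) (T.getD (j + 1) [])) → IsTab T
  | [], _, _ => trivial
  | [_], h, _ => ⟨h 0, adj_nil _, trivial⟩
  | _ :: _ :: _, h, h' => ⟨h 0, h' 0, isTab_of_getD (fun j => h (j + 1)) fun j => h' (j + 1)⟩

theorem adj_of_getElem : ∀ {c d : List (Letter m n)} (hl : d.length ≤ c.length),
    (∀ r (h : r < d.length), ¬ ColLt (d)[r] (c)[r]) → Adj c d
  | _, [], _, _ => adj_nil _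
  | [], _ :: _, hl, _ => by simp at hl
  | _ :: _, _ :: _, hl, h => ⟨h 0 (by simp), adj_of_getElem (by simpa using hl) fun r hr =>
      h (r + 1) (by simpa using hr)⟩

theorem IsColumn.le_getElem {c : List (Letter m n)} (hc : IsColumn c) :
    ∀ k (h : k < c.length), min k m ≤ ((c)[k]).val
  | 0, _ => by simp
  | k + 1, h => by
    have h1 := hc.le_getElem k (by omega)
    have h2 := List.pairwise_iff_getElem.1 hc k (k + 1) (by omega) h (by omega)
    unfold ColLt at h2
    omega

/-- A column holds at most `m` barred letters, so its entry in row `m` is unbarred; unbarred letters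
strictly increase along this row. -/
theorem IsTab.add_le_getElem {T : List (List (Letter m n))} (hT : IsTab T) :
    ∀ j (h : m < (T.getD j []).length), m + j ≤ ((T.getD j [])[m]).val
  | 0, h => by simpa using (hT.isColumn_getD 0).le_getElem m h
  | j + 1, h => by
    have ha := hT.adj_getD_succ j
    have h1 := hT.add_le_getElem j (h.trans_le ha.length_le)
    have h2 := ha.not_colLt (List.getElem?_eq_getElem h)
      (List.getElem?_eq_getElem (h.trans_le ha.length_le))
    unfold ColLt at h2
    omega

/-- A box in row `m` and column `n` would need an entry of value at least `m + n`, beyond the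
alphabet. -/
theorem rowLen_shape_le {T : List (List (Letter m n))} (hT : IsTab T) :
    (shape T hT).rowLen m ≤ n := by
  by_contra hlt
  have h1 : (m, n) ∈ shape T hT := YoungDiagram.mem_iff_lt_rowLen.2 (not_le.1 hlt)
  rw [YoungDiagram.mem_iff_lt_colLen, colLen_shape] at h1
  have h2 := hT.add_le_getElem n h1
  have h3 := ((T.getD n [])[m]'h1).isLt
  omega

theorem lt_rowLen_zero_iff {μ : YoungDiagram} {j : ℕ} : j < μ.rowLen 0 ↔ 0 < μ.colLen j := by
  rw [← YoungDiagram.mem_iff_lt_rowLen, ← YoungDiagram.mem_iff_lt_colLen]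

theorem readCols_map {ι : Type*} (l : List ι) (f : ι → List (Letter m n)) :
    readCols (l.map f) = l.reverse.flatMap f := by
  induction l with
  | nil => rfl
  | cons a l ih => simp [readCols, ih]

/-- The columns of a filling. -/
def columns {μ : YoungDiagram} (F : {c // c ∈ μ} → Letter m n) : List (List (Letter m n)) :=
  (List.range (μ.rowLen 0)).map fun j =>
    List.ofFn fun k : Fin (μ.colLen j) => F ⟨(k.val, j), μ.mem_iff_lt_colLen.2 k.isLt⟩

theorem readCols_columns {μ : YoungDiagram} (F : {c // c ∈ μ} → Letter m n) :
    readCols (columns F) = columnReading μ F := readCols_map _ _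

theorem getD_columns {μ : YoungDiagram} (F : {c // c ∈ μ} → Letter m n) (j : ℕ) :
    (columns F).getD j [] =
      List.ofFn fun k : Fin (μ.colLen j) => F ⟨(k.val, j), μ.mem_iff_lt_colLen.2 k.isLt⟩ := by
  by_cases hj : j < μ.rowLen 0
  · rw [List.getD_eq_getElem _ _ (by simpa [columns] using hj)]
    simp [columns]
  · rw [List.getD_eq_default _ _ (by simpa [columns] using hj)]
    rw [lt_rowLen_zero_iff] at hj
    refine (List.length_eq_zero_iff.1 ?_).symm
    rw [List.length_ofFn]; omega

theorem colLen_columns {μ : YoungDiagram} (F : {c // c ∈ μ} → Letter m n) :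
    colLen (columns F) = μ.colLen := by
  funext j
  rw [colLen, getD_columns, List.length_ofFn]

theorem nil_notMem_columns {μ : YoungDiagram} (F : {c // c ∈ μ} → Letter m n) :
    [] ∉ columns F := by
  intro h
  obtain ⟨j, hj, h⟩ := List.mem_map.1 h
  have := congrArg List.length h
  rw [List.length_ofFn] at this
  have := lt_rowLen_zero_iff.1 (List.mem_range.1 hj)
  simp at *
  omega

theorem degree_eq_one {b : Letter m n} : degree b = 1 ↔ m ≤ b.val := by
  unfold degree; split_ifs <;> simp <;> omega

theorem isHookSemistandard_iff {μ : YoungDiagram} {F : {c // c ∈ μ} → Letter m n} :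
    IsHookSemistandard μ F ↔
      (∀ c d, c.val.2 = d.val.2 → c.val.1 < d.val.1 → ColLt (F c) (F d)) ∧
      ∀ c d, c.val.1 = d.val.1 → c.val.2 < d.val.2 → ¬ ColLt (F d) (F c) := by
  constructor
  · refine fun h => ⟨fun c d h1 h2 => ?_, fun c d h1 h2 => ?_⟩
    · have h3 := h.col_weak c d h1 h2
      have h4 := h.col_strict c d h1 h2
      rw [degree_eq_zero, degree_eq_zero, Fin.lt_def] at h4
      rw [Fin.le_def] at h3
      unfold ColLt; omega
    · have h3 := h.row_weak c d h1 h2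
      have h4 := h.row_strict c d h1 h2
      rw [degree_eq_one, degree_eq_one, Fin.lt_def] at h4
      rw [Fin.le_def] at h3
      unfold ColLt; omega
  · rintro ⟨h, h'⟩
    unfold ColLt at h h'
    constructor
    · intro c d h1 h2
      have := h' c d h1 h2
      rw [Fin.le_def]; omega
    · intro c d h1 h2
      have := h c d h1 h2
      rw [Fin.le_def]; omega
    · intro c d h1 h2
      have := h c d h1 h2
      rw [degree_eq_zero, degree_eq_zero, Fin.lt_def]; omega
    · intro c d h1 h2
      have := h' c d h1 h2
      rw [degree_eq_one, degree_eq_one, Fin.lt_def]; omega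

theorem isTab_columns {μ : YoungDiagram} {F : {c // c ∈ μ} → Letter m n}
    (h : IsHookSemistandard μ F) : IsTab (columns F) := by
  obtain ⟨h1, h2⟩ := isHookSemistandard_iff.1 h
  refine isTab_of_getD (fun j => ?_) fun j => ?_
  · rw [getD_columns]
    exact List.pairwise_ofFn.2 fun a b hab => h1 _ _ rfl hab
  · rw [getD_columns, getD_columns]
    refine adj_of_getElem ?_ fun r hr => ?_
    · rw [List.length_ofFn, List.length_ofFn]
      exact μ.colLen_anti _ _ (Nat.le_succ j)
    · rw [List.getElem_ofFn, List.getElem_ofFn]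
      exact h2 _ _ rfl (Nat.lt_succ_self j)

theorem exists_filling {μ : YoungDiagram} {T : List (List (Letter m n))} (hT : IsTab T)
    (h0 : [] ∉ T) (hs : colLen T = μ.colLen) :
    ∃ F : {c // c ∈ μ} → Letter m n, IsHookSemistandard μ F ∧ columnReading μ F = readCols T := by
  have hlt : ∀ c : {c // c ∈ μ}, c.val.1 < (T.getD c.val.2 []).length := by
    rintro ⟨⟨i, j⟩, h⟩
    rw [YoungDiagram.mem_iff_lt_colLen, ← hs] at h
    exact h
  refine ⟨fun c => (T.getD c.val.2 [])[c.val.1]'(hlt c), ?_, ?_⟩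
  · refine isHookSemistandard_iff.2 ⟨?_, ?_⟩
    · rintro ⟨⟨i, j⟩, h⟩ ⟨⟨i', j'⟩, h'⟩ (rfl : j = j') h2
      exact List.pairwise_iff_getElem.1 (hT.isColumn_getD j) _ _ _ _ h2
    · rintro ⟨⟨i, j⟩, h⟩ ⟨⟨i', j'⟩, h'⟩ (rfl : i = i') h2
      exact (hT.adj_getD h2).not_colLt (List.getElem?_eq_getElem (hlt ⟨_, h'⟩))
        (List.getElem?_eq_getElem (hlt ⟨_, h⟩))
  · rw [← readCols_columns]
    congr 1
    have hlen : μ.rowLen 0 = T.length := by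
      refine eq_of_forall_lt_iff fun j => ?_
      rw [lt_rowLen_zero_iff, ← hs]
      refine ⟨lt_length_of_lt_colLen, fun hj => ?_⟩
      rw [colLen, List.getD_eq_getElem _ _ hj, List.length_pos_iff]
      exact fun e => h0 (e ▸ List.getElem_mem hj)
    refine List.ext_getElem (by simp [columns, hlen]) fun j h1 h2 => ?_
    have h3 := getD_columns (fun c : {c // c ∈ μ} => (T.getD c.val.2 [])[c.val.1]'(hlt c)) j
    rw [List.getD_eq_getElem _ _ h1] at h3
    rw [h3]
    refine List.ext_getElem ?_ fun k h4 h5 => ?_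
    · rw [List.length_ofFn, ← hs, colLen, List.getD_eq_getElem _ _ h2]
    · simp [h2]

theorem mem_tableauWords {μ : YoungDiagram} {w : Word m n} : w ∈ tableauWords m n μ ↔
    ∃ T : List (List (Letter m n)), IsTab T ∧ [] ∉ T ∧ colLen T = μ.colLen ∧ readCols T = w := by
  constructor
  · rintro ⟨F, hF, rfl⟩
    exact ⟨columns F, isTab_columns hF, nil_notMem_columns F, colLen_columns F, readCols_columns F⟩
  · rintro ⟨T, hT, h0, hs, rfl⟩
    exact exists_filling hT h0 hs

theorem mem_tableauWords_of_wordOp {u : Bool} {i : Index m n} {μ : YoungDiagram} {w w' : Word m n}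
    (hw : w ∈ tableauWords m n μ) (h : wordOp u i w = some w') : w' ∈ tableauWords m n μ := by
  obtain ⟨T, hT, h0, hs, rfl⟩ := mem_tableauWords.1 hw
  obtain ⟨T', hT', h0', hl, rfl⟩ := exists_tab_of_wordOp hT h0 h
  exact mem_tableauWords.2 ⟨T', hT', h0', (colLen_eq_of_map_length hl).trans hs, rfl⟩

theorem isCrystalOn_tableauWords (μ : YoungDiagram) :
    IsCrystalOn (wordMaps m n) (tableauWords m n μ) :=
  isCrystalOn_wordMaps (fun _ _ hw _ h => mem_tableauWords_of_wordOp (u := false) hw h)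
    fun _ _ hw _ h => mem_tableauWords_of_wordOp (u := true) hw h

end Shapes

/-! ### The crystal of symmetric matrices -/

section Diagonal

variable {m n : ℕ}

/-- The word attached to a symmetric matrix. -/
def matWord (A : Mat m n) : Word m n := readCols (matTab A)

theorem diagonalMaps_wt (A : Mat m n) : (diagonalMaps m n).wt A = wordWt (matWord A) :=
  wordWt_matTab A

theorem diagonalMaps_eps (i : Index m n) {A : Mat m n} (hA : A ∈ symmetricMatrices m n) :
    (diagonalMaps m n).eps i A = wordEps i (matWord A) := sSup_powersNeZero false i hA

theorem diagonalMaps_phi (i : Index m n) {A : Mat m n} (hA : A ∈ symmetricMatrices m n) :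
    (diagonalMaps m n).phi i A = wordPhi i (matWord A) := sSup_powersNeZero true i hA

theorem diagE_eq_some_iff {i : Index m n} {A B : Mat m n} (hA : A ∈ symmetricMatrices m n) :
    diagE i A = some B ↔ B ∈ symmetricMatrices m n ∧ wordE i (matWord A) = some (matWord B) :=
  diagOp_eq_some_iff (u := false) hA

theorem diagF_eq_some_iff {i : Index m n} {A B : Mat m n} (hA : A ∈ symmetricMatrices m n) :
    diagF i A = some B ↔ B ∈ symmetricMatrices m n ∧ wordF i (matWord A) = some (matWord B) :=
  diagOp_eq_some_iff (u := true) hA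

theorem isCrystalOn_diagonalMaps :
    IsCrystalOn (diagonalMaps m n) (symmetricMatrices m n) where
  e_mem i A hA B h := ((diagE_eq_some_iff hA).1 h).1
  f_mem i A hA B h := ((diagF_eq_some_iff hA).1 h).1
  phi_sub_eps i hi A hA := by
    rw [diagonalMaps_eps i hA, diagonalMaps_phi i hA, diagonalMaps_wt]
    exact wordPhi_sub_wordEps hi _
  coroot_zero_nonneg i hi A hA := by
    rw [diagonalMaps_wt]
    exact coroot_wordWt_nonneg hi _
  phi_add_eps i hi A hA := by
    rw [diagonalMaps_eps i hA, diagonalMaps_phi i hA, diagonalMaps_wt]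
    exact wordPhi_add_wordEps hi _
  of_e i A hA B h := by
    obtain ⟨hB, h'⟩ := (diagE_eq_some_iff hA).1 h
    rw [diagonalMaps_eps i hA, diagonalMaps_phi i hA, diagonalMaps_wt, diagonalMaps_eps i hB,
      diagonalMaps_phi i hB, diagonalMaps_wt]
    exact wordE_spec h'
  of_f i A hA B h := by
    obtain ⟨hB, h'⟩ := (diagF_eq_some_iff hA).1 h
    rw [diagonalMaps_eps i hA, diagonalMaps_phi i hA, diagonalMaps_wt, diagonalMaps_eps i hB,
      diagonalMaps_phi i hB, diagonalMaps_wt]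
    exact wordF_spec h'
  f_iff_e i A hA B hB := by
    refine (diagF_eq_some_iff hA).trans (Iff.trans ?_ (diagE_eq_some_iff hB).symm)
    rw [wordF_eq_some_iff_wordE]
    exact ⟨fun h => ⟨hA, h.2⟩, fun h => ⟨hB, h.2⟩⟩

/-- The tableau of a symmetric matrix, in the crystal given by its shape. -/
def toTableau (A : symmetricMatrices m n) :
    {x : HookPartition m n × Word m n | x.2 ∈ tableauWords m n x.1.val} :=
  ⟨(⟨shape (matTab A.val) (isTab_matTab _), rowLen_shape_le _⟩, matWord A.val),
    mem_tableauWords.2 ⟨matTab A.val, isTab_matTab _, nil_notMem_matTab _,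
      (colLen_shape (isTab_matTab A.val)).symm, rfl⟩⟩

/-- Surjectivity realises `T` by the matrix of the pair `(T, T)`. For injectivity the word alone
suffices, since it determines the tableau. -/
theorem toTableau_bijective : Function.Bijective (toTableau (m := m) (n := n)) := by
  constructor
  · rintro ⟨A, hA⟩ ⟨B, hB⟩ h
    have h1 : matTab A = matTab B := matTab_eq_of_readCols (congrArg (fun x => x.val.2) h)
    exact Subtype.ext (matTab_injective hA.1 hB.1 h1 (by rw [hA.2, hB.2, h1]))
  · rintro ⟨⟨⟨μ, hμ⟩, w⟩, hw⟩
    obtain ⟨T, hT, h0, hs, rfl⟩ := mem_tableauWords.1 hw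
    obtain ⟨A, hA, rfl⟩ := exists_symmetric hT h0
    exact ⟨⟨A, hA⟩, Subtype.ext (Prod.ext (Subtype.ext
      (youngDiagram_eq_of_colLen ((colLen_shape (isTab_matTab _)).trans hs))) rfl)⟩

theorem isomorphic_tableaux :
    Isomorphic (diagonalMaps m n) (symmetricMatrices m n) ((wordMaps m n).copies (HookPartition m n))
      {x | x.2 ∈ tableauWords m n x.1.val} := by
  refine ⟨Equiv.ofBijective _ toTableau_bijective, fun A => (diagonalMaps_wt A.val).symm,
    fun i A => (diagonalMaps_eps i A.2).symm, fun i A => (diagonalMaps_phi i A.2).symm,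
    fun i A B => ?_⟩
  refine (diagF_eq_some_iff A.2).trans ?_
  change _ ↔ (wordF i (matWord A.val)).map _ = some (toTableau B).val
  rw [Option.map_eq_some_iff]
  constructor
  · rintro ⟨_, h⟩
    -- An arrow of the direct sum stays in one summand, so the shapes of the two tableaux must
    -- agree; they do because the operators preserve column lengths.
    refine ⟨_, h, Prod.ext (Subtype.ext (youngDiagram_eq_of_colLen ?_)) rfl⟩
    obtain ⟨T, hT, h0, hl, h1⟩ := exists_tab_of_wordF (isTab_matTab _) (nil_notMem_matTab _) h
    rw [readCols_injective hT h0 (isTab_matTab _) (nil_notMem_matTab _) h1] at hl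
    exact (colLen_shape (isTab_matTab _)).trans ((colLen_eq_of_map_length hl.symm).trans (colLen_shape (isTab_matTab _)).symm)
  · rintro ⟨w, h, h'⟩
    have : w = matWord B.val := congrArg Prod.snd h'
    exact ⟨B.2, this ▸ h⟩

theorem isGreatest_powersNeZero (i : Index m n) {A : Mat m n} (hA : A ∈ symmetricMatrices m n) :
    IsGreatest (powersNeZero (diagE i) A) ((diagonalMaps m n).eps i A) ∧
      IsGreatest (powersNeZero (diagF i) A) ((diagonalMaps m n).phi i A) := by
  have h : ∀ u, IsGreatest (powersNeZero (diagOp u i) A) (sSup (powersNeZero (diagOp u i) A)) := by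
    intro u
    rw [powersNeZero_diagOp u i hA, csSup_Iic]
    exact isGreatest_Iic
  exact ⟨h false, h true⟩

end Diagonal

end HookCrystal

theorem proposition3p9 (m n : ℕ) (hmn : 0 < m + n) :
    -- the diagonal operators do not depend on the order of the two factors
    (∀ i : HookCrystal.Index m n, ∀ A ∈ HookCrystal.symmetricMatrices m n,
      (HookCrystal.matEStar i A).bind (HookCrystal.matE i) =
          (HookCrystal.matE i A).bind (HookCrystal.matEStar i) ∧
        (HookCrystal.matFStar i A).bind (HookCrystal.matF i) =
          (HookCrystal.matF i A).bind (HookCrystal.matFStar i)) ∧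
    -- the maxima that define `ε_i` and `φ_i` exist
    (∀ i : HookCrystal.Index m n, ∀ A ∈ HookCrystal.symmetricMatrices m n,
      IsGreatest (HookCrystal.powersNeZero (HookCrystal.diagE i) A)
          ((HookCrystal.diagonalMaps m n).eps i A) ∧
        IsGreatest (HookCrystal.powersNeZero (HookCrystal.diagF i) A)
          ((HookCrystal.diagonalMaps m n).phi i A)) ∧
    -- the symmetric matrices form a crystal
    HookCrystal.IsCrystalOn (HookCrystal.diagonalMaps m n) (HookCrystal.symmetricMatrices m n) ∧
    -- which decomposes as the direct sum of the crystals of tableaux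
    (∀ μ : HookCrystal.HookPartition m n,
      HookCrystal.IsCrystalOn (HookCrystal.wordMaps m n) (HookCrystal.tableauWords m n μ.val)) ∧
    HookCrystal.Isomorphic (HookCrystal.diagonalMaps m n) (HookCrystal.symmetricMatrices m n)
      ((HookCrystal.wordMaps m n).copies (HookCrystal.HookPartition m n))
      {x | x.2 ∈ HookCrystal.tableauWords m n x.1.val} := by
  exact ⟨fun i A hA => ⟨HookCrystal.matOpStar_bind_matOp_comm false i hA.1,
      HookCrystal.matOpStar_bind_matOp_comm true i hA.1⟩,
    fun i A hA => HookCrystal.isGreatest_powersNeZero i hA,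
    HookCrystal.isCrystalOn_diagonalMaps,
    fun μ => HookCrystal.isCrystalOn_tableauWords μ.val,
    HookCrystal.isomorphic_tableaux⟩
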